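/- Let $K$ be a field of characteristic $0$, let $h,g$ be formal parameters, and let $gl(2)$ be the Lie algebra of $2\times2$ matrices over $K$ with basis $Z=\mathrm{id}$, $H=\mathrm{diag}(1,-1)$, $X_+=E_{12}$, $X_-=E_{21}$, so that $[H,X_\pm]=\pm2X_\pm$, $[X_+,X_-]=H$, $[Z,\cdot]=0$. Let $U=U(gl(2))$ with its standard Hopf structure $(\Delta_0,\epsilon_0,S_0)$. Work in $U[[h,g]]$, with completed tensor products over $K[[h,g]]$, so that $U[[h,g]]\,\hat\otimes\,U[[h,g]]=(U\otimes U)[[h,g]]$. Put $$\sigma=-\ln(1-2hX_+),\qquad \mathcal F=\exp\Bigl(\tfrac{g}{2h}\,\sigma\otimes Z\Bigr)\exp\Bigl(-\tfrac12 H\otimes\sigma\Bigr).$$ All quotients by $h$ here and below are quotients of series divisible by $h$. 1. (Twist.) $\mathcal F$ is invertible, $(\epsilon_0\otimes\mathrm{id})(\mathcal F)=(\mathrm{id}\otimes\epsilon_0)(\mathcal F)=1$, and $\mathcal F_{12}(\Delta_0\otimes\mathrm{id})(\mathcal F)=\mathcal F_{23}(\mathrm{id}\otimes\Delta_0)(\mathcal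 F)$. The element $u=m(\mathrm{id}\otimes S_0)(\mathcal F)$ is invertible. The algebra $U[[h,g]]$ with $\Delta=\mathcal F\Delta_0\mathcal F^{-1}$, $\epsilon=\epsilon_0$, $S=uS_0u^{-1}$ is a topological Hopf algebra over $K[[h,g]]$, denoted $\mathcal U_{h,g}(gl(2))$. It is triangular with universal R-matrix $\mathcal R=\mathcal F_{21}\mathcal F^{-1}$: $\mathcal R\Delta(x)=\Delta^{op}(x)\mathcal R$, $(\Delta\otimes\mathrm{id})\mathcal R=\mathcal R_{13}\mathcal R_{23}$, $(\mathrm{id}\otimes\Delta)\mathcal R=\mathcal R_{13}\mathcal R_{12}$, $\mathcal R_{21}\mathcal R=1$, and $$\mathcal R=\exp\Bigl(\tfrac{g}{2h}Z\otimes\sigma\Bigr)\exp\Bigl(-\tfrac12\sigma\otimes H\Bigr)\exp\Bigl(\tfrac12H\otimes\sigma\Bigr)\exp\Bigl(-\tfrac{g}{2h}\sigma\otimes Z\Bigr).$$ 2. (Explicit structure.) $\epsilon(Z)=\epsilon(H)=\epsilon(X_\pm)=0$, and $$\begin{aligned} \Delta(Z)&=Z\otimes1+1\otimes Z,\\ \Delta(H)&=H\otimes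 e^\sigma+1\otimes H+\tfrac gh(1-e^\sigma)\otimes Ze^\sigma,\\ \Delta(X_+)&=X_+\otimes1+e^{-\sigma}\otimes X_+,\\ \Delta(X_-)&=X_-\otimes e^\sigma+1\otimes X_--hH\otimes e^\sigma H-\tfrac h2H(H+2)\otimes e^\sigma(e^\sigma-1)\\ &\quad+g(e^\sigma-1)\otimes Ze^\sigma H+g(H-e^\sigma+1)\otimes Ze^\sigma+g(e^\sigma-1)(H+e^\sigma+1)\otimes Ze^{2\sigma}\\ &\quad-\tfrac{g^2}{2h}(e^\sigma-1)\otimes Z^2e^\sigma-\tfrac{g^2}{2h}(e^\sigma-1)^2\otimes Z^2e^{2\sigma},\\ S(Z)&=-Z,\qquad S(H)=-He^{-\sigma}+\tfrac ghZ(e^{-\sigma}-1),\qquad S(X_+)=-X_+e^\sigma,\\ S(X_-)&=-\Bigl\{X_-+\tfrac h2H^2(e^{-\sigma}+1)-hH(e^{-\sigma}-1)-gHZe^{-\sigma}\\ &\qquad+gZ(e^{-\sigma}-1)+\tfrac{g^2}{2h}(e^{-\sigma}-1)Z^2\Bigr\}e^{-\sigma}. \end{aligned}$$ 3. (Jordanian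 form.) Put $A=Z$, $H'=e^{-\sigma/2}H$, $X=\frac1{2h}\sigma$, $Y=e^{-\sigma/2}\bigl(X_-+\frac h2H^2\bigr)-\frac h8e^{\sigma/2}(e^{-\sigma}-1)$. Then $$[X,Y]=H',\quad [H',X]=\tfrac{2\sinh hX}{h},\quad [H',Y]=-Y\cosh hX-\cosh hX\,Y,\quad [A,\cdot]=0,$$ $$\begin{aligned} \Delta(A)&=A\otimes1+1\otimes A,\qquad \Delta(X)=X\otimes1+1\otimes X,\\ \Delta(H')&=H'\otimes e^{hX}+e^{-hX}\otimes H'-\tfrac{2g}h\sinh hX\otimes Ae^{hX},\\ \Delta(Y)&=Y\otimes e^{hX}+e^{-hX}\otimes Y-\tfrac{g^2}h\sinh hX\otimes A^2e^{hX}+gH'\otimes Ae^{hX},\\ S(A)&=-A,\qquad S(X)=-X,\\ S(H')&=-e^{hX}H'e^{-hX}-\tfrac{2g}h(\sinh hX)A,\\ S(Y)&=-e^{hX}Ye^{-hX}+\tfrac{g^2}h(\sinh hX)A^2+ge^{hX}H'Ae^{-hX}, \end{aligned}$$ and $\epsilon$ vanishes on $A,H',X,Y$. 4. (Identification.) $\mathcal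 U_{h,g}(gl(2))$ is the Jordanian Hopf algebra defined by generators $A,H',X,Y$ with these relations and structure maps. That is, the continuous $K[[h,g]]$-algebra map $\pi:K\langle A,H',X,Y\rangle[[h,g]]\to U[[h,g]]$ given by the elements of part 3 is surjective, its kernel is the $(h,g)$-adic closure of the two-sided ideal generated by the relations $[X,Y]=H'$, $[H',X]=\frac{2\sinh hX}h$, $[H',Y]=-Y\cosh hX-\cosh hX\,Y$, $[A,X]=[A,Y]=[A,H']=0$; and $\pi$ intertwines the coproduct, counit and antipode of part 3, extended (anti)multiplicatively and continuously from the free generators, with $\Delta$, $\epsilon$, $S$. -/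

import Mathlib

open scoped TensorProduct

attribute [local instance] LieRing.ofAssociativeRing LieAlgebra.ofAssociativeAlgebra

noncomputable section

namespace JordanianTwist

/-! ### Formal power series in the two deformation parameters -/

/-- `FPS A` is `A[[h,g]]`: formal power series in two central variables `h` and `g` over a possibly
noncommutative ring `A`. The completed tensor product over `K[[h,g]]` of `A[[h,g]]` and `B[[h,g]]`
is `(A ⊗ B)[[h,g]]`. -/
abbrev FPS (A : Type*) : Type _ := MvPowerSeries (Fin 2) A

section Series

/-- The deformation parameter `h`. -/
def parH {A : Type*} [Ring A] : FPS A := MvPowerSeries.X 0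

/-- The deformation parameter `g`. -/
def parG {A : Type*} [Ring A] : FPS A := MvPowerSeries.X 1

/-- The inclusion of scalars `K[[h,g]] → A[[h,g]]`. -/
def base (K : Type*) [Field K] (A : Type*) [Ring A] [Algebra K A] : FPS K →+* FPS A :=
  MvPowerSeries.map (algebraMap K A)

/-- The constant series attached to an element of `A`. -/
def const {A : Type*} [Ring A] (a : A) : FPS A := MvPowerSeries.C a

/-- `const` as a `K`-linear map. -/
def constL {K : Type*} [Field K] (A : Type*) [Ring A] [Algebra K A] : A →ₗ[K] FPS A where
  toFun := const
  map_add' x y := by simp [const]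
  map_smul' c x := by
    classical
    ext d
    change MvPowerSeries.coeff d (MvPowerSeries.C (c • x)) =
      c • MvPowerSeries.coeff d (MvPowerSeries.C x)
    rw [MvPowerSeries.coeff_C, MvPowerSeries.coeff_C]
    split_ifs <;> simp

/-- Division by `h`: for a multiple `x` of `h` this is the unique series `y` with `h * y = x`
(see `parH_mul_divH`). -/
def divH {A : Type*} (x : FPS A) : FPS A := fun d => x (d + Finsupp.single 0 1)

theorem coeff_parH_mul {A : Type*} [Ring A] (y : FPS A) (d : Fin 2 →₀ ℕ) :
    MvPowerSeries.coeff d (parH * y) =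
      if Finsupp.single 0 1 ≤ d then MvPowerSeries.coeff (d - Finsupp.single 0 1) y else 0 := by
  rw [parH, MvPowerSeries.X, MvPowerSeries.coeff_monomial_mul]
  simp

theorem parH_mul_divH {A : Type*} [Ring A] (x : FPS A)
    (hx : ∀ d : Fin 2 →₀ ℕ, d 0 = 0 → MvPowerSeries.coeff d x = 0) : parH * divH x = x := by
  ext d
  by_cases hd : d 0 = 0
  · rw [hx d hd, coeff_parH_mul, if_neg]
    intro hle
    have := hle 0
    simp [hd] at this
  · have hle : Finsupp.single (0 : Fin 2) 1 ≤ d := by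
      rw [Finsupp.single_le_iff]; omega
    rw [coeff_parH_mul, if_pos hle]
    change x (d - Finsupp.single 0 1 + Finsupp.single 0 1) = x d
    rw [tsub_add_cancel_of_le hle]

theorem divH_parH_mul {A : Type*} [Ring A] (y : FPS A) : divH (parH * y) = y := by
  ext d
  change MvPowerSeries.coeff (d + Finsupp.single 0 1) (parH * y) = _
  rw [coeff_parH_mul, if_pos (by simp)]
  simp

/-- `f(x) = ∑ fₙ xⁿ` for a one-variable series `f` and a series `x` without constant term; as `xⁿ`
has no terms of total degree below `n`, only `n ≤ |d|` contribute to the coefficient at `d`. -/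
def evalSeries {K : Type*} [Field K] {A : Type*} [Ring A] [Algebra K A]
    (f : PowerSeries K) (x : FPS A) : FPS A := fun d =>
  ∑ n ∈ Finset.range (d.degree + 1), PowerSeries.coeff n f • MvPowerSeries.coeff d (x ^ n)

variable (K : Type*) [Field K]

/-- `exp x`, for a series `x` without constant term. -/
def fexp [CharZero K] {A : Type*} [Ring A] [Algebra K A] (x : FPS A) : FPS A :=
  evalSeries (PowerSeries.exp K) x

/-- `-ln (1 - x) = ∑_{n ≥ 1} xⁿ / n`, for a series `x` without constant term. -/
def negLogOneSub {A : Type*} [Ring A] [Algebra K A] (x : FPS A) : FPS A :=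
  evalSeries (PowerSeries.mk fun n => if n = 0 then (0 : K) else (n : K)⁻¹) x

def fsinh [CharZero K] {A : Type*} [Ring A] [Algebra K A] (x : FPS A) : FPS A :=
  (1 / 2 : K) • (fexp K x - fexp K (-x))

def fcosh [CharZero K] {A : Type*} [Ring A] [Algebra K A] (x : FPS A) : FPS A :=
  (1 / 2 : K) • (fexp K x + fexp K (-x))

variable {K} {A B C D : Type*} [Ring A] [Algebra K A] [Ring B] [Algebra K B]
  [Ring C] [Algebra K C] [Ring D] [Algebra K D]

/-- A `K`-linear map applied to every coefficient. -/
def mapL (f : A →ₗ[K] B) : FPS A →ₗ[K] FPS B where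
  toFun x := fun d => f (x d)
  map_add' x y := by funext d; exact map_add f (x d) (y d)
  map_smul' c x := by funext d; exact map_smul f c (x d)

/-- The `K[[h,g]]`-linear (hence `(h,g)`-adically continuous) extension `A[[h,g]] → B[[h,g]]` of a
`K`-linear map `φ : A → B[[h,g]]`. -/
def extend (φ : A →ₗ[K] FPS B) : FPS A →ₗ[K] FPS B where
  toFun x := fun d => ∑ p ∈ Finset.HasAntidiagonal.antidiagonal d,
    MvPowerSeries.coeff p.2 (φ (MvPowerSeries.coeff p.1 x))
  map_add' x y := by
    funext d
    refine Eq.trans (Finset.sum_congr rfl fun p _ => ?_) Finset.sum_add_distrib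
    rw [map_add, map_add, map_add]
  map_smul' c x := by
    funext d
    refine Eq.trans (Finset.sum_congr rfl fun p _ => ?_) (Finset.smul_sum (r := c)).symm
    have h1 : MvPowerSeries.coeff p.1 (c • x) = c • MvPowerSeries.coeff p.1 x := rfl
    rw [h1, map_smul]
    rfl

variable (K) in
/-- The element `a ⊗ b` of `(A ⊗ B)[[h,g]]`, for `a` in `A[[h,g]]` and `b` in `B[[h,g]]`. -/
def tens (a : FPS A) (b : FPS B) : FPS (A ⊗[K] B) := fun d =>
  ∑ p ∈ Finset.HasAntidiagonal.antidiagonal d, MvPowerSeries.coeff p.1 a ⊗ₜ[K] MvPowerSeries.coeff p.2 b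

notation:70 a:70 " ⊠[" K "] " b:71 => tens K a b

variable (K A B) in
/-- `a, b ↦ a ⊗ b` as a `K`-bilinear map. -/
def tensL : FPS A →ₗ[K] FPS B →ₗ[K] FPS (A ⊗[K] B) :=
  LinearMap.mk₂ K (tens K)
    (fun a a' b => by
      funext d
      refine Eq.trans (Finset.sum_congr rfl fun p _ => ?_) Finset.sum_add_distrib
      rw [map_add, TensorProduct.add_tmul])
    (fun c a b => by
      funext d
      refine Eq.trans (Finset.sum_congr rfl fun p _ => ?_) (Finset.smul_sum (r := c)).symm
      rfl)
    (fun a b b' => by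
      funext d
      refine Eq.trans (Finset.sum_congr rfl fun p _ => ?_) Finset.sum_add_distrib
      rw [map_add, TensorProduct.tmul_add])
    (fun c a b => by
      funext d
      refine Eq.trans (Finset.sum_congr rfl fun p _ => ?_) (Finset.smul_sum (r := c)).symm
      have h1 : MvPowerSeries.coeff p.2 (c • b) = c • MvPowerSeries.coeff p.2 b := rfl
      rw [h1, TensorProduct.tmul_smul])

/-- The completed tensor product `f ⊗ g : (A ⊗ C)[[h,g]] → (B ⊗ D)[[h,g]]` of two
`K[[h,g]]`-linear maps `f : A[[h,g]] → B[[h,g]]` and `g : C[[h,g]] → D[[h,g]]`: the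
`K[[h,g]]`-linear extension of `a ⊗ c ↦ f a ⊗ g c`. -/
def tensMap (f : FPS A →ₗ[K] FPS B) (g : FPS C →ₗ[K] FPS D) :
    FPS (A ⊗[K] C) →ₗ[K] FPS (B ⊗[K] D) :=
  extend (TensorProduct.lift ((tensL K B D).compl₁₂
    (f ∘ₗ constL A) (g ∘ₗ constL C)))

end Series

/-! ### Topological Hopf algebras on `A[[h,g]]` and Drinfeld twists -/

section Hopf

variable {K : Type*} [Field K] {A : Type*} [Ring A] [Algebra K A]

/-- `x₁₂ = x ⊗ 1`. -/
def leg12 : FPS (A ⊗[K] A) →ₗ[K] FPS (A ⊗[K] A ⊗[K] A) :=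
  mapL (Algebra.TensorProduct.includeLeft :
    A ⊗[K] A →ₐ[K] A ⊗[K] A ⊗[K] A).toLinearMap

/-- `x₁₃`: the map `a ⊗ b ↦ a ⊗ 1 ⊗ b`. -/
def leg13 : FPS (A ⊗[K] A) →ₗ[K] FPS (A ⊗[K] A ⊗[K] A) :=
  mapL (TensorProduct.map (Algebra.TensorProduct.includeLeft : A →ₐ[K] A ⊗[K] A).toLinearMap
    LinearMap.id)

/-- `x₂₃ = 1 ⊗ x`. -/
def leg23 : FPS (A ⊗[K] A) →ₗ[K] FPS (A ⊗[K] A ⊗[K] A) :=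
  mapL (TensorProduct.map (Algebra.TensorProduct.includeRight : A →ₐ[K] A ⊗[K] A).toLinearMap
    LinearMap.id)

/-- `x₂₁`: the flip `a ⊗ b ↦ b ⊗ a`. -/
def flip : FPS (A ⊗[K] A) →ₗ[K] FPS (A ⊗[K] A) :=
  mapL (TensorProduct.comm K A A).toLinearMap

/-- The multiplication `a ⊗ b ↦ a b`. -/
def mulMap : FPS (A ⊗[K] A) →ₗ[K] FPS A := mapL (LinearMap.mul' K A)

/-- Regrouping `a ⊗ (b ⊗ c) ↦ (a ⊗ b) ⊗ c`. -/
def regroup : FPS (A ⊗[K] (A ⊗[K] A)) →ₗ[K] FPS (A ⊗[K] A ⊗[K] A) :=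
  mapL (TensorProduct.assoc K A A A).symm.toLinearMap

/-- `Δ`, `ε`, `S` make the `K[[h,g]]`-algebra `A[[h,g]]` a topological Hopf algebra over
`K[[h,g]]`: `Δ` and `ε` are homomorphisms of unital `K[[h,g]]`-algebras, `Δ` is coassociative with
counit `ε`, and `S` is `K[[h,g]]`-linear and the convolution inverse of the identity. -/
structure IsTopHopf (Δ : FPS A →ₗ[K] FPS (A ⊗[K] A)) (ε : FPS A →ₗ[K] FPS K)
    (S : FPS A →ₗ[K] FPS A) : Prop where
  comul_base (c : FPS K) : Δ (base K A c) = base K (A ⊗[K] A) c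
  comul_mul (x y : FPS A) : Δ (x * y) = Δ x * Δ y
  counit_base (c : FPS K) : ε (base K A c) = c
  counit_mul (x y : FPS A) : ε (x * y) = ε x * ε y
  antipode_base_mul (c : FPS K) (x : FPS A) : S (base K A c * x) = base K A c * S x
  coassoc (x : FPS A) :
    tensMap Δ LinearMap.id (Δ x) = regroup (tensMap LinearMap.id Δ (Δ x))
  counit_left (x : FPS A) :
    mapL (TensorProduct.lid K A).toLinearMap (tensMap ε LinearMap.id (Δ x)) = x
  counit_right (x : FPS A) :
    mapL (TensorProduct.rid K A).toLinearMap (tensMap LinearMap.id ε (Δ x)) = x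
  antipode_left (x : FPS A) : mulMap (tensMap S LinearMap.id (Δ x)) = base K A (ε x)
  antipode_right (x : FPS A) : mulMap (tensMap LinearMap.id S (Δ x)) = base K A (ε x)

/-- `R` is a universal R-matrix for the coproduct `Δ`, and it is triangular. -/
structure IsTriangular (Δ : FPS A →ₗ[K] FPS (A ⊗[K] A)) (R : FPS (A ⊗[K] A)) : Prop where
  isUnit : IsUnit R
  intertwines (x : FPS A) : R * Δ x = flip (Δ x) * R
  comul_left : tensMap Δ LinearMap.id R = leg13 R * leg23 R
  comul_right : regroup (tensMap LinearMap.id Δ R) = leg13 R * leg12 R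
  triangular : flip R * R = 1

/-- `F` is an invertible normalised 2-cocycle (twist element) for the coproduct `Δ₀` and counit
`ε₀` of `A`, extended coefficientwise to `A[[h,g]]`. -/
structure IsTwist (Δ₀ : A →ₗ[K] A ⊗[K] A) (ε₀ : A →ₗ[K] K) (F : FPS (A ⊗[K] A)) : Prop where
  isUnit : IsUnit F
  counit_left : mapL ((TensorProduct.lid K A).toLinearMap ∘ₗ ε₀.rTensor A) F = 1
  counit_right : mapL ((TensorProduct.rid K A).toLinearMap ∘ₗ ε₀.lTensor A) F = 1
  cocycle : leg12 F * mapL (Δ₀.rTensor A) F = leg23 F * regroup (mapL (Δ₀.lTensor A) F)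

/-- The twisted coproduct `x ↦ F Δ₀(x) F⁻¹`. -/
def twistComul (Δ₀ : A →ₗ[K] A ⊗[K] A) (F : FPS (A ⊗[K] A)) : FPS A →ₗ[K] FPS (A ⊗[K] A) :=
  LinearMap.mulLeft K F ∘ₗ LinearMap.mulRight K (Ring.inverse F) ∘ₗ mapL Δ₀

/-- The element `u = m (id ⊗ S₀)(F)`. -/
def twistU (S₀ : A →ₗ[K] A) (F : FPS (A ⊗[K] A)) : FPS A := mulMap (mapL (S₀.lTensor A) F)

/-- The twisted antipode `x ↦ u S₀(x) u⁻¹`. -/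
def twistAntipode (S₀ : A →ₗ[K] A) (F : FPS (A ⊗[K] A)) : FPS A →ₗ[K] FPS A :=
  LinearMap.mulLeft K (twistU S₀ F) ∘ₗ LinearMap.mulRight K (Ring.inverse (twistU S₀ F)) ∘ₗ mapL S₀

/-- The twist `F₂₁ R₀ F⁻¹` of the trivial R-matrix `R₀ = 1 ⊗ 1` of a cocommutative Hopf algebra. -/
def twistR (F : FPS (A ⊗[K] A)) : FPS (A ⊗[K] A) := flip F * Ring.inverse F

end Hopf

/-! ### `U(gl(2))` and its twist -/

section GL2

variable (K : Type*) [Field K]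

/-- `U(gl(2))`. -/
abbrev U : Type _ := UniversalEnvelopingAlgebra K (Matrix (Fin 2) (Fin 2) K)

/-- The inclusion `gl(2) → U(gl(2))`. -/
abbrev inc : Matrix (Fin 2) (Fin 2) K →ₗ⁅K⁆ U K := UniversalEnvelopingAlgebra.ι K

/-- The coproduct of `U(gl(2))`: `x ↦ x ⊗ 1 + 1 ⊗ x` on `gl(2)`. -/
def comul₀ : U K →ₐ[K] U K ⊗[K] U K :=
  UniversalEnvelopingAlgebra.lift K
    { toFun := fun x => inc K x ⊗ₜ[K] 1 + 1 ⊗ₜ[K] inc K x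
      map_add' := fun x y => by
        simp only [map_add, TensorProduct.add_tmul, TensorProduct.tmul_add]; abel
      map_smul' := fun c x => by
        simp only [map_smul, TensorProduct.smul_tmul', TensorProduct.tmul_smul, smul_add,
          RingHom.id_apply]
      map_lie' := fun {x y} => by
        rw [LieHom.map_lie]
        simp only [LieRing.of_associative_ring_bracket, TensorProduct.sub_tmul,
          TensorProduct.tmul_sub, mul_add, add_mul, Algebra.TensorProduct.tmul_mul_tmul, one_mul,
          mul_one]
        abel }

/-- The counit of `U(gl(2))`: zero on `gl(2)`. -/
def counit₀ : U K →ₐ[K] K :=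
  UniversalEnvelopingAlgebra.lift K (0 : Matrix (Fin 2) (Fin 2) K →ₗ⁅K⁆ K)

/-- The antipode of `U(gl(2))`, as a homomorphism to the opposite algebra: `x ↦ -x` on `gl(2)`. -/
def antipodeOp₀ : U K →ₐ[K] (U K)ᵐᵒᵖ :=
  UniversalEnvelopingAlgebra.lift K
    { toFun := fun x => MulOpposite.op (-inc K x)
      map_add' := fun x y => by
        apply MulOpposite.unop_injective
        simp only [map_add, MulOpposite.unop_op, MulOpposite.unop_add]; abel
      map_smul' := fun c x => by
        apply MulOpposite.unop_injective
        simp only [map_smul, MulOpposite.unop_op, MulOpposite.unop_smul, RingHom.id_apply, smul_neg]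
      map_lie' := fun {x y} => by
        apply MulOpposite.unop_injective
        rw [LieHom.map_lie]
        simp only [LieRing.of_associative_ring_bracket, MulOpposite.unop_op,
          MulOpposite.unop_sub, MulOpposite.unop_mul]
        noncomm_ring }

/-- The antipode of `U(gl(2))`. -/
def antipode₀ : U K →ₗ[K] U K :=
  (MulOpposite.opLinearEquiv K).symm.toLinearMap ∘ₗ (antipodeOp₀ K).toLinearMap

/-- The central generator `Z`: the identity matrix. -/
def Z : FPS (U K) := const (inc K !![1, 0; 0, 1])

def H : FPS (U K) := const (inc K !![1, 0; 0, -1])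

def Xp : FPS (U K) := const (inc K !![0, 1; 0, 0])

def Xm : FPS (U K) := const (inc K !![0, 0; 1, 0])

/-- `σ = -ln (1 - 2 h X₊)`. -/
def σ : FPS (U K) := negLogOneSub K (2 * parH * Xp K)

/-- The (undeformed) counit. -/
def ε : FPS (U K) →ₗ[K] FPS K := mapL (counit₀ K).toLinearMap

variable [CharZero K]

/-- The twist element `F = exp ((g / 2h) σ ⊗ Z) exp (-(1/2) H ⊗ σ)`. -/
def F : FPS (U K ⊗[K] U K) :=
  fexp K ((1 / 2 : K) • (parG * (divH (σ K) ⊠[K] Z K))) * fexp K (-((1 / 2 : K) • (H K ⊠[K] σ K)))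

/-- The coproduct of the twisted algebra. -/
def Δ : FPS (U K) →ₗ[K] FPS (U K ⊗[K] U K) := twistComul (comul₀ K).toLinearMap (F K)

/-- The antipode of the twisted algebra. -/
def S : FPS (U K) →ₗ[K] FPS (U K) := twistAntipode (antipode₀ K) (F K)

/-- `e^σ`. -/
def eσ : FPS (U K) := fexp K (σ K)

/-- `e^{-σ}`. -/
def eσm : FPS (U K) := fexp K (-σ K)

/-- `e^{σ/2}`. -/
def eσh : FPS (U K) := fexp K ((1 / 2 : K) • σ K)

/-- `e^{-σ/2}`. -/
def eσmh : FPS (U K) := fexp K (-((1 / 2 : K) • σ K))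

/-- `A = Z`. -/
def jA : FPS (U K) := Z K

/-- `H' = e^{-σ/2} H`. -/
def jH : FPS (U K) := eσmh K * H K

/-- `X = σ / (2h)`. -/
def jX : FPS (U K) := (1 / 2 : K) • divH (σ K)

/-- `Y = e^{-σ/2} (X₋ + (h/2) H²) - (h/8) e^{σ/2} (e^{-σ} - 1)`. -/
def jY : FPS (U K) :=
  eσmh K * (Xm K + (1 / 2 : K) • (parH * H K ^ 2)) -
    (1 / 8 : K) • (parH * eσh K * (eσm K - 1))

end GL2

/-! ### The Jordanian algebra by generators and relations -/

section Jordanian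

variable (K : Type*) [Field K]

/-- The free algebra on `A, H', X, Y` (indexed by `0, 1, 2, 3`). -/
abbrev Free : Type _ := FreeAlgebra K (Fin 4)

/-- The free generators as constant series. -/
def gen (i : Fin 4) : FPS (Free K) := const (FreeAlgebra.ι K i)

/-- The Jordanian counit: the algebra homomorphism that vanishes on the generators. -/
def freeε : FPS (Free K) →ₗ[K] FPS K :=
  mapL (FreeAlgebra.lift K (fun _ : Fin 4 => (0 : K))).toLinearMap

variable [CharZero K]

/-- The relations `[X,Y] = H'`, `[H',X] = 2 sinh(hX) / h`, `[H',Y] = -Y cosh(hX) - cosh(hX) Y`,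
`[A,X] = [A,Y] = [A,H'] = 0`. -/
def relators (A H X Y : FPS (Free K)) : Set (FPS (Free K)) :=
  { X * Y - Y * X - H,
    H * X - X * H - 2 * divH (fsinh K (parH * X)),
    H * Y - Y * H + Y * fcosh K (parH * X) + fcosh K (parH * X) * Y,
    A * X - X * A, A * Y - Y * A, A * H - H * A }

/-- The two-sided ideal of `K⟨A,H',X,Y⟩[[h,g]]` generated by the relations. -/
def relIdeal : TwoSidedIdeal (FPS (Free K)) :=
  TwoSidedIdeal.span (relators K (gen K 0) (gen K 1) (gen K 2) (gen K 3))

/-- The `(h,g)`-adic closure of `relIdeal`. The quotient of `K⟨A,H',X,Y⟩[[h,g]]` by it is the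
topological algebra presented by the Jordanian relations. -/
def relClosure : Set (FPS (Free K)) :=
  {x | ∀ n : ℕ, ∃ y ∈ relIdeal K, ∀ d : Fin 2 →₀ ℕ, d.degree < n →
    MvPowerSeries.coeff d x = MvPowerSeries.coeff d y}

/-- The continuous `K[[h,g]]`-algebra homomorphism `K⟨A,H',X,Y⟩[[h,g]] → U(gl(2))[[h,g]]` with the
given values on the generators. -/
def present : FPS (Free K) →ₗ[K] FPS (U K) :=
  extend (FreeAlgebra.lift K ![jA K, jH K, jX K, jY K]).toLinearMap

/-- The Jordanian coproduct on generators. -/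
def jorComul (A H X Y : FPS (Free K)) : Fin 4 → FPS (Free K ⊗[K] Free K) :=
  ![A ⊠[K] 1 + 1 ⊠[K] A,
    H ⊠[K] fexp K (parH * X) + fexp K (-(parH * X)) ⊠[K] H
      - 2 * parG * (divH (fsinh K (parH * X)) ⊠[K] (A * fexp K (parH * X))),
    X ⊠[K] 1 + 1 ⊠[K] X,
    Y ⊠[K] fexp K (parH * X) + fexp K (-(parH * X)) ⊠[K] Y
      - parG ^ 2 * (divH (fsinh K (parH * X)) ⊠[K] (A ^ 2 * fexp K (parH * X)))
      + parG * (H ⊠[K] (A * fexp K (parH * X)))]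

/-- The Jordanian antipode on generators. -/
def jorAntipode (A H X Y : FPS (Free K)) : Fin 4 → FPS (Free K) :=
  ![-A,
    -(fexp K (parH * X) * H * fexp K (-(parH * X)))
      - 2 * parG * divH (fsinh K (parH * X)) * A,
    -X,
    -(fexp K (parH * X) * Y * fexp K (-(parH * X)))
      + parG ^ 2 * divH (fsinh K (parH * X)) * A ^ 2
      + parG * fexp K (parH * X) * H * A * fexp K (-(parH * X))]

/-- The Jordanian coproduct, extended multiplicatively to the free algebra. -/
def freeΔ : FPS (Free K) →ₗ[K] FPS (Free K ⊗[K] Free K) :=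
  extend (FreeAlgebra.lift K
    (jorComul K (gen K 0) (gen K 1) (gen K 2) (gen K 3))).toLinearMap

/-- The Jordanian antipode, extended antimultiplicatively to the free algebra. -/
def freeS : FPS (Free K) →ₗ[K] FPS (Free K) :=
  extend ((MulOpposite.opLinearEquiv K).symm.toLinearMap ∘ₗ
    (FreeAlgebra.lift K fun i => MulOpposite.op
      (jorAntipode K (gen K 0) (gen K 1) (gen K 2) (gen K 3) i)).toLinearMap)

end Jordanian

/-! ### The explicit formulas -/

section Formulas

variable (K : Type*) [Field K] [CharZero K]

/-- The series whose quotients by `h` occur below are divisible by `h`. -/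
structure Divisibility : Prop where
  sigma : parH * divH (σ K) = σ K
  exp_sub_one : parH * divH (eσ K - 1) = eσ K - 1
  exp_neg_sub_one : parH * divH (eσm K - 1) = eσm K - 1
  sinh : parH * divH (fsinh K (parH * jX K)) = fsinh K (parH * jX K)
  sinh_free : parH * divH (fsinh K (parH * gen K 2)) = fsinh K (parH * gen K 2)

/-- Relations, coproduct, counit and antipode of `Z, H, X₊, X₋` in the twisted algebra. -/
structure GeneratorFormulas : Prop where
  H_Xp : H K * Xp K - Xp K * H K = 2 * Xp K
  H_Xm : H K * Xm K - Xm K * H K = -2 * Xm K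
  Xp_Xm : Xp K * Xm K - Xm K * Xp K = H K
  Z_central : ∀ x : FPS (U K), Z K * x = x * Z K
  comul_Z : Δ K (Z K) = Z K ⊠[K] 1 + 1 ⊠[K] Z K
  comul_H : Δ K (H K) = H K ⊠[K] eσ K + 1 ⊠[K] H K
    + parG * (divH (1 - eσ K) ⊠[K] (Z K * eσ K))
  comul_Xp : Δ K (Xp K) = Xp K ⊠[K] 1 + eσm K ⊠[K] Xp K
  comul_Xm : Δ K (Xm K) = Xm K ⊠[K] eσ K + 1 ⊠[K] Xm K
    - parH * (H K ⊠[K] (eσ K * H K))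
    - (1 / 2 : K) • (parH * ((H K * (H K + 2)) ⊠[K] (eσ K * (eσ K - 1))))
    + parG * ((eσ K - 1) ⊠[K] (Z K * eσ K * H K))
    + parG * ((H K - eσ K + 1) ⊠[K] (Z K * eσ K))
    + parG * (((eσ K - 1) * (H K + eσ K + 1)) ⊠[K] (Z K * eσ K ^ 2))
    - (1 / 2 : K) • (parG ^ 2 * (divH (eσ K - 1) ⊠[K] (Z K ^ 2 * eσ K)))
    - (1 / 2 : K) • (parG ^ 2 * (divH ((eσ K - 1) ^ 2) ⊠[K] (Z K ^ 2 * eσ K ^ 2)))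
  counit_Z : ε K (Z K) = 0
  counit_H : ε K (H K) = 0
  counit_Xp : ε K (Xp K) = 0
  counit_Xm : ε K (Xm K) = 0
  antipode_Z : S K (Z K) = -Z K
  antipode_H : S K (H K) = -(H K * eσm K) + parG * Z K * divH (eσm K - 1)
  antipode_Xp : S K (Xp K) = -(Xp K * eσ K)
  antipode_Xm : S K (Xm K) = -((Xm K + (1 / 2 : K) • (parH * H K ^ 2 * (eσm K + 1))
    - parH * H K * (eσm K - 1) - parG * H K * Z K * eσm K + parG * Z K * (eσm K - 1)
    + (1 / 2 : K) • (parG ^ 2 * divH (eσm K - 1) * Z K ^ 2)) * eσm K)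

/-- Relations, coproduct, counit and antipode of `A, H', X, Y` in the twisted algebra. -/
structure JordanianFormulas : Prop where
  X_Y : jX K * jY K - jY K * jX K = jH K
  H_X : jH K * jX K - jX K * jH K = 2 * divH (fsinh K (parH * jX K))
  H_Y : jH K * jY K - jY K * jH K
    = -(jY K * fcosh K (parH * jX K)) - fcosh K (parH * jX K) * jY K
  A_central : ∀ x : FPS (U K), jA K * x = x * jA K
  comul_A : Δ K (jA K) = jA K ⊠[K] 1 + 1 ⊠[K] jA K
  comul_H : Δ K (jH K) =
    jH K ⊠[K] fexp K (parH * jX K) + fexp K (-(parH * jX K)) ⊠[K] jH K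
      - 2 * parG * (divH (fsinh K (parH * jX K)) ⊠[K] (jA K * fexp K (parH * jX K)))
  comul_X : Δ K (jX K) = jX K ⊠[K] 1 + 1 ⊠[K] jX K
  comul_Y : Δ K (jY K) =
    jY K ⊠[K] fexp K (parH * jX K) + fexp K (-(parH * jX K)) ⊠[K] jY K
      - parG ^ 2 * (divH (fsinh K (parH * jX K)) ⊠[K] (jA K ^ 2 * fexp K (parH * jX K)))
      + parG * (jH K ⊠[K] (jA K * fexp K (parH * jX K)))
  counit_A : ε K (jA K) = 0
  counit_H : ε K (jH K) = 0
  counit_X : ε K (jX K) = 0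
  counit_Y : ε K (jY K) = 0
  antipode_A : S K (jA K) = -jA K
  antipode_X : S K (jX K) = -jX K
  antipode_H : S K (jH K) = -(fexp K (parH * jX K) * jH K * fexp K (-(parH * jX K)))
    - 2 * parG * divH (fsinh K (parH * jX K)) * jA K
  antipode_Y : S K (jY K) = -(fexp K (parH * jX K) * jY K * fexp K (-(parH * jX K)))
    + parG ^ 2 * divH (fsinh K (parH * jX K)) * jA K ^ 2
    + parG * fexp K (parH * jX K) * jH K * jA K * fexp K (-(parH * jX K))

/-- The map `present` is a surjective algebra homomorphism whose kernel is the closed ideal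
generated by the Jordanian relations, and under it the Jordanian structure maps on the generators
correspond to the structure maps of the twisted algebra. -/
structure JordanianPresentation : Prop where
  map_gen : ∀ i, present K (gen K i) = ![jA K, jH K, jX K, jY K] i
  map_base : ∀ c : FPS K, present K (base K (Free K) c) = base K (U K) c
  map_mul : ∀ x y, present K (x * y) = present K x * present K y
  surjective : Function.Surjective (present K)
  kernel : ∀ x, present K x = 0 ↔ x ∈ relClosure K
  comul : ∀ x, Δ K (present K x) = tensMap (present K) (present K) (freeΔ K x)
  counit : ∀ x, ε K (present K x) = freeε K x
  antipode : ∀ x, S K (present K x) = present K (freeS K x)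

end Formulas

end JordanianTwist

end

open JordanianTwist

/-!
Write `U` for `U(gl(2))`. All objects are series in `h, g` with coefficients in an algebra, and all
maps between them are `K[[h,g]]`-linear, hence continuous for the filtration `filt` by total degree
(`IsCts`). A continuous map is determined by its values on constant series (`IsCts.ext`,
`IsCts.ext_tmul`), so an identity between continuous maps is checked on elements of the underlying
algebra, and an identity between continuous algebra maps on generators.

**The twist.** `F = abelianFactor * jordanFactor` with `jordanFactor = exp (-(1/2) H ⊗ σ)` and
`abelianFactor = exp ((g/2h) σ ⊗ Z)`. The commutators of `σ` with the generators follow from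
`evalSeries_mul_of_commutators`, which moves `f(x)` past `y` when the iterated commutators of `x`
with `y` terminate. Since `[H, X₊] = 2 X₊`, conjugation by the Jordanian factor multiplies `X₊ ⊗ 1`
by `1 ⊗ e^{-σ}`. As `e^{-σ} = 1 - 2 h X₊`, it turns `Δ₀(e^{-σ})` into `e^{-σ} ⊗ e^{-σ}`, and
therefore `Δ₀(σ)` into `σ ⊗ 1 + 1 ⊗ σ` (`jordanFactor_mul_comul₀_σ`). Given this, primitivity of
`H` yields the cocycle equation of the Jordanian factor, and primitivity and centrality of `Z`
extend it to the product of the two factors (`F_cocycle`).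

**The Hopf algebra.** Twisting a cocommutative Hopf algebra by a normalised cocycle gives a
triangular Hopf algebra; this is proved for a general cocommutative Hopf algebra in
`isTopHopf_twist` and `isTriangular_twist`.

**The formulas.** The twisted coproduct is the conjugation of `Δ₀` by the Jordanian factor followed
by conjugation by the abelian factor (`Δ_eq`). For each Lie generator both conjugations are finite
computations with iterated commutators. The antipode of an element is then read off its coproduct
through the antipode axiom (`antipodeConv_Δ`). The relations and structure maps of the Jordanian
generators reduce to identities between words in `e^{±σ/2}`, `H` and `X₋`, which hold by normal
ordering (`HalfRelations`). An identity that involves a quotient by `h` is multiplied by `h` first,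
multiplication by `h` being injective (`parH_cancel`).

**The presentation.** Modulo `(h, g)` the map `present` becomes the homomorphism `classicalPresent`
from the free algebra to `U`, which is surjective, and the Jordanian relations become those of
`gl(2)`. Since `U` is presented by the latter, every element of the kernel of `classicalPresent` is
the constant term of an element of the ideal of relations
(`mem_constIdeal_of_classicalPresent_eq_zero`). Successive approximation, one total degree at a
time, lifts surjectivity (`IsCts.surjective`) and the description of the kernel
(`IsCts.exists_sub_mem_filt`) to the series. The structure maps are intertwined because they are on
generators.
-/

noncomputable section

namespace JordanianTwist

open MvPowerSeries (coeff monomial)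

/-! ### The `(h,g)`-adic filtration and continuous linear maps -/

section Filtration

variable {A : Type*} [Ring A]

/-- The `n`-th step of the `(h,g)`-adic filtration: series without terms of total degree below
`n`. -/
def filt (A : Type*) [Ring A] (n : ℕ) : AddSubgroup (FPS A) where
  carrier := {x | ∀ d : Fin 2 →₀ ℕ, d.degree < n → coeff d x = 0}
  zero_mem' := fun d _ => map_zero _
  add_mem' := fun hx hy d hd => by rw [map_add, hx d hd, hy d hd, add_zero]
  neg_mem' := fun hx d hd => by rw [map_neg, hx d hd, neg_zero]

theorem mem_filt {n : ℕ} {x : FPS A} :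
    x ∈ filt A n ↔ ∀ d : Fin 2 →₀ ℕ, d.degree < n → coeff d x = 0 := Iff.rfl

theorem mem_filt_iff_le_order {n : ℕ} {x : FPS A} : x ∈ filt A n ↔ (n : ℕ∞) ≤ x.order := by
  constructor
  · exact fun h => MvPowerSeries.nat_le_order h
  · exact fun h d hd => MvPowerSeries.coeff_of_lt_order (lt_of_lt_of_le (by exact_mod_cast hd) h)

theorem filt_anti {m n : ℕ} (h : m ≤ n) : filt A n ≤ filt A m :=
  fun _ hx d hd => hx d (hd.trans_le h)

theorem mem_filt_zero (x : FPS A) : x ∈ filt A 0 := fun _ hd => absurd hd (Nat.not_lt_zero _)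

theorem mul_mem_filt {m n : ℕ} {x y : FPS A} (hx : x ∈ filt A m) (hy : y ∈ filt A n) :
    x * y ∈ filt A (m + n) := by
  rw [mem_filt_iff_le_order] at *
  refine le_trans ?_ MvPowerSeries.le_order_mul
  push_cast
  exact add_le_add hx hy

theorem mul_mem_filt_left {n : ℕ} {x : FPS A} (hx : x ∈ filt A n) (y : FPS A) :
    x * y ∈ filt A n := mul_mem_filt hx (mem_filt_zero y)

theorem mul_mem_filt_right {n : ℕ} {y : FPS A} (x : FPS A) (hy : y ∈ filt A n) :
    x * y ∈ filt A n := by simpa using mul_mem_filt (mem_filt_zero x) hy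

theorem pow_mem_filt {x : FPS A} (hx : x ∈ filt A 1) (n : ℕ) : x ^ n ∈ filt A n := by
  induction n with
  | zero => exact mem_filt_zero _
  | succ n ih => rw [pow_succ]; exact mul_mem_filt ih hx

theorem smul_mem_filt {K : Type*} [Field K] [Algebra K A] {n : ℕ} {x : FPS A} (c : K)
    (hx : x ∈ filt A n) : c • x ∈ filt A n := fun d hd => by
  change c • coeff d x = 0
  rw [hx d hd, smul_zero]

theorem eq_of_forall_sub_mem_filt {x y : FPS A} (h : ∀ n, x - y ∈ filt A n) : x = y := by
  ext d
  have := h (d.degree + 1) d (Nat.lt_succ_self _)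
  rwa [map_sub, sub_eq_zero] at this

theorem X_mem_filt (s : Fin 2) : (MvPowerSeries.X s : FPS A) ∈ filt A 1 := by
  classical
  intro d hd
  rw [MvPowerSeries.coeff_X, if_neg]
  rintro rfl
  simp at hd

theorem parH_mem_filt : (parH : FPS A) ∈ filt A 1 := X_mem_filt 0

theorem parG_mem_filt : (parG : FPS A) ∈ filt A 1 := X_mem_filt 1

theorem X_commute (s : Fin 2) (x : FPS A) : Commute (MvPowerSeries.X s) x :=
  (MvPowerSeries.commute_X x s).symm

theorem coeff_X_mul (s : Fin 2) (y : FPS A) (d : Fin 2 →₀ ℕ) :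
    coeff (d + Finsupp.single s 1) (MvPowerSeries.X s * y) = coeff d y := by
  rw [MvPowerSeries.X, add_comm]
  simp [MvPowerSeries.coeff_add_monomial_mul]

theorem coeff_X_mul_of_eq_zero (s : Fin 2) (y : FPS A) {d : Fin 2 →₀ ℕ} (hd : d s = 0) :
    coeff d (MvPowerSeries.X s * y) = 0 := by
  rw [MvPowerSeries.X, MvPowerSeries.coeff_monomial_mul, if_neg]
  intro h
  have := h s
  simp [hd] at this

theorem coeff_const [DecidableEq (Fin 2 →₀ ℕ)] (a : A) (d : Fin 2 →₀ ℕ) :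
    coeff d (const a) = if d = 0 then a else 0 := by
  rw [const, MvPowerSeries.coeff_C]
  split_ifs <;> rfl

theorem const_mul (a b : A) : const (a * b) = const a * const b := by simp [const]

theorem const_one : const (1 : A) = 1 := by simp [const]

end Filtration

section Cts

variable {K : Type*} [Field K] {A B C : Type*} [Ring A] [Algebra K A] [Ring B] [Algebra K B]
  [Ring C] [Algebra K C]

theorem const_eq_constL (a : A) : const a = constL (K := K) A a := rfl

theorem const_smul (c : K) (a : A) : const (c • a) = c • const a := by
  rw [const_eq_constL (K := K), map_smul]; rfl

/-- Continuous `K[[h,g]]`-linear maps: `K`-linear maps that respect the filtration and commute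
with multiplication by `h` and by `g`. -/
structure IsCts (f : FPS A →ₗ[K] FPS B) : Prop where
  map_filt : ∀ {n x}, x ∈ filt A n → f x ∈ filt B n
  map_X : ∀ s x, f (MvPowerSeries.X s * x) = MvPowerSeries.X s * f x

theorem isCts_id : IsCts (LinearMap.id : FPS A →ₗ[K] FPS A) := ⟨fun h => h, fun _ _ => rfl⟩

theorem IsCts.comp {f : FPS B →ₗ[K] FPS C} {g : FPS A →ₗ[K] FPS B} (hf : IsCts f)
    (hg : IsCts g) : IsCts (f ∘ₗ g) :=
  ⟨fun h => hf.map_filt (hg.map_filt h), fun s x => by simp [hg.map_X, hf.map_X]⟩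

theorem isCts_mulLeft (a : FPS A) : IsCts (LinearMap.mulLeft K a) :=
  ⟨fun h => mul_mem_filt_right a h, fun s x => by
    simp only [LinearMap.mulLeft_apply, ← mul_assoc, (X_commute s a).eq]⟩

theorem isCts_mulRight (a : FPS A) : IsCts (LinearMap.mulRight K a) :=
  ⟨fun h => mul_mem_filt_left h a, fun s x => by
    simp only [LinearMap.mulRight_apply, mul_assoc]⟩

theorem coeff_mapL (f : A →ₗ[K] B) (x : FPS A) (d : Fin 2 →₀ ℕ) :
    coeff d (mapL f x) = f (coeff d x) := rfl

theorem isCts_mapL (f : A →ₗ[K] B) : IsCts (mapL f) := by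
  refine ⟨fun {n x} h d hd => ?_, fun s x => ?_⟩
  · rw [coeff_mapL, h d hd, map_zero]
  · ext d
    rw [coeff_mapL]
    by_cases hd : d s = 0
    · rw [coeff_X_mul_of_eq_zero s _ hd, coeff_X_mul_of_eq_zero s _ hd, map_zero]
    · obtain ⟨e, rfl⟩ : ∃ e, d = e + Finsupp.single s 1 :=
        ⟨d - Finsupp.single s 1, (tsub_add_cancel_of_le (by
          rw [Finsupp.single_le_iff]; omega)).symm⟩
      rw [coeff_X_mul, coeff_X_mul, coeff_mapL]

theorem coeff_extend (φ : A →ₗ[K] FPS B) (x : FPS A) (d : Fin 2 →₀ ℕ) :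
    coeff d (extend φ x) = ∑ p ∈ Finset.HasAntidiagonal.antidiagonal d,
      coeff p.2 (φ (coeff p.1 x)) := rfl

theorem isCts_extend (φ : A →ₗ[K] FPS B) : IsCts (extend φ) := by
  refine ⟨fun {n x} h d hd => ?_, fun s x => ?_⟩
  · rw [coeff_extend]
    refine Finset.sum_eq_zero fun p hp => ?_
    rw [Finset.HasAntidiagonal.mem_antidiagonal] at hp
    have : p.1.degree < n := by
      have := congrArg Finsupp.degree hp
      rw [map_add] at this
      omega
    rw [h _ this, map_zero, map_zero]
  · ext d
    by_cases hd : d s = 0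
    · rw [coeff_X_mul_of_eq_zero s _ hd, coeff_extend]
      refine Finset.sum_eq_zero fun p hp => ?_
      rw [Finset.HasAntidiagonal.mem_antidiagonal] at hp
      have : p.1 s = 0 := by
        have := DFunLike.congr_fun hp s
        simp at this
        omega
      rw [coeff_X_mul_of_eq_zero s _ this, map_zero, map_zero]
    · obtain ⟨e, rfl⟩ : ∃ e, d = e + Finsupp.single s 1 :=
        ⟨d - Finsupp.single s 1, (tsub_add_cancel_of_le (by
          rw [Finsupp.single_le_iff]; omega)).symm⟩
      rw [coeff_X_mul, coeff_extend, coeff_extend]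
      symm
      refine Finset.sum_of_injOn (fun p => (p.1 + Finsupp.single s 1, p.2)) ?_ ?_ ?_ ?_
      · intro p _ q _ hpq
        simp only [Prod.mk.injEq, add_left_inj] at hpq
        exact Prod.ext hpq.1 hpq.2
      · intro p hp
        simp only [Finset.mem_coe, Finset.HasAntidiagonal.mem_antidiagonal] at hp ⊢
        rw [← hp]; abel
      · intro p hp hp'
        by_cases hps : p.1 s = 0
        · rw [coeff_X_mul_of_eq_zero s _ hps, map_zero, map_zero]
        · exfalso
          apply hp'
          have hle : Finsupp.single s 1 ≤ p.1 := by rw [Finsupp.single_le_iff]; omega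
          refine ⟨(p.1 - Finsupp.single s 1, p.2), ?_, ?_⟩
          · simp only [Finset.mem_coe, Finset.HasAntidiagonal.mem_antidiagonal] at hp ⊢
            have h2 : p.1 - Finsupp.single s 1 + Finsupp.single s 1 = p.1 :=
              tsub_add_cancel_of_le hle
            rw [← add_left_inj (Finsupp.single s 1), add_right_comm, h2, hp]
          · simp [tsub_add_cancel_of_le hle]
      · intro p _
        simp only [coeff_X_mul]

theorem extend_const (φ : A →ₗ[K] FPS B) (a : A) : extend φ (const a) = φ a := by
  classical
  ext d
  rw [coeff_extend, Finset.sum_eq_single (0, d)]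
  · simp [coeff_const]
  · rintro ⟨p, q⟩ hp hne
    rw [coeff_const, if_neg, map_zero, map_zero]
    rintro rfl
    simp at hp
    exact hne (by simp [hp])
  · simp

theorem mapL_const (f : A →ₗ[K] B) (a : A) : mapL f (const a) = const (f a) := by
  classical
  ext d
  rw [coeff_mapL, coeff_const, coeff_const]
  split_ifs <;> simp

theorem IsCts.map_monomial {f : FPS A →ₗ[K] FPS B} (hf : IsCts f) (d : Fin 2 →₀ ℕ) :
    ∀ x, f (monomial d 1 * x) = monomial d 1 * f x := by
  induction d using Finsupp.induction_linear with
  | zero => intro x; simp [MvPowerSeries.monomial_zero_eq_C]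
  | add d e hd he =>
    intro x
    have h1 : (monomial (d + e) (1 : A) : FPS A) = monomial d 1 * monomial e 1 := by
      simp [MvPowerSeries.monomial_mul_monomial]
    have h2 : (monomial (d + e) (1 : B) : FPS B) = monomial d 1 * monomial e 1 := by
      simp [MvPowerSeries.monomial_mul_monomial]
    rw [h1, h2, mul_assoc, mul_assoc, hd, he]
  | single s n =>
    induction n with
    | zero => intro x; simp [MvPowerSeries.monomial_zero_eq_C]
    | succ n ih =>
      intro x
      have h1 : (monomial (Finsupp.single s (n + 1)) (1 : A) : FPS A)
          = MvPowerSeries.X s * monomial (Finsupp.single s n) 1 := by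
        rw [MvPowerSeries.X, MvPowerSeries.monomial_mul_monomial, ← Finsupp.single_add,
          add_comm, one_mul]
      have h2 : (monomial (Finsupp.single s (n + 1)) (1 : B) : FPS B)
          = MvPowerSeries.X s * monomial (Finsupp.single s n) 1 := by
        rw [MvPowerSeries.X, MvPowerSeries.monomial_mul_monomial, ← Finsupp.single_add,
          add_comm, one_mul]
      rw [h1, h2, mul_assoc, mul_assoc, hf.map_X, ih]

theorem monomial_eq_mul_const (d : Fin 2 →₀ ℕ) (a : A) :
    (monomial d a : FPS A) = monomial d 1 * const a := by
  rw [const, ← MvPowerSeries.monomial_zero_eq_C_apply, MvPowerSeries.monomial_mul_monomial,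
    add_zero, one_mul]

/-- Every series is a finite sum of monomials up to higher order. -/
theorem exists_sub_sum_monomial_mem_filt (x : FPS A) (n : ℕ) : ∃ s : Finset (Fin 2 →₀ ℕ),
    x - ∑ d ∈ s, monomial d (coeff d x) ∈ filt A n := by
  classical
  refine ⟨Finset.Iic (Finsupp.equivFunOnFinite.symm fun _ => n), fun d hd => ?_⟩
  rw [map_sub, map_sum, Finset.sum_eq_single d]
  · simp
  · intro e _ hne
    rw [MvPowerSeries.coeff_monomial, if_neg (Ne.symm hne)]
  · intro h
    exfalso
    apply h
    rw [Finset.mem_Iic]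
    intro i
    have := Finsupp.le_degree i d
    simp
    omega

/-- A continuous `K[[h,g]]`-linear map is determined by its values on constant series. -/
theorem IsCts.ext {f g : FPS A →ₗ[K] FPS B} (hf : IsCts f) (hg : IsCts g)
    (h : ∀ a, f (const a) = g (const a)) (x : FPS A) : f x = g x := by
  refine eq_of_forall_sub_mem_filt fun n => ?_
  obtain ⟨s, hs⟩ := exists_sub_sum_monomial_mem_filt x n
  have h1 : f (∑ d ∈ s, monomial d (coeff d x)) = g (∑ d ∈ s, monomial d (coeff d x)) := by
    rw [map_sum, map_sum]
    refine Finset.sum_congr rfl fun d _ => ?_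
    rw [monomial_eq_mul_const, hf.map_monomial, hg.map_monomial, h]
  have h2 := sub_mem (hf.map_filt hs) (hg.map_filt hs)
  rwa [map_sub, map_sub, h1, sub_sub_sub_cancel_right] at h2

theorem IsCts.eq_extend {f : FPS A →ₗ[K] FPS B} (hf : IsCts f) : f = extend (f ∘ₗ constL A) :=
  LinearMap.ext <| hf.ext (isCts_extend _) fun a => by rw [extend_const]; rfl

theorem IsCts.ext_tmul {f g : FPS (A ⊗[K] B) →ₗ[K] FPS C} (hf : IsCts f) (hg : IsCts g)
    (h : ∀ a b, f (const (a ⊗ₜ b)) = g (const (a ⊗ₜ b))) (x : FPS (A ⊗[K] B)) : f x = g x := by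
  refine hf.ext hg (fun t => ?_) x
  have : f ∘ₗ constL _ = g ∘ₗ constL _ := TensorProduct.ext' h
  exact LinearMap.congr_fun this t

theorem IsCts.map_parH {f : FPS A →ₗ[K] FPS B} (hf : IsCts f) (x : FPS A) :
    f (parH * x) = parH * f x := hf.map_X 0 x

theorem IsCts.map_parG {f : FPS A →ₗ[K] FPS B} (hf : IsCts f) (x : FPS A) :
    f (parG * x) = parG * f x := hf.map_X 1 x

theorem IsCts.map_divH {f : FPS A →ₗ[K] FPS B} (hf : IsCts f) {x : FPS A}
    (hx : parH * divH x = x) : f (divH x) = divH (f x) := by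
  rw [← divH_parH_mul (f (divH x)), ← hf.map_parH, hx]

theorem base_eq_mapL : ⇑(base K A) = mapL (Algebra.linearMap K A) := rfl

theorem const_algebraMap (c : K) : const (algebraMap K A c) = c • (1 : FPS A) := by
  rw [Algebra.algebraMap_eq_smul_one, const_smul, const_one]

theorem IsCts.map_base_mul {f : FPS A →ₗ[K] FPS B} (hf : IsCts f) (c : FPS K) (x : FPS A) :
    f (base K A c * x) = base K B c * f x := by
  let L : FPS K →ₗ[K] FPS B := f ∘ₗ LinearMap.mulRight K x ∘ₗ mapL (Algebra.linearMap K A)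
  let R : FPS K →ₗ[K] FPS B := LinearMap.mulRight K (f x) ∘ₗ mapL (Algebra.linearMap K B)
  have hL : IsCts L := hf.comp ((isCts_mulRight x).comp (isCts_mapL _))
  have hR : IsCts R := (isCts_mulRight _).comp (isCts_mapL _)
  refine hL.ext hR (fun k => ?_) c
  simp only [L, R, LinearMap.comp_apply, mapL_const, Algebra.linearMap_apply,
    LinearMap.mulRight_apply, const_algebraMap, one_mul, map_smul]

theorem base_commute (c : FPS K) (x : FPS A) : Commute (base K A c) x :=
  by simpa [Commute, SemiconjBy] using ((isCts_mulLeft (K := K) x).map_base_mul c 1).symm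

/-- Continuous homomorphisms of unital `K[[h,g]]`-algebras. -/
structure IsAlgMap (f : FPS A →ₗ[K] FPS B) : Prop extends IsCts f where
  map_one : f 1 = 1
  map_mul : ∀ x y, f (x * y) = f x * f y

/-- Continuous antihomomorphisms of unital `K[[h,g]]`-algebras. -/
structure IsAntiMap (f : FPS A →ₗ[K] FPS B) : Prop extends IsCts f where
  map_one : f 1 = 1
  map_mul : ∀ x y, f (x * y) = f y * f x

theorem IsAlgMap.map_pow {f : FPS A →ₗ[K] FPS B} (hf : IsAlgMap f) (x : FPS A) (n : ℕ) :
    f (x ^ n) = f x ^ n := by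
  induction n with
  | zero => simp [hf.map_one]
  | succ n ih => rw [pow_succ, hf.map_mul, ih, pow_succ]

theorem IsAntiMap.map_pow {f : FPS A →ₗ[K] FPS B} (hf : IsAntiMap f) (x : FPS A) (n : ℕ) :
    f (x ^ n) = f x ^ n := by
  induction n with
  | zero => simp [hf.map_one]
  | succ n ih => rw [pow_succ, hf.map_mul, ih, pow_succ']

theorem IsAlgMap.map_base {f : FPS A →ₗ[K] FPS B} (hf : IsAlgMap f) (c : FPS K) :
    f (base K A c) = base K B c := by
  simpa [hf.map_one] using hf.map_base_mul c 1

theorem IsCts.map_mul_of_const {f : FPS A →ₗ[K] FPS B} (hf : IsCts f)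
    (h : ∀ a b, f (const (a * b)) = f (const a) * f (const b)) (x y : FPS A) :
    f (x * y) = f x * f y := by
  have h1 : ∀ (a : A) (y : FPS A), f (const a * y) = f (const a) * f y := fun a =>
    (hf.comp (isCts_mulLeft (const a))).ext ((isCts_mulLeft (f (const a))).comp hf)
      fun b => by simp [← const_mul, h]
  exact (hf.comp (isCts_mulRight y)).ext ((isCts_mulRight (f y)).comp hf) (fun a => h1 a y) x

theorem IsCts.map_mul_rev_of_const {f : FPS A →ₗ[K] FPS B} (hf : IsCts f)
    (h : ∀ a b, f (const (a * b)) = f (const b) * f (const a)) (x y : FPS A) :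
    f (x * y) = f y * f x := by
  have h1 : ∀ (a : A) (y : FPS A), f (const a * y) = f y * f (const a) := fun a =>
    (hf.comp (isCts_mulLeft (const a))).ext ((isCts_mulRight (f (const a))).comp hf)
      fun b => by simp [← const_mul, h]
  exact (hf.comp (isCts_mulRight y)).ext ((isCts_mulLeft (f y)).comp hf) (fun a => h1 a y) x

theorem isAlgMap_extend (φ : A →ₐ[K] FPS B) : IsAlgMap (extend φ.toLinearMap) where
  toIsCts := isCts_extend _
  map_one := by rw [← const_one, extend_const]; simp
  map_mul := (isCts_extend _).map_mul_of_const fun a b => by simp [extend_const]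

theorem isAlgMap_mapL (φ : A →ₐ[K] B) : IsAlgMap (mapL φ.toLinearMap) where
  toIsCts := isCts_mapL _
  map_one := by rw [← const_one, mapL_const]; simp [const_one]
  map_mul := (isCts_mapL _).map_mul_of_const fun a b => by
    simp only [mapL_const, ← const_mul, AlgHom.toLinearMap_apply, map_mul]

theorem IsAlgMap.comp {f : FPS B →ₗ[K] FPS C} {g : FPS A →ₗ[K] FPS B} (hf : IsAlgMap f)
    (hg : IsAlgMap g) : IsAlgMap (f ∘ₗ g) :=
  ⟨hf.toIsCts.comp hg.toIsCts, by simp [hf.map_one, hg.map_one], fun x y => by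
    simp [hf.map_mul, hg.map_mul]⟩

theorem IsAntiMap.comp_isAlgMap {f : FPS B →ₗ[K] FPS C} {g : FPS A →ₗ[K] FPS B}
    (hf : IsAntiMap f) (hg : IsAlgMap g) : IsAntiMap (f ∘ₗ g) :=
  ⟨hf.toIsCts.comp hg.toIsCts, by simp [hf.map_one, hg.map_one], fun x y => by
    simp [hf.map_mul, hg.map_mul]⟩

theorem IsAlgMap.comp_isAntiMap {f : FPS B →ₗ[K] FPS C} {g : FPS A →ₗ[K] FPS B}
    (hf : IsAlgMap f) (hg : IsAntiMap g) : IsAntiMap (f ∘ₗ g) :=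
  ⟨hf.toIsCts.comp hg.toIsCts, by simp [hf.map_one, hg.map_one], fun x y => by
    simp [hf.map_mul, hg.map_mul]⟩

/-- Conjugation by an invertible series is a continuous automorphism. -/
theorem isAlgMap_conj {u v : FPS A} (huv : u * v = 1) (hvu : v * u = 1) :
    IsAlgMap (LinearMap.mulLeft K u ∘ₗ LinearMap.mulRight K v) where
  toIsCts := (isCts_mulLeft u).comp (isCts_mulRight v)
  map_one := by simp [huv]
  map_mul x y := by
    simp only [LinearMap.comp_apply, LinearMap.mulLeft_apply, LinearMap.mulRight_apply]
    rw [show u * (x * v) * (u * (y * v)) = u * (x * (v * u) * y * v) by noncomm_ring, hvu]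
    simp [mul_assoc]

end Cts

end JordanianTwist

end

noncomputable section

namespace JordanianTwist

open MvPowerSeries (coeff monomial)

/-! ### Functional calculus: substituting a series without constant term -/

section EvalSeries

variable {K : Type*} [Field K] {A B : Type*} [Ring A] [Algebra K A] [Ring B] [Algebra K B]

/-- The partial sums of `∑ fₙ xⁿ` converge to `evalSeries f x`. -/
theorem evalSeries_sub_mem_filt (f : PowerSeries K) {x : FPS A} (hx : x ∈ filt A 1) (N : ℕ) :
    evalSeries f x - ∑ n ∈ Finset.range N, PowerSeries.coeff n f • x ^ n ∈ filt A N := by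
  intro d hd
  rw [map_sub, map_sum, sub_eq_zero]
  change ∑ n ∈ Finset.range (d.degree + 1), PowerSeries.coeff n f • coeff d (x ^ n) =
    ∑ n ∈ Finset.range N, PowerSeries.coeff n f • coeff d (x ^ n)
  refine Finset.sum_subset (Finset.range_mono hd) fun n _ hn => ?_
  rw [pow_mem_filt hx n d (by simpa using hn), smul_zero]

theorem evalSeries_eq_of_forall {f : PowerSeries K} {x y : FPS A} (hx : x ∈ filt A 1)
    (h : ∀ N, y - ∑ n ∈ Finset.range N, PowerSeries.coeff n f • x ^ n ∈ filt A N) :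
    y = evalSeries f x :=
  eq_of_forall_sub_mem_filt fun N => by
    have := sub_mem (h N) (evalSeries_sub_mem_filt f hx N)
    rwa [sub_sub_sub_cancel_right] at this

theorem evalSeries_mem_filt {f : PowerSeries K} {x : FPS A} (hx : x ∈ filt A 1) {N : ℕ}
    (hf : ∀ n < N, PowerSeries.coeff n f = 0) : evalSeries f x ∈ filt A N := by
  have := evalSeries_sub_mem_filt f hx N
  rwa [Finset.sum_eq_zero, sub_zero] at this
  intro n hn
  rw [hf n (Finset.mem_range.1 hn), zero_smul]

theorem evalSeries_add (f g : PowerSeries K) (x : FPS A) :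
    evalSeries (f + g) x = evalSeries f x + evalSeries g x := by
  funext d
  refine Eq.trans (Finset.sum_congr rfl fun n _ => ?_) Finset.sum_add_distrib
  rw [map_add, add_smul]

theorem evalSeries_smul (c : K) (f : PowerSeries K) (x : FPS A) :
    evalSeries (c • f) x = c • evalSeries f x := by
  funext d
  refine Eq.trans (Finset.sum_congr rfl fun n _ => ?_) (Finset.smul_sum (r := c)).symm
  rw [PowerSeries.coeff_smul, smul_eq_mul, mul_smul]

theorem evalSeries_sub (f g : PowerSeries K) (x : FPS A) :
    evalSeries (f - g) x = evalSeries f x - evalSeries g x := by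
  rw [eq_sub_iff_add_eq, ← evalSeries_add, sub_add_cancel]

theorem evalSeries_neg (f : PowerSeries K) (x : FPS A) :
    evalSeries (-f) x = -evalSeries f x := by
  rw [eq_neg_iff_add_eq_zero, ← evalSeries_add, neg_add_cancel]
  funext d
  refine Finset.sum_eq_zero fun n _ => ?_
  simp

theorem evalSeries_coe (p : Polynomial K) {x : FPS A} (hx : x ∈ filt A 1) :
    evalSeries (p : PowerSeries K) x = Polynomial.aeval x p := by
  refine eq_of_forall_sub_mem_filt fun N => ?_
  have h := evalSeries_sub_mem_filt (p : PowerSeries K) hx (max N (p.natDegree + 1))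
  rw [Polynomial.aeval_eq_sum_range' (n := max N (p.natDegree + 1)) (by omega)]
  simp only [Polynomial.coeff_coe] at h
  exact filt_anti (le_max_left _ _) h

theorem evalSeries_one {x : FPS A} (hx : x ∈ filt A 1) :
    evalSeries (1 : PowerSeries K) x = 1 := by
  simpa using evalSeries_coe (1 : Polynomial K) hx

theorem evalSeries_X {x : FPS A} (hx : x ∈ filt A 1) :
    evalSeries (PowerSeries.X : PowerSeries K) x = x := by
  simpa using evalSeries_coe (Polynomial.X : Polynomial K) hx

theorem coeff_sub_trunc (f : PowerSeries K) (N n : ℕ) (h : n < N) :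
    PowerSeries.coeff n (f - ((PowerSeries.trunc N f : Polynomial K) : PowerSeries K)) = 0 := by
  simp [PowerSeries.coeff_trunc, h]

theorem evalSeries_mul (f g : PowerSeries K) {x : FPS A} (hx : x ∈ filt A 1) :
    evalSeries (f * g) x = evalSeries f x * evalSeries g x := by
  refine eq_of_forall_sub_mem_filt fun N => ?_
  set p := PowerSeries.trunc N f
  set q := PowerSeries.trunc N g
  have hf : ∀ n < N, PowerSeries.coeff n (f - (p : PowerSeries K)) = 0 := coeff_sub_trunc f N
  have hg : ∀ n < N, PowerSeries.coeff n (g - (q : PowerSeries K)) = 0 := coeff_sub_trunc g N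
  have hfg : ∀ n < N,
      PowerSeries.coeff n (f * g - ((p * q : Polynomial K) : PowerSeries K)) = 0 := by
    rw [← PowerSeries.X_pow_dvd_iff] at *
    have : f * g - ((p * q : Polynomial K) : PowerSeries K) = (f - p) * g + p * (g - q) := by
      push_cast; ring
    rw [this]
    exact dvd_add (hf.mul_right _) (hg.mul_left _)
  have h1 := evalSeries_mem_filt hx hf
  have h2 := evalSeries_mem_filt hx hg
  have h3 := evalSeries_mem_filt hx hfg
  rw [evalSeries_sub, evalSeries_coe _ hx] at h1 h2 h3
  rw [map_mul] at h3
  have h4 := add_mem (mul_mem_filt_left h1 (evalSeries g x))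
    (mul_mem_filt_right (Polynomial.aeval x p) h2)
  have h5 := sub_mem h3 h4
  convert h5 using 1
  noncomm_ring

theorem evalSeries_pow (f : PowerSeries K) {x : FPS A} (hx : x ∈ filt A 1) (n : ℕ) :
    evalSeries (f ^ n) x = evalSeries f x ^ n := by
  induction n with
  | zero => simp [evalSeries_one hx]
  | succ n ih => rw [pow_succ, evalSeries_mul _ _ hx, ih, pow_succ]

/-- `f ↦ f(x)` as an algebra homomorphism. -/
def evalHom {x : FPS A} (hx : x ∈ filt A 1) : PowerSeries K →ₐ[K] FPS A :=
  AlgHom.ofLinearMap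
    { toFun := fun f => evalSeries f x
      map_add' := fun f g => evalSeries_add f g x
      map_smul' := fun c f => evalSeries_smul c f x }
    (evalSeries_one hx) fun f g => evalSeries_mul f g hx

theorem evalHom_apply {x : FPS A} (hx : x ∈ filt A 1) (f : PowerSeries K) :
    evalHom hx f = evalSeries f x := rfl

theorem evalSeries_commute (f : PowerSeries K) {x y : FPS A} (hx : x ∈ filt A 1)
    (h : Commute x y) : Commute (evalSeries f x) y := by
  refine eq_of_forall_sub_mem_filt fun N => ?_
  have h1 := evalSeries_sub_mem_filt f hx N
  have h2 : Commute (∑ n ∈ Finset.range N, PowerSeries.coeff n f • x ^ n) y :=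
    Commute.sum_left _ _ _ fun n _ => (h.pow_left n).smul_left _
  have h3 := sub_mem (mul_mem_filt_left h1 y) (mul_mem_filt_right y h1)
  convert h3 using 1
  rw [sub_mul, mul_sub, h2.eq]
  abel

/-- Intertwining: `x y = y x'` implies `f(x) y = y f(x')`. -/
theorem evalSeries_semiconj (f : PowerSeries K) {x x' y : FPS A} (hx : x ∈ filt A 1)
    (hx' : x' ∈ filt A 1) (h : x * y = y * x') :
    evalSeries f x * y = y * evalSeries f x' := by
  refine eq_of_forall_sub_mem_filt fun N => ?_
  have h1 := evalSeries_sub_mem_filt f hx N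
  have h1' := evalSeries_sub_mem_filt f hx' N
  have h2 : (∑ n ∈ Finset.range N, PowerSeries.coeff n f • x ^ n) * y =
      y * ∑ n ∈ Finset.range N, PowerSeries.coeff n f • x' ^ n := by
    rw [Finset.sum_mul, Finset.mul_sum]
    refine Finset.sum_congr rfl fun n _ => ?_
    have : SemiconjBy y x' x := h.symm
    rw [smul_mul_assoc, mul_smul_comm, (this.pow_right n).eq]
  have h3 := sub_mem (mul_mem_filt_left h1 y) (mul_mem_filt_right y h1')
  convert h3 using 1
  rw [sub_mul, mul_sub, h2]
  abel

theorem IsCts.map_evalSeries {φ : FPS A →ₗ[K] FPS B} (hφ : IsCts φ) (f : PowerSeries K)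
    {x : FPS A} (hx : x ∈ filt A 1) (hpow : ∀ n, φ (x ^ n) = φ x ^ n) :
    φ (evalSeries f x) = evalSeries f (φ x) := by
  refine evalSeries_eq_of_forall (hφ.map_filt hx) fun N => ?_
  have := hφ.map_filt (evalSeries_sub_mem_filt f hx N)
  simpa [hpow] using this

theorem IsAlgMap.map_evalSeries {φ : FPS A →ₗ[K] FPS B} (hφ : IsAlgMap φ) (f : PowerSeries K)
    {x : FPS A} (hx : x ∈ filt A 1) : φ (evalSeries f x) = evalSeries f (φ x) :=
  hφ.toIsCts.map_evalSeries f hx (hφ.map_pow x)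

theorem IsAntiMap.map_evalSeries {φ : FPS A →ₗ[K] FPS B} (hφ : IsAntiMap φ) (f : PowerSeries K)
    {x : FPS A} (hx : x ∈ filt A 1) : φ (evalSeries f x) = evalSeries f (φ x) :=
  hφ.toIsCts.map_evalSeries f hx (hφ.map_pow x)

theorem evalSeries_mem_filt_one {f : PowerSeries K} (hf : PowerSeries.constantCoeff f = 0)
    {x : FPS A} (hx : x ∈ filt A 1) : evalSeries f x ∈ filt A 1 :=
  evalSeries_mem_filt hx fun n hn => by
    obtain rfl : n = 0 := by omega
    simpa using hf

/-- Substitution is compatible with composition of one-variable series. -/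
theorem evalSeries_subst (f : PowerSeries K) {g : PowerSeries K}
    (hg : PowerSeries.constantCoeff g = 0) {x : FPS A} (hx : x ∈ filt A 1) :
    evalSeries (f.subst g) x = evalSeries f (evalSeries g x) := by
  refine evalSeries_eq_of_forall (evalSeries_mem_filt_one hg hx) fun N => ?_
  have hs : PowerSeries.HasSubst g := PowerSeries.HasSubst.of_constantCoeff_zero' hg
  have h1 : ∑ n ∈ Finset.range N, PowerSeries.coeff n f • evalSeries g x ^ n
      = evalSeries (((PowerSeries.trunc N f : Polynomial K) : PowerSeries K).subst g) x := by
    have h2 := Polynomial.aeval_algHom_apply (evalHom (K := K) hx) g (PowerSeries.trunc N f)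
    rw [PowerSeries.subst_coe hs]
    refine Eq.trans ?_ h2
    have h3 : PowerSeries.trunc N f =
        ∑ n ∈ Finset.range N, Polynomial.monomial n (PowerSeries.coeff n f) := by
      ext m
      simp [PowerSeries.coeff_trunc, Polynomial.coeff_monomial]
    simp [h3, Polynomial.aeval_monomial, Algebra.smul_def, evalHom_apply]
  rw [h1, ← evalSeries_sub, ← PowerSeries.subst_sub hs]
  refine evalSeries_mem_filt hx ?_
  obtain ⟨r, hr⟩ := PowerSeries.X_pow_dvd_iff.2 (coeff_sub_trunc f N)
  rw [← PowerSeries.X_pow_dvd_iff, hr, PowerSeries.subst_mul hs, PowerSeries.subst_pow hs,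
    PowerSeries.subst_X hs]
  exact ((pow_dvd_pow_of_dvd (PowerSeries.X_dvd_iff.2 hg) N)).mul_right _

/-- If `f` has no constant term, then `f(x)` is divisible by `x`. -/
theorem evalSeries_eq_mul {f : PowerSeries K} (hf : PowerSeries.constantCoeff f = 0)
    {x : FPS A} (hx : x ∈ filt A 1) : ∃ r : PowerSeries K, f = PowerSeries.X * r ∧
      evalSeries f x = x * evalSeries r x := by
  obtain ⟨r, hr⟩ := PowerSeries.X_dvd_iff.2 hf
  exact ⟨r, hr, by rw [hr, evalSeries_mul _ _ hx, evalSeries_X hx]⟩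

/-- The binomial expansion of `xⁿ y` when the second iterated commutator with `x` is the last
nonzero one. -/
theorem pow_mul_of_commutators {R : Type*} [Ring R] {x y z w : R} (hz : x * y = y * x + z)
    (hw : x * z = z * x + w) (hc : x * w = w * x) (n : ℕ) :
    x ^ n * y = y * x ^ n + n • (z * x ^ (n - 1)) + n.choose 2 • (w * x ^ (n - 2)) := by
  induction n with
  | zero => simp
  | succ n ih =>
    have e1 : n • (x * (z * x ^ (n - 1))) = n • (z * x ^ n) + n • (w * x ^ (n - 1)) := by
      rcases n with _ | n
      · simp
      · rw [← mul_assoc, hw, add_mul, mul_assoc, ← pow_succ', smul_add]; simp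
    have e2 : n.choose 2 • (x * (w * x ^ (n - 2))) = n.choose 2 • (w * x ^ (n - 1)) := by
      rcases n with _ | _ | n
      · simp
      · simp
      · rw [← mul_assoc, hc, mul_assoc, ← pow_succ']; simp
    rw [pow_succ', mul_assoc, ih, mul_add, mul_add, mul_smul_comm, mul_smul_comm, e1, e2,
      ← mul_assoc, hz, add_mul, mul_assoc, ← pow_succ']
    have : (n + 1).choose 2 = n + n.choose 2 := by
      rw [Nat.choose_succ_succ' n 1]; simp
    rw [this]
    simp only [Nat.add_sub_cancel, show n + 1 - 2 = n - 1 by omega, add_smul, one_smul]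
    abel

/-- Moving `f(x)` past an element whose second iterated commutator with `x` is the last nonzero
one: `f(x) y = y f(x) + z f'(x) + w f''(x) / 2`, where `z = [x,y]` and `w = [x,z]`. -/
theorem evalSeries_mul_of_commutators [CharZero K] (f : PowerSeries K) {x y z w : FPS A}
    (hx : x ∈ filt A 1) (hz : x * y = y * x + z) (hw : x * z = z * x + w) (hc : x * w = w * x) :
    evalSeries f x * y = y * evalSeries f x + z * evalSeries (PowerSeries.derivative K f) x +
      (1 / 2 : K) • (w * evalSeries (PowerSeries.derivative K (PowerSeries.derivative K f)) x) := by
  refine eq_of_forall_sub_mem_filt fun N => ?_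
  have h0 := evalSeries_sub_mem_filt f hx (N + 2)
  have h1 := evalSeries_sub_mem_filt (PowerSeries.derivative K f) hx (N + 1)
  have h2 := evalSeries_sub_mem_filt (PowerSeries.derivative K (PowerSeries.derivative K f)) hx N
  have key : (∑ n ∈ Finset.range (N + 2), PowerSeries.coeff n f • x ^ n) * y =
      y * (∑ n ∈ Finset.range (N + 2), PowerSeries.coeff n f • x ^ n) +
      z * (∑ n ∈ Finset.range (N + 1), PowerSeries.coeff n (PowerSeries.derivative K f) • x ^ n) +
      (1 / 2 : K) • (w * ∑ n ∈ Finset.range N, PowerSeries.coeff n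
        (PowerSeries.derivative K (PowerSeries.derivative K f)) • x ^ n) := by
    have e1 : z * (∑ n ∈ Finset.range (N + 1),
        PowerSeries.coeff n (PowerSeries.derivative K f) • x ^ n) =
        ∑ n ∈ Finset.range (N + 2), PowerSeries.coeff n f • n • (z * x ^ (n - 1)) := by
      rw [Finset.sum_range_succ' _ (N + 1), Finset.mul_sum]
      simp only [PowerSeries.coeff_derivative, zero_smul, smul_zero, add_zero, mul_smul_comm,
        Nat.add_sub_cancel]
      refine Finset.sum_congr rfl fun n _ => ?_
      rw [mul_smul, ← Nat.cast_smul_eq_nsmul K]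
      push_cast
      rfl
    have e2 : (1 / 2 : K) • (w * ∑ n ∈ Finset.range N, PowerSeries.coeff n
        (PowerSeries.derivative K (PowerSeries.derivative K f)) • x ^ n)
        = ∑ n ∈ Finset.range (N + 2), PowerSeries.coeff n f • n.choose 2 • (w * x ^ (n - 2)) := by
      rw [Finset.sum_range_succ' _ (N + 1), Finset.sum_range_succ' _ N, Finset.mul_sum,
        Finset.smul_sum]
      simp only [PowerSeries.coeff_derivative, mul_smul_comm]
      simp only [zero_add, Nat.choose_zero_succ, Nat.choose_eq_zero_of_lt,
        Nat.one_lt_ofNat, zero_smul, smul_zero, add_zero]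
      refine Finset.sum_congr rfl fun n _ => ?_
      rw [← Nat.cast_smul_eq_nsmul K, Nat.cast_choose_two, smul_smul, smul_smul,
        show n + 1 + 1 - 2 = n by omega]
      congr 1
      push_cast
      ring
    rw [e1, e2, Finset.sum_mul, Finset.mul_sum, ← Finset.sum_add_distrib, ← Finset.sum_add_distrib]
    refine Finset.sum_congr rfl fun n _ => ?_
    rw [smul_mul_assoc, pow_mul_of_commutators hz hw hc, mul_smul_comm, smul_add, smul_add]
  have m0 := filt_anti (by omega : N ≤ N + 2) (mul_mem_filt_left h0 y)
  have m0' := filt_anti (by omega : N ≤ N + 2) (mul_mem_filt_right y h0)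
  have m1 := filt_anti (by omega : N ≤ N + 1) (mul_mem_filt_right z h1)
  have m2 := smul_mem_filt (1 / 2 : K) (mul_mem_filt_right w h2)
  have h3 := sub_mem m0 (add_mem (add_mem m0' m1) m2)
  convert h3 using 1
  rw [sub_mul, mul_sub, mul_sub, mul_sub, smul_sub, key]
  abel

end EvalSeries

end JordanianTwist

end

noncomputable section

namespace JordanianTwist

open MvPowerSeries (coeff monomial)

/-! ### Exponential and logarithm -/

section OneVariable

variable (K : Type*) [Field K]

/-- The one-variable series `-ln (1 - T)`. -/
def logSeries : PowerSeries K := PowerSeries.mk fun n => if n = 0 then (0 : K) else (n : K)⁻¹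

theorem constantCoeff_logSeries : PowerSeries.constantCoeff (logSeries K) = 0 := by
  rw [← PowerSeries.coeff_zero_eq_constantCoeff_apply]; simp [logSeries]

theorem derivative_logSeries [CharZero K] :
    PowerSeries.derivative K (logSeries K) = PowerSeries.mk 1 := by
  ext n
  have : (n : K) + 1 ≠ 0 := by exact_mod_cast n.succ_ne_zero
  simp [PowerSeries.coeff_derivative, logSeries, this]

theorem one_sub_X_mul_mk_one :
    (1 - PowerSeries.X : PowerSeries K) * PowerSeries.mk 1 = 1 := by
  rw [mul_comm]; exact PowerSeries.mk_one_mul_one_sub_eq_one K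

theorem hasSubst_neg_logSeries : PowerSeries.HasSubst (-logSeries K) :=
  PowerSeries.HasSubst.of_constantCoeff_zero' (by simp [constantCoeff_logSeries])

theorem constantCoeff_one_sub_exp [CharZero K] :
    PowerSeries.constantCoeff (1 - PowerSeries.exp K) = 0 := by
  simp

theorem subst_one {g : PowerSeries K} (hg : PowerSeries.HasSubst g) :
    (1 : PowerSeries K).subst g = 1 := by
  rw [← PowerSeries.coe_substAlgHom hg, map_one]

theorem constantCoeff_subst_of_constantCoeff_eq_zero (f : PowerSeries K) {g : PowerSeries K}
    (hg : PowerSeries.constantCoeff g = 0) :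
    PowerSeries.constantCoeff (f.subst g) = PowerSeries.constantCoeff f := by
  have hs := PowerSeries.HasSubst.of_constantCoeff_zero' hg
  have h1 : f = (f - PowerSeries.constantCoeff f • 1) + PowerSeries.constantCoeff f • 1 := by abel
  obtain ⟨r, hr⟩ : PowerSeries.X ∣ f - PowerSeries.constantCoeff f • 1 :=
    PowerSeries.X_dvd_iff.2 (by simp)
  rw [hr] at h1
  have h2 : f.subst g = g * r.subst g + PowerSeries.constantCoeff f • 1 := by
    conv_lhs => rw [h1]
    rw [PowerSeries.subst_add hs, PowerSeries.subst_mul hs, PowerSeries.subst_X hs,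
      PowerSeries.subst_smul hs, subst_one K hs]
  rw [h2]
  simp [hg]

theorem derivative_derivative_logSeries [CharZero K] :
    PowerSeries.derivative K (PowerSeries.derivative K (logSeries K)) = PowerSeries.mk 1 ^ 2 := by
  have h1 := congrArg (PowerSeries.derivative K) (one_sub_X_mul_mk_one K)
  rw [Derivation.leibniz] at h1
  simp only [map_sub, Derivation.map_one_eq_zero, PowerSeries.derivative_X, smul_eq_mul] at h1
  rw [derivative_logSeries]
  have h2 := one_sub_X_mul_mk_one K
  linear_combination (PowerSeries.mk 1) * h1 -
    (PowerSeries.derivative K (PowerSeries.mk 1)) * h2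

/-- `exp (ln (1 - T)) = 1 - T`: the product of `exp (ln (1 - T))` and `1 / (1 - T)` has derivative
zero. -/
theorem exp_subst_neg_logSeries [CharZero K] :
    (PowerSeries.exp K).subst (-logSeries K) = 1 - PowerSeries.X := by
  set P : PowerSeries K := (PowerSeries.exp K).subst (-logSeries K) with hP
  set G : PowerSeries K := PowerSeries.mk 1 with hG
  have hd : PowerSeries.derivative K P = -(P * G) := by
    rw [hP, PowerSeries.derivative_subst (hasSubst_neg_logSeries K), PowerSeries.derivative_exp,
      map_neg, derivative_logSeries]
    ring
  have hG' : PowerSeries.derivative K G = G ^ 2 := by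
    rw [hG, ← derivative_logSeries, derivative_derivative_logSeries, derivative_logSeries]
  have h1 : P * G = 1 := by
    apply PowerSeries.derivative.ext
    · rw [Derivation.leibniz, hd, hG']
      simp only [smul_eq_mul, Derivation.map_one_eq_zero]
      ring
    · have : PowerSeries.constantCoeff P = 1 := by
        rw [hP, constantCoeff_subst_of_constantCoeff_eq_zero _ _
          (by simp [constantCoeff_logSeries]),
          PowerSeries.constantCoeff_exp]
      rw [map_mul, this, hG]
      simp [← PowerSeries.coeff_zero_eq_constantCoeff_apply]
  have h2 := one_sub_X_mul_mk_one K
  calc P = P * ((1 - PowerSeries.X) * G) := by rw [h2, mul_one]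
    _ = P * G * (1 - PowerSeries.X) := by ring
    _ = _ := by rw [h1, one_mul]

/-- `-ln (exp T) = -T`: both sides have derivative `-1` and no constant term. -/
theorem logSeries_subst_one_sub_exp [CharZero K] :
    (logSeries K).subst (1 - PowerSeries.exp K) = -PowerSeries.X := by
  have hs : PowerSeries.HasSubst (1 - PowerSeries.exp K) :=
    PowerSeries.HasSubst.of_constantCoeff_zero' (constantCoeff_one_sub_exp K)
  apply PowerSeries.derivative.ext
  · rw [PowerSeries.derivative_subst hs, derivative_logSeries, map_neg, PowerSeries.derivative_X,
      map_sub, PowerSeries.derivative_exp, Derivation.map_one_eq_zero, zero_sub, mul_neg]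
    congr 1
    have h := congrArg (PowerSeries.subst (1 - PowerSeries.exp K)) (one_sub_X_mul_mk_one K)
    rw [PowerSeries.subst_mul hs, PowerSeries.subst_sub hs, PowerSeries.subst_X hs,
      subst_one K hs, sub_sub_cancel] at h
    rw [mul_comm]; exact h
  · rw [constantCoeff_subst_of_constantCoeff_eq_zero _ _ (constantCoeff_one_sub_exp K)]
    simp [constantCoeff_logSeries]

end OneVariable

section Exp

theorem negLogOneSub_eq {K A : Type*} [Field K] [Ring A] [Algebra K A] (x : FPS A) :
    negLogOneSub K x = evalSeries (logSeries K) x := rfl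

variable {K : Type*} [Field K] [CharZero K] {A B : Type*} [Ring A] [Algebra K A] [Ring B]
  [Algebra K B]

theorem fexp_add {x y : FPS A} (hx : x ∈ filt A 1) (hy : y ∈ filt A 1) (h : Commute x y) :
    fexp K (x + y) = fexp K x * fexp K y := by
  symm
  refine evalSeries_eq_of_forall (add_mem hx hy) fun N => ?_
  have h1 := evalSeries_sub_mem_filt (PowerSeries.exp K) hx N
  have h2 := evalSeries_sub_mem_filt (PowerSeries.exp K) hy N
  set a : ℕ → K := fun n => PowerSeries.coeff n (PowerSeries.exp K) with ha
  have ha' : ∀ n, a n = (n.factorial : K)⁻¹ := fun n => by simp [ha, PowerSeries.coeff_exp]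
  change fexp K x - ∑ n ∈ Finset.range N, a n • x ^ n ∈ _ at h1
  change fexp K y - ∑ n ∈ Finset.range N, a n • y ^ n ∈ _ at h2
  change _ - ∑ n ∈ Finset.range N, a n • (x + y) ^ n ∈ _
  set t : ℕ × ℕ → FPS A := fun p => (a p.1 * a p.2) • (x ^ p.1 * y ^ p.2) with ht
  have e1 : (∑ n ∈ Finset.range N, a n • x ^ n) * (∑ n ∈ Finset.range N, a n • y ^ n) =
      ∑ p ∈ Finset.range N ×ˢ Finset.range N, t p := by
    rw [Finset.sum_mul_sum, Finset.sum_product]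
    simp only [ht, smul_mul_smul_comm]
  have e2 : ∑ n ∈ Finset.range N, a n • (x + y) ^ n =
      ∑ p ∈ Finset.range N ×ˢ Finset.range N with p.1 + p.2 < N, t p := by
    rw [← Finset.sum_fiberwise_of_maps_to (g := fun p : ℕ × ℕ => p.1 + p.2)
      (t := Finset.range N) (by simp)]
    refine Finset.sum_congr rfl fun n hn => ?_
    rw [h.add_pow', Finset.smul_sum]
    have : Finset.filter (fun p : ℕ × ℕ => p.1 + p.2 = n)
        (Finset.filter (fun p : ℕ × ℕ => p.1 + p.2 < N) (Finset.range N ×ˢ Finset.range N)) =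
        Finset.HasAntidiagonal.antidiagonal n := by
      ext p
      simp only [Finset.mem_filter, Finset.mem_product, Finset.mem_range,
        Finset.HasAntidiagonal.mem_antidiagonal] at hn ⊢
      omega
    rw [this]
    refine Finset.sum_congr rfl fun p hp => ?_
    rw [Finset.HasAntidiagonal.mem_antidiagonal] at hp
    simp only [ht]
    rw [← Nat.cast_smul_eq_nsmul K, smul_smul, ha', ha', ha', ← hp]
    congr 1
    have h1 : ((p.1 + p.2).factorial : K) ≠ 0 := by exact_mod_cast (p.1 + p.2).factorial_ne_zero
    have h2 : (p.1.factorial : K) ≠ 0 := by exact_mod_cast p.1.factorial_ne_zero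
    have h3 : (p.2.factorial : K) ≠ 0 := by exact_mod_cast p.2.factorial_ne_zero
    have h4 : (((p.1 + p.2).choose p.1 : ℕ) : K) * p.1.factorial * p.2.factorial =
        (p.1 + p.2).factorial := by
      rw [Nat.choose_symm_add]
      exact_mod_cast Nat.add_choose_mul_factorial_mul_factorial p.1 p.2
    rw [← h4] at h1 ⊢
    have h5 := left_ne_zero_of_mul (left_ne_zero_of_mul h1)
    field_simp
  have e3 := Finset.sum_filter_add_sum_filter_not (Finset.range N ×ˢ Finset.range N)
    (fun p : ℕ × ℕ => p.1 + p.2 < N) t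
  have e4 : ∑ p ∈ Finset.range N ×ˢ Finset.range N with ¬ (p.1 + p.2 < N), t p ∈ filt A N := by
    refine sum_mem fun p hp => smul_mem_filt _ ?_
    rw [Finset.mem_filter] at hp
    exact filt_anti (by omega) (mul_mem_filt (pow_mem_filt hx p.1) (pow_mem_filt hy p.2))
  have h3 := add_mem (add_mem (mul_mem_filt_left h1 (fexp K y))
    (mul_mem_filt_right (∑ n ∈ Finset.range N, a n • x ^ n) h2)) e4
  convert h3 using 1
  rw [e2, sub_mul, mul_sub, e1, ← e3]
  abel

theorem fexp_zero : fexp K (0 : FPS A) = 1 := by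
  symm
  refine evalSeries_eq_of_forall (zero_mem _) fun N => ?_
  rcases N with _ | N
  · exact mem_filt_zero _
  · rw [Finset.sum_range_succ']
    simp [zero_mem]

theorem fexp_mul_fexp_neg {x : FPS A} (hx : x ∈ filt A 1) : fexp K x * fexp K (-x) = 1 := by
  rw [← fexp_add hx (neg_mem hx) (Commute.refl x).neg_right, add_neg_cancel, fexp_zero]

theorem fexp_neg_mul_fexp {x : FPS A} (hx : x ∈ filt A 1) : fexp K (-x) * fexp K x = 1 := by
  simpa using fexp_mul_fexp_neg (neg_mem hx)

theorem fexp_commute {x y : FPS A} (hx : x ∈ filt A 1) (h : Commute x y) :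
    Commute (fexp K x) y := evalSeries_commute _ hx h

theorem fexp_sub_one_mem_filt {x : FPS A} (hx : x ∈ filt A 1) : fexp K x - 1 ∈ filt A 1 := by
  have := evalSeries_mem_filt_one (f := PowerSeries.exp K - 1) (by simp) hx
  rwa [evalSeries_sub, evalSeries_one hx] at this

theorem fexp_neg_negLogOneSub {x : FPS A} (hx : x ∈ filt A 1) :
    fexp K (-negLogOneSub K x) = 1 - x := by
  rw [negLogOneSub_eq, ← evalSeries_neg, fexp, ← evalSeries_subst _ (by
    simp [constantCoeff_logSeries]) hx, exp_subst_neg_logSeries, evalSeries_sub, evalSeries_one hx,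
    evalSeries_X hx]

theorem negLogOneSub_one_sub_fexp {x : FPS A} (hx : x ∈ filt A 1) :
    negLogOneSub K (1 - fexp K x) = -x := by
  have h : 1 - fexp K x = evalSeries (1 - PowerSeries.exp K) x := by
    rw [evalSeries_sub, evalSeries_one hx]; rfl
  rw [negLogOneSub_eq, h, ← evalSeries_subst _ (constantCoeff_one_sub_exp K) hx,
    logSeries_subst_one_sub_exp, evalSeries_neg, evalSeries_X hx]

/-- The exponential is injective, as the logarithm inverts it. -/
theorem fexp_injective {x y : FPS A} (hx : x ∈ filt A 1) (hy : y ∈ filt A 1)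
    (h : fexp K x = fexp K y) : x = y := by
  rw [← neg_inj, ← negLogOneSub_one_sub_fexp (K := K) hx, h, negLogOneSub_one_sub_fexp hy]

/-- Conjugation by an exponential, when the second iterated commutator is the last nonzero one. -/
theorem fexp_mul_of_commutators {x y z w : FPS A} (hx : x ∈ filt A 1)
    (hz : x * y = y * x + z) (hw : x * z = z * x + w) (hc : x * w = w * x) :
    fexp K x * y = (y + z + (1 / 2 : K) • w) * fexp K x := by
  have := evalSeries_mul_of_commutators (PowerSeries.exp K) hx hz hw hc
  rw [PowerSeries.derivative_exp, PowerSeries.derivative_exp] at this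
  rw [fexp, this, add_mul, add_mul, smul_mul_assoc]

/-- Conjugation by an exponential, when the first commutator `z` commutes with `x`. -/
theorem fexp_mul_of_commutator {x y z : FPS A} (hx : x ∈ filt A 1)
    (hz : x * y = y * x + z) (hc : x * z = z * x) : fexp K x * y = (y + z) * fexp K x := by
  simpa using fexp_mul_of_commutators (K := K) (w := 0) hx hz (by simpa using hc) (by simp)

theorem IsAlgMap.map_fexp {φ : FPS A →ₗ[K] FPS B} (hφ : IsAlgMap φ) {x : FPS A}
    (hx : x ∈ filt A 1) : φ (fexp K x) = fexp K (φ x) := hφ.map_evalSeries _ hx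

theorem IsAntiMap.map_fexp {φ : FPS A →ₗ[K] FPS B} (hφ : IsAntiMap φ) {x : FPS A}
    (hx : x ∈ filt A 1) : φ (fexp K x) = fexp K (φ x) := hφ.map_evalSeries _ hx

end Exp

end JordanianTwist

end

noncomputable section

namespace JordanianTwist

open MvPowerSeries (coeff monomial)

/-! ### Completed tensor products -/

section Tens

variable {K : Type*} [Field K] {A B C D A' B' : Type*} [Ring A] [Algebra K A] [Ring B] [Algebra K B]
  [Ring C] [Algebra K C] [Ring D] [Algebra K D] [Ring A'] [Algebra K A'] [Ring B'] [Algebra K B']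

variable (K B) in
/-- The map `a ↦ a ⊗ 1`. -/
def left : FPS A →ₗ[K] FPS (A ⊗[K] B) :=
  mapL (Algebra.TensorProduct.includeLeft : A →ₐ[K] A ⊗[K] B).toLinearMap

variable (K A) in
/-- The map `b ↦ 1 ⊗ b`. -/
def right : FPS B →ₗ[K] FPS (A ⊗[K] B) :=
  mapL (Algebra.TensorProduct.includeRight : B →ₐ[K] A ⊗[K] B).toLinearMap

theorem isAlgMap_left : IsAlgMap (left K B : FPS A →ₗ[K] FPS (A ⊗[K] B)) := isAlgMap_mapL _

theorem isAlgMap_right : IsAlgMap (right K A : FPS B →ₗ[K] FPS (A ⊗[K] B)) := isAlgMap_mapL _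

theorem tens_eq (a : FPS A) (b : FPS B) : a ⊠[K] b = left K B a * right K A b := by
  ext d
  rw [MvPowerSeries.coeff_mul]
  refine Finset.sum_congr rfl fun p _ => ?_
  rw [left, right, coeff_mapL, coeff_mapL]
  simp

theorem left_commute_right (a : FPS A) (b : FPS B) : Commute (left K B a) (right K A b) := by
  have h1 : ∀ (a : A) (b : FPS B), left K B (const a) * right K A b =
      right K A b * left K B (const a) := fun a =>
    ((isCts_mulLeft _).comp isAlgMap_right.toIsCts).ext
      ((isCts_mulRight _).comp isAlgMap_right.toIsCts) fun b => by
        simp [left, right, mapL_const, ← const_mul]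
  exact ((isCts_mulRight _).comp isAlgMap_left.toIsCts).ext
      ((isCts_mulLeft _).comp isAlgMap_left.toIsCts) (fun a => h1 a b) a

theorem tensL_apply (a : FPS A) (b : FPS B) : tensL K A B a b = a ⊠[K] b := rfl

theorem isCts_tensL (a : FPS A) : IsCts (tensL K A B a) := by
  have : tensL K A B a = LinearMap.mulLeft K (left K B a) ∘ₗ right K A :=
    LinearMap.ext fun b => tens_eq a b
  rw [this]
  exact (isCts_mulLeft _).comp isAlgMap_right.toIsCts

theorem isCts_tensL_flip (b : FPS B) : IsCts ((tensL K A B).flip b) := by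
  have : (tensL K A B).flip b = LinearMap.mulRight K (right K A b) ∘ₗ left K B :=
    LinearMap.ext fun a => tens_eq a b
  rw [this]
  exact (isCts_mulRight _).comp isAlgMap_left.toIsCts

theorem const_tens_const (a : A) (b : B) : const a ⊠[K] const b = const (a ⊗ₜ[K] b) := by
  rw [tens_eq, left, right, mapL_const, mapL_const, ← const_mul]
  simp

theorem tens_mul_tens (a c : FPS A) (b d : FPS B) :
    (a ⊠[K] b) * (c ⊠[K] d) = (a * c) ⊠[K] (b * d) := by
  simp only [tens_eq, isAlgMap_left.map_mul, isAlgMap_right.map_mul]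
  rw [mul_assoc, ← mul_assoc (right K A b), ← (left_commute_right c b).eq]
  simp only [mul_assoc]

theorem left_eq (a : FPS A) : left K B a = a ⊠[K] (1 : FPS B) := by
  rw [tens_eq, isAlgMap_right.map_one, mul_one]

theorem right_eq (b : FPS B) : right K A b = (1 : FPS A) ⊠[K] b := by
  rw [tens_eq, isAlgMap_left.map_one, one_mul]

theorem one_tens_one : (1 : FPS A) ⊠[K] (1 : FPS B) = 1 := by
  rw [← left_eq, isAlgMap_left.map_one]

theorem add_tens (a a' : FPS A) (b : FPS B) : (a + a') ⊠[K] b = a ⊠[K] b + a' ⊠[K] b :=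
  LinearMap.map_add₂ (tensL K A B) a a' b

theorem tens_add (a : FPS A) (b b' : FPS B) : a ⊠[K] (b + b') = a ⊠[K] b + a ⊠[K] b' :=
  map_add (tensL K A B a) b b'

theorem sub_tens (a a' : FPS A) (b : FPS B) : (a - a') ⊠[K] b = a ⊠[K] b - a' ⊠[K] b :=
  LinearMap.map_sub₂ (tensL K A B) a a' b

theorem tens_sub (a : FPS A) (b b' : FPS B) : a ⊠[K] (b - b') = a ⊠[K] b - a ⊠[K] b' :=
  map_sub (tensL K A B a) b b'

theorem neg_tens (a : FPS A) (b : FPS B) : (-a) ⊠[K] b = -(a ⊠[K] b) :=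
  LinearMap.map_neg₂ (tensL K A B) a b

theorem tens_neg (a : FPS A) (b : FPS B) : a ⊠[K] (-b) = -(a ⊠[K] b) :=
  map_neg (tensL K A B a) b

theorem smul_tens (c : K) (a : FPS A) (b : FPS B) : (c • a) ⊠[K] b = c • (a ⊠[K] b) :=
  LinearMap.map_smul₂ (tensL K A B) c a b

theorem tens_smul (c : K) (a : FPS A) (b : FPS B) : a ⊠[K] (c • b) = c • (a ⊠[K] b) :=
  map_smul (tensL K A B a) c b

theorem parH_tens (a : FPS A) (b : FPS B) : (parH * a) ⊠[K] b = parH * (a ⊠[K] b) :=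
  (isCts_tensL_flip b).map_parH a

theorem tens_parH (a : FPS A) (b : FPS B) : a ⊠[K] (parH * b) = parH * (a ⊠[K] b) :=
  (isCts_tensL a).map_parH b

theorem tens_mem_filt_left {n : ℕ} {a : FPS A} (ha : a ∈ filt A n) (b : FPS B) :
    a ⊠[K] b ∈ filt (A ⊗[K] B) n := (isCts_tensL_flip b).map_filt ha

theorem tens_mem_filt_right {n : ℕ} (a : FPS A) {b : FPS B} (hb : b ∈ filt B n) :
    a ⊠[K] b ∈ filt (A ⊗[K] B) n := (isCts_tensL a).map_filt hb

/-- A map given on tensors by a bi-continuous expression is determined by constant tensors. -/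
theorem IsCts.map_tens_of_const {f : FPS (A ⊗[K] B) →ₗ[K] FPS C}
    (hf : IsCts f) (g : FPS A →ₗ[K] FPS B →ₗ[K] FPS C) (hg1 : ∀ a, IsCts (g a))
    (hg2 : ∀ b, IsCts (g.flip b))
    (h : ∀ a b, f (const (a ⊗ₜ b)) = g (const a) (const b)) (a : FPS A) (b : FPS B) :
    f (a ⊠[K] b) = g a b := by
  have h1 : ∀ (a : A) (b : FPS B), f (const a ⊠[K] b) = g (const a) b := fun a =>
    (hf.comp (isCts_tensL _)).ext (hg1 _) fun b => by
      simp [tensL_apply, const_tens_const, h]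
  exact (hf.comp (isCts_tensL_flip b)).ext (hg2 b) (fun a => h1 a b) a

variable {f : FPS A →ₗ[K] FPS B} {g : FPS C →ₗ[K] FPS D}

variable (f g) in
theorem isCts_tensMap : IsCts (tensMap f g) := isCts_extend _

variable (f g) in
theorem tensMap_const (a : A) (c : C) :
    tensMap f g (const (a ⊗ₜ c)) = f (const a) ⊠[K] g (const c) := by
  rw [tensMap, extend_const]; rfl

theorem tensMap_tens (hf : IsCts f) (hg : IsCts g) (a : FPS A) (c : FPS C) :
    tensMap f g (a ⊠[K] c) = f a ⊠[K] g c := by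
  refine (isCts_tensMap f g).map_tens_of_const ((tensL K B D).compl₁₂ f g)
    (fun a => (isCts_tensL (f a)).comp hg)
    (fun b => (isCts_tensL_flip (g b)).comp hf) (fun a c => ?_) a c
  rw [tensMap_const]; rfl

/-- Multiplicativity of a continuous map on a tensor product can be tested on pure tensors. -/
theorem IsCts.isAlgMap_of_tmul {f : FPS (A ⊗[K] B) →ₗ[K] FPS C} (hf : IsCts f)
    (h1 : f (const (1 ⊗ₜ 1)) = 1)
    (h : ∀ a b a' b', f (const ((a * a') ⊗ₜ (b * b'))) =
      f (const (a ⊗ₜ b)) * f (const (a' ⊗ₜ b'))) : IsAlgMap f where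
  toIsCts := hf
  map_one := by rw [← const_one]; exact h1
  map_mul x y := by
    have h2 : ∀ a b y, f (const (a ⊗ₜ b) * y) = f (const (a ⊗ₜ b)) * f y := fun a b =>
      (hf.comp (isCts_mulLeft _)).ext_tmul ((isCts_mulLeft _).comp hf) fun a' b' => by
        simp [← const_mul, h]
    exact (hf.comp (isCts_mulRight y)).ext_tmul ((isCts_mulRight _).comp hf)
      (fun a b => h2 a b y) x

theorem isAlgMap_tensMap (hf : IsAlgMap f) (hg : IsAlgMap g) : IsAlgMap (tensMap f g) :=
  (isCts_tensMap f g).isAlgMap_of_tmul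
    (by rw [tensMap_const, const_one, const_one, hf.map_one, hg.map_one, one_tens_one])
    fun a b a' b' => by
      simp only [tensMap_const, tens_mul_tens, ← hf.map_mul, ← hg.map_mul, const_mul]

theorem tensMap_mapL (f : A →ₗ[K] B) (g : C →ₗ[K] D) (x : FPS (A ⊗[K] C)) :
    tensMap (mapL f) (mapL g) x = mapL (TensorProduct.map f g) x :=
  (isCts_tensMap _ _).ext_tmul (isCts_mapL _) (fun a b => by
    simp [tensMap_const, mapL_const, const_tens_const]) x

theorem mapL_id : mapL (LinearMap.id : A →ₗ[K] A) = LinearMap.id := rfl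

theorem mapL_comp_apply (f : B →ₗ[K] C) (g : A →ₗ[K] B) (x : FPS A) :
    mapL f (mapL g x) = mapL (f ∘ₗ g) x := rfl

theorem mulMap_tens (a b : FPS A) : mulMap (a ⊠[K] b) = a * b :=
  (isCts_mapL _).map_tens_of_const (LinearMap.mul K (FPS A)) (fun a => isCts_mulLeft a)
    (fun b => isCts_mulRight b) (fun a b => by simp [mapL_const, const_mul]) a b

theorem isCts_mulMap : IsCts (mulMap : FPS (A ⊗[K] A) →ₗ[K] FPS A) := isCts_mapL _

theorem isAlgMap_flip : IsAlgMap (flip : FPS (A ⊗[K] A) →ₗ[K] FPS (A ⊗[K] A)) :=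
  isAlgMap_mapL (Algebra.TensorProduct.comm K A A).toAlgHom

theorem flip_flip (x : FPS (A ⊗[K] A)) : flip (flip x) = x := by
  rw [flip, mapL_comp_apply]
  have : (TensorProduct.comm K A A).toLinearMap ∘ₗ (TensorProduct.comm K A A).toLinearMap =
    LinearMap.id := by ext; simp
  rw [this, mapL_id]; rfl

theorem isAlgMap_regroup :
    IsAlgMap (regroup : FPS (A ⊗[K] (A ⊗[K] A)) →ₗ[K] FPS (A ⊗[K] A ⊗[K] A)) :=
  isAlgMap_mapL (Algebra.TensorProduct.assoc K K K A A A).symm.toAlgHom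

theorem isAlgMap_leg12 : IsAlgMap (leg12 : FPS (A ⊗[K] A) →ₗ[K] FPS (A ⊗[K] A ⊗[K] A)) :=
  isAlgMap_mapL _

theorem isAlgMap_leg13 : IsAlgMap (leg13 : FPS (A ⊗[K] A) →ₗ[K] FPS (A ⊗[K] A ⊗[K] A)) :=
  isAlgMap_mapL (Algebra.TensorProduct.map
    (Algebra.TensorProduct.includeLeft : A →ₐ[K] A ⊗[K] A) (AlgHom.id K A))

theorem isAlgMap_leg23 : IsAlgMap (leg23 : FPS (A ⊗[K] A) →ₗ[K] FPS (A ⊗[K] A ⊗[K] A)) :=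
  isAlgMap_mapL (Algebra.TensorProduct.map
    (Algebra.TensorProduct.includeRight : A →ₐ[K] A ⊗[K] A) (AlgHom.id K A))

theorem flip_tens (a b : FPS A) : flip (a ⊠[K] b) = b ⊠[K] a :=
  isAlgMap_flip.toIsCts.map_tens_of_const (tensL K A A).flip isCts_tensL_flip isCts_tensL
    (fun a b => by
      simp only [flip, mapL_const, LinearMap.flip_apply, tensL_apply, const_tens_const]; rfl) a b

theorem leg12_tens (a b : FPS A) : leg12 (a ⊠[K] b) = a ⊠[K] b ⊠[K] 1 :=
  left_eq (B := A) (a ⊠[K] b)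

theorem leg13_tens (a b : FPS A) : leg13 (a ⊠[K] b) = a ⊠[K] 1 ⊠[K] b :=
  (isAlgMap_leg13 (K := K) (A := A)).toIsCts.map_tens_of_const ((tensL K (A ⊗[K] A) A) ∘ₗ left K A)
    (fun a => isCts_tensL _) (fun b => (isCts_tensL_flip b).comp isAlgMap_left.toIsCts)
    (fun a b => by
      simp only [leg13, mapL_const, LinearMap.comp_apply, tensL_apply, left, const_tens_const]
      rfl) a b |>.trans (by simp [tensL_apply, left_eq])

theorem leg23_tens (a b : FPS A) : leg23 (a ⊠[K] b) = 1 ⊠[K] a ⊠[K] b :=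
  (isAlgMap_leg23 (K := K) (A := A)).toIsCts.map_tens_of_const ((tensL K (A ⊗[K] A) A) ∘ₗ right K A)
    (fun a => isCts_tensL _) (fun b => (isCts_tensL_flip b).comp isAlgMap_right.toIsCts)
    (fun a b => by
      simp only [leg23, mapL_const, LinearMap.comp_apply, tensL_apply, right, const_tens_const]
      rfl) a b |>.trans (by simp [tensL_apply, right_eq])

theorem regroup_const (a b c : A) :
    regroup (const (a ⊗ₜ[K] (b ⊗ₜ[K] c))) = const (a ⊗ₜ[K] b ⊗ₜ[K] c) := by
  rw [regroup, mapL_const]; rfl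

theorem regroup_tens (a b c : FPS A) : regroup (a ⊠[K] (b ⊠[K] c)) = a ⊠[K] b ⊠[K] c := by
  have h1 : ∀ (a b : A) (c : FPS A), regroup (const a ⊠[K] (const b ⊠[K] c)) =
      const a ⊠[K] const b ⊠[K] c := fun a b =>
    ((isAlgMap_regroup (K := K) (A := A)).toIsCts.comp
      ((isCts_tensL _).comp (isCts_tensL _))).ext (isCts_tensL _)
      fun c => by
        simp only [LinearMap.comp_apply, tensL_apply, const_tens_const, regroup_const]
  have h2 : ∀ (a : A) (b c : FPS A), regroup (const a ⊠[K] (b ⊠[K] c)) =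
      const a ⊠[K] b ⊠[K] c := fun a b c =>
    ((isAlgMap_regroup (K := K) (A := A)).toIsCts.comp
      ((isCts_tensL _).comp (isCts_tensL_flip c))).ext
      ((isCts_tensL_flip c).comp (isCts_tensL (const a))) (fun b => h1 a b c) b
  exact ((isAlgMap_regroup (K := K) (A := A)).toIsCts.comp (isCts_tensL_flip (b ⊠[K] c))).ext
      ((isCts_tensL_flip c).comp (isCts_tensL_flip b)) (fun a => h2 a b c) a

end Tens

end JordanianTwist

end

noncomputable section

namespace JordanianTwist

open MvPowerSeries (coeff monomial)

/-! ### Twisting a cocommutative Hopf algebra -/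

section TwistTheory

variable {K : Type*} [Field K] {A : Type*} [Ring A] [Algebra K A]

/-- `Δ₀`, `ε₀`, `S₀` make `A` a cocommutative Hopf algebra; the antimultiplicativity of `S₀` is
part of the data. -/
structure IsCocommHopf (Δ₀ : A →ₐ[K] A ⊗[K] A) (ε₀ : A →ₐ[K] K) (S₀ : A →ₗ[K] A) : Prop where
  coassoc : ∀ a, (TensorProduct.assoc K A A A).symm (Δ₀.toLinearMap.lTensor A (Δ₀ a)) =
    Δ₀.toLinearMap.rTensor A (Δ₀ a)
  counit_left : ∀ a, TensorProduct.lid K A (ε₀.toLinearMap.rTensor A (Δ₀ a)) = a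
  counit_right : ∀ a, TensorProduct.rid K A (ε₀.toLinearMap.lTensor A (Δ₀ a)) = a
  cocomm : ∀ a, TensorProduct.comm K A A (Δ₀ a) = Δ₀ a
  antipode_one : S₀ 1 = 1
  antipode_mul : ∀ a b, S₀ (a * b) = S₀ b * S₀ a
  antipode_left : ∀ a, LinearMap.mul' K A (S₀.rTensor A (Δ₀ a)) = algebraMap K A (ε₀ a)
  antipode_right : ∀ a, LinearMap.mul' K A (S₀.lTensor A (Δ₀ a)) = algebraMap K A (ε₀ a)

/-- A series with constant term `1` is invertible, by the geometric series. -/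
theorem isUnit_of_sub_one_mem_filt (K : Type*) [Field K] {A : Type*} [Ring A] [Algebra K A]
    {u : FPS A} (hu : u - 1 ∈ filt A 1) : IsUnit u := by
  have hx : 1 - u ∈ filt A 1 := by simpa using neg_mem hu
  have e : evalSeries (1 - PowerSeries.X : PowerSeries K) (1 - u) = u := by
    rw [evalSeries_sub, evalSeries_one hx, evalSeries_X hx, sub_sub_cancel]
  have h1 := evalSeries_mul (K := K) (1 - PowerSeries.X) (PowerSeries.mk 1) hx
  have h2 := evalSeries_mul (K := K) (PowerSeries.mk 1) (1 - PowerSeries.X) hx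
  rw [mul_comm (PowerSeries.mk 1)] at h2
  rw [one_sub_X_mul_mk_one, evalSeries_one hx, e] at h1 h2
  exact ⟨⟨u, _, h1.symm, h2.symm⟩, rfl⟩

variable (Δ₀ : A →ₐ[K] A ⊗[K] A) (ε₀ : A →ₐ[K] K) (S₀ : A →ₗ[K] A)

/-- `Δ₀ ⊗ id` on series. -/
def comul12 : FPS (A ⊗[K] A) →ₗ[K] FPS (A ⊗[K] A ⊗[K] A) := mapL (Δ₀.toLinearMap.rTensor A)

/-- `id ⊗ Δ₀` on series. -/
def comul23 : FPS (A ⊗[K] A) →ₗ[K] FPS (A ⊗[K] A ⊗[K] A) :=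
  regroup ∘ₗ mapL (Δ₀.toLinearMap.lTensor A)

theorem isAlgMap_comul12 : IsAlgMap (comul12 Δ₀) :=
  isAlgMap_mapL (Algebra.TensorProduct.map Δ₀ (AlgHom.id K A))

theorem isAlgMap_comul23 : IsAlgMap (comul23 Δ₀) :=
  (isAlgMap_regroup (K := K) (A := A)).comp
    (isAlgMap_mapL (Algebra.TensorProduct.map (AlgHom.id K A) Δ₀))

theorem comul12_const (a b : A) : comul12 Δ₀ (const (a ⊗ₜ b)) = const (Δ₀ a ⊗ₜ b) := by
  rw [comul12, mapL_const]; rfl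

theorem comul23_const (a b : A) : comul23 Δ₀ (const (a ⊗ₜ b)) =
    const ((TensorProduct.assoc K A A A).symm (a ⊗ₜ Δ₀ b)) := by
  rw [comul23, LinearMap.comp_apply, mapL_const, regroup, mapL_const]; rfl

theorem regroup_one_tens (P : FPS (A ⊗[K] A)) : regroup ((1 : FPS A) ⊠[K] P) = leg23 P := by
  refine ((isAlgMap_regroup (K := K) (A := A)).toIsCts.comp (isCts_tensL 1)).ext_tmul
    (isAlgMap_leg23 (K := K) (A := A)).toIsCts (fun a b => ?_) P
  rw [← const_one, LinearMap.comp_apply, tensL_apply, const_tens_const, regroup_const, leg23,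
    mapL_const]
  rfl

section

variable {F G : FPS (A ⊗[K] A)} (hFG : F * G = 1) (hGF : G * F = 1)
include hFG hGF

theorem inverse_eq : Ring.inverse F = G := by
  have := Ring.inverse_unit (⟨F, G, hFG, hGF⟩ : (FPS (A ⊗[K] A))ˣ)
  simpa using this

theorem twistComul_apply (x : FPS A) :
    twistComul Δ₀.toLinearMap F x = F * (mapL Δ₀.toLinearMap x * G) := by
  rw [twistComul, inverse_eq hFG hGF]; rfl

theorem isAlgMap_twistComul : IsAlgMap (twistComul Δ₀.toLinearMap F) := by
  rw [twistComul, inverse_eq hFG hGF]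
  exact (isAlgMap_conj hFG hGF).comp (isAlgMap_mapL Δ₀)

/-- `Δ ⊗ id` is `Δ₀ ⊗ id` followed by conjugation by `F₁₂`. -/
theorem tensMap_twistComul_id (y : FPS (A ⊗[K] A)) :
    tensMap (twistComul Δ₀.toLinearMap F) LinearMap.id y =
      leg12 F * (comul12 Δ₀ y * leg12 G) := by
  refine (isCts_tensMap _ _).ext_tmul ((isCts_mulLeft (leg12 F)).comp
    ((isCts_mulRight (leg12 G)).comp (isAlgMap_comul12 Δ₀).toIsCts)) (fun a b => ?_) y
  have h : ∀ P : FPS (A ⊗[K] A), leg12 P = P ⊠[K] (1 : FPS A) := left_eq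
  simp only [LinearMap.comp_apply, LinearMap.mulLeft_apply, LinearMap.mulRight_apply,
    tensMap_const, comul12_const, LinearMap.id_apply, twistComul_apply Δ₀ hFG hGF, mapL_const]
  simp only [← const_tens_const, h, tens_mul_tens, one_mul, mul_one]
  rfl

/-- `id ⊗ Δ` is `id ⊗ Δ₀` followed by conjugation by `F₂₃`. -/
theorem regroup_tensMap_id_twistComul (y : FPS (A ⊗[K] A)) :
    regroup (tensMap LinearMap.id (twistComul Δ₀.toLinearMap F) y) =
      leg23 F * (comul23 Δ₀ y * leg23 G) := by
  refine ((isAlgMap_regroup (K := K) (A := A)).toIsCts.comp (isCts_tensMap _ _)).ext_tmul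
    ((isCts_mulLeft (leg23 F)).comp
    ((isCts_mulRight (leg23 G)).comp (isAlgMap_comul23 Δ₀).toIsCts)) (fun a b => ?_) y
  have h : regroup (const (a ⊗ₜ[K] Δ₀ b)) = comul23 Δ₀ (const (a ⊗ₜ b)) := by
    rw [comul23_const, regroup, mapL_const]; rfl
  simp only [LinearMap.comp_apply, LinearMap.mulLeft_apply, LinearMap.mulRight_apply,
    tensMap_const, LinearMap.id_apply, twistComul_apply Δ₀ hFG hGF, mapL_const,
    ← regroup_one_tens, ← h, ← (isAlgMap_regroup (K := K) (A := A)).map_mul]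
  simp only [← const_tens_const, tens_mul_tens, one_mul, mul_one]
  rfl

end

/-! #### The antipode -/

/-- The map `a ⊗ b ↦ a w S₀(b)`. -/
def mulAntipode (w : FPS A) : FPS (A ⊗[K] A) →ₗ[K] FPS A :=
  mulMap ∘ₗ LinearMap.mulRight K (left K A w) ∘ₗ mapL (S₀.lTensor A)

/-- The map `a ⊗ b ↦ S₀(a) w b`. -/
def antipodeMul (w : FPS A) : FPS (A ⊗[K] A) →ₗ[K] FPS A :=
  mulMap ∘ₗ LinearMap.mulLeft K (right K A w) ∘ₗ mapL (S₀.rTensor A)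

theorem isCts_mulAntipode (w : FPS A) : IsCts (mulAntipode S₀ w) :=
  isCts_mulMap.comp ((isCts_mulRight _).comp (isCts_mapL _))

theorem isCts_antipodeMul (w : FPS A) : IsCts (antipodeMul S₀ w) :=
  isCts_mulMap.comp ((isCts_mulLeft _).comp (isCts_mapL _))

theorem mulAntipode_const (w : FPS A) (a b : A) :
    mulAntipode S₀ w (const (a ⊗ₜ b)) = const a * w * const (S₀ b) := by
  simp only [mulAntipode, LinearMap.comp_apply, mapL_const, LinearMap.lTensor_tmul,
    LinearMap.mulRight_apply]
  simp only [← const_tens_const, left_eq, tens_mul_tens, mul_one, mulMap_tens]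

theorem antipodeMul_const (w : FPS A) (a b : A) :
    antipodeMul S₀ w (const (a ⊗ₜ b)) = const (S₀ a) * w * const b := by
  simp only [antipodeMul, LinearMap.comp_apply, mapL_const, LinearMap.rTensor_tmul,
    LinearMap.mulLeft_apply]
  simp only [← const_tens_const, right_eq, tens_mul_tens, one_mul, mulMap_tens,
    mul_assoc]

variable {Δ₀ ε₀ S₀}
variable (hA : IsCocommHopf Δ₀ ε₀ S₀)
include hA

theorem mulAntipode_mul (w : FPS A) (P Q : FPS (A ⊗[K] A)) :
    mulAntipode S₀ w (P * Q) = mulAntipode S₀ (mulAntipode S₀ w Q) P := by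
  refine ((isCts_mulAntipode S₀ w).comp (isCts_mulRight Q)).ext_tmul
    (isCts_mulAntipode S₀ _) (fun a b => ?_) P
  rw [mulAntipode_const, LinearMap.comp_apply, LinearMap.mulRight_apply]
  refine ((isCts_mulAntipode S₀ w).comp (isCts_mulLeft (const (a ⊗ₜ b)))).ext_tmul
    ((isCts_mulRight (const (S₀ b))).comp ((isCts_mulLeft (const a)).comp (isCts_mulAntipode S₀ w)))
    (fun c d => ?_) Q
  simp only [LinearMap.comp_apply, LinearMap.mulLeft_apply, LinearMap.mulRight_apply, ← const_mul,
    Algebra.TensorProduct.tmul_mul_tmul, mulAntipode_const, hA.antipode_mul]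
  simp only [const_mul, mul_assoc]

theorem antipodeMul_mul (w : FPS A) (P Q : FPS (A ⊗[K] A)) :
    antipodeMul S₀ w (P * Q) = antipodeMul S₀ (antipodeMul S₀ w P) Q := by
  refine ((isCts_antipodeMul S₀ w).comp (isCts_mulLeft P)).ext_tmul
    (isCts_antipodeMul S₀ _) (fun a b => ?_) Q
  rw [antipodeMul_const, LinearMap.comp_apply, LinearMap.mulLeft_apply]
  refine ((isCts_antipodeMul S₀ w).comp (isCts_mulRight (const (a ⊗ₜ b)))).ext_tmul
    ((isCts_mulRight (const b)).comp
      ((isCts_mulLeft (const (S₀ a))).comp (isCts_antipodeMul S₀ w))) (fun c d => ?_) P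
  simp only [LinearMap.comp_apply, LinearMap.mulLeft_apply, LinearMap.mulRight_apply, ← const_mul,
    Algebra.TensorProduct.tmul_mul_tmul, antipodeMul_const, hA.antipode_mul]
  simp only [const_mul, mul_assoc]

theorem mulAntipode_one (w : FPS A) : mulAntipode S₀ w 1 = w := by
  rw [← const_one, Algebra.TensorProduct.one_def, mulAntipode_const, hA.antipode_one, const_one]
  simp

theorem antipodeMul_one (w : FPS A) : antipodeMul S₀ w 1 = w := by
  rw [← const_one, Algebra.TensorProduct.one_def, antipodeMul_const, hA.antipode_one, const_one]
  simp

theorem mulAntipode_comul (x : FPS A) :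
    mulAntipode S₀ 1 (mapL Δ₀.toLinearMap x) = base K A (mapL ε₀.toLinearMap x) := by
  rw [base_eq_mapL]
  refine ((isCts_mulAntipode S₀ 1).comp (isCts_mapL Δ₀.toLinearMap)).ext
    ((isCts_mapL (Algebra.linearMap K A)).comp (isCts_mapL ε₀.toLinearMap)) (fun a => ?_) x
  have := hA.antipode_right a
  simp only [mulAntipode, isAlgMap_left.map_one, LinearMap.comp_apply, LinearMap.mulRight_apply,
    mul_one, mapL_const, mulMap, AlgHom.toLinearMap_apply, this]
  rfl

theorem antipodeMul_comul (x : FPS A) :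
    antipodeMul S₀ 1 (mapL Δ₀.toLinearMap x) = base K A (mapL ε₀.toLinearMap x) := by
  rw [base_eq_mapL]
  refine ((isCts_antipodeMul S₀ 1).comp (isCts_mapL Δ₀.toLinearMap)).ext
    ((isCts_mapL (Algebra.linearMap K A)).comp (isCts_mapL ε₀.toLinearMap)) (fun a => ?_) x
  have := hA.antipode_left a
  simp only [antipodeMul, isAlgMap_right.map_one, LinearMap.comp_apply, LinearMap.mulLeft_apply,
    one_mul, mapL_const, mulMap, AlgHom.toLinearMap_apply, this]
  rfl

omit hA in
theorem mulAntipode_base (c : FPS K) (y : FPS (A ⊗[K] A)) :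
    mulAntipode S₀ (base K A c) y = base K A c * mulAntipode S₀ 1 y := by
  refine (isCts_mulAntipode S₀ _).ext_tmul ((isCts_mulLeft _).comp (isCts_mulAntipode S₀ 1))
    (fun a b => ?_) y
  simp only [mulAntipode_const, LinearMap.comp_apply, LinearMap.mulLeft_apply, mul_one]
  rw [← (base_commute c _).eq, mul_assoc]

omit hA in
theorem antipodeMul_base (c : FPS K) (y : FPS (A ⊗[K] A)) :
    antipodeMul S₀ (base K A c) y = base K A c * antipodeMul S₀ 1 y := by
  refine (isCts_antipodeMul S₀ _).ext_tmul ((isCts_mulLeft _).comp (isCts_antipodeMul S₀ 1))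
    (fun a b => ?_) y
  simp only [antipodeMul_const, LinearMap.comp_apply, LinearMap.mulLeft_apply, mul_one]
  rw [← (base_commute c _).eq, mul_assoc]

omit hA in
theorem twistU_eq (F : FPS (A ⊗[K] A)) : twistU S₀ F = mulAntipode S₀ 1 F := by
  simp [twistU, mulAntipode, isAlgMap_left.map_one]

variable (S₀) in
/-- The map `a ⊗ b ⊗ c ↦ a S₀(b) c`. -/
def mulAntipodeMul : A ⊗[K] A ⊗[K] A →ₗ[K] A :=
  LinearMap.mul' K A ∘ₗ (LinearMap.mul' K A ∘ₗ S₀.lTensor A).rTensor A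

omit hA in
theorem mulAntipodeMul_tmul (a b c : A) :
    mulAntipodeMul S₀ (a ⊗ₜ b ⊗ₜ c) = a * S₀ b * c := by
  simp [mulAntipodeMul]

theorem mulAntipodeMul_assoc_mul (a d : A) (s t : A ⊗[K] A) :
    mulAntipodeMul S₀ ((TensorProduct.assoc K A A A).symm (a ⊗ₜ t) * s ⊗ₜ d) =
      a * LinearMap.mul' K A (S₀.lTensor A s) * LinearMap.mul' K A (S₀.rTensor A t) * d := by
  induction t with
  | zero => simp
  | add t t' h h' => simp only [TensorProduct.tmul_add, map_add, add_mul, mul_add, h, h']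
  | tmul x y =>
    induction s with
    | zero => simp
    | add t t' h h' => simp only [TensorProduct.add_tmul, map_add, add_mul, mul_add, h, h']
    | tmul z w =>
      simp [mulAntipodeMul_tmul, hA.antipode_mul, mul_assoc]

theorem mulAntipodeMul_leg (P Q : FPS (A ⊗[K] A)) :
    mapL (mulAntipodeMul S₀) (leg23 P * leg12 Q) =
      mulAntipode S₀ 1 Q * antipodeMul S₀ 1 P := by
  refine ((isCts_mapL (mulAntipodeMul S₀)).comp ((isCts_mulRight (leg12 Q)).comp
    (isAlgMap_leg23 (K := K) (A := A)).toIsCts)).ext_tmul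
    ((isCts_mulLeft (mulAntipode S₀ 1 Q)).comp (isCts_antipodeMul S₀ 1)) (fun a b => ?_) P
  refine ((isCts_mapL (mulAntipodeMul S₀)).comp ((isCts_mulLeft (leg23 (const (a ⊗ₜ[K] b)))).comp
    (isAlgMap_leg12 (K := K) (A := A)).toIsCts)).ext_tmul
    ((isCts_mulRight (antipodeMul S₀ 1 (const (a ⊗ₜ b)))).comp (isCts_mulAntipode S₀ 1))
    (fun c d => ?_) Q
  simp only [LinearMap.comp_apply, LinearMap.mulLeft_apply, LinearMap.mulRight_apply, leg23, leg12,
    mapL_const, ← const_mul, mulAntipode_const, antipodeMul_const, mul_one]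
  simp [mulAntipodeMul_tmul, hA.antipode_mul, mul_assoc]

theorem mulAntipodeMul_comul (P Q : FPS (A ⊗[K] A)) :
    mapL (mulAntipodeMul S₀) (comul23 Δ₀ P * comul12 Δ₀ Q) =
      mapL ((TensorProduct.rid K A).toLinearMap ∘ₗ ε₀.toLinearMap.lTensor A) P *
      mapL ((TensorProduct.lid K A).toLinearMap ∘ₗ ε₀.toLinearMap.rTensor A) Q := by
  set r := (TensorProduct.rid K A).toLinearMap ∘ₗ ε₀.toLinearMap.lTensor A with hr
  set l := (TensorProduct.lid K A).toLinearMap ∘ₗ ε₀.toLinearMap.rTensor A with hl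
  refine ((isCts_mapL (mulAntipodeMul S₀)).comp ((isCts_mulRight (comul12 Δ₀ Q)).comp
    (isAlgMap_comul23 Δ₀).toIsCts)).ext_tmul
    ((isCts_mulRight (mapL l Q)).comp (isCts_mapL r)) (fun a b => ?_) P
  refine ((isCts_mapL (mulAntipodeMul S₀)).comp
    ((isCts_mulLeft (comul23 Δ₀ (const (a ⊗ₜ b)))).comp (isAlgMap_comul12 Δ₀).toIsCts)).ext_tmul
    ((isCts_mulLeft (mapL r (const (a ⊗ₜ b)))).comp (isCts_mapL l)) (fun c d => ?_) Q
  simp only [LinearMap.comp_apply, LinearMap.mulLeft_apply,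
    comul23_const, comul12_const, mapL_const, ← const_mul]
  rw [mulAntipodeMul_assoc_mul hA, hA.antipode_left, hA.antipode_right]
  congr 1
  simp [hr, hl, Algebra.algebraMap_eq_smul_one, smul_comm (ε₀ b)]

variable {F G : FPS (A ⊗[K] A)} (hF : IsTwist Δ₀.toLinearMap ε₀.toLinearMap F)
  (hFG : F * G = 1) (hGF : G * F = 1)
include hF hFG hGF

omit hA hF in
/-- An algebra map sends inverse pairs to inverse pairs. -/
theorem IsAlgMap.map_mul_eq_one {B : Type*} [Ring B] [Algebra K B]
    {f : FPS (A ⊗[K] A) →ₗ[K] FPS B} (hf : IsAlgMap f) :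
    f F * f G = 1 ∧ f G * f F = 1 := by
  rw [← hf.map_mul, ← hf.map_mul, hFG, hGF, hf.map_one]
  exact ⟨rfl, rfl⟩

omit hA in
theorem counit_left_inverse :
    mapL ((TensorProduct.lid K A).toLinearMap ∘ₗ ε₀.toLinearMap.rTensor A) G = 1 := by
  have h : IsAlgMap (mapL ((TensorProduct.lid K A).toLinearMap ∘ₗ ε₀.toLinearMap.rTensor A)) :=
    isAlgMap_mapL ((Algebra.TensorProduct.lid K A).toAlgHom.comp
      (Algebra.TensorProduct.map ε₀ (AlgHom.id K A)))
  simpa [hF.counit_left] using (h.map_mul_eq_one hFG hGF).1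

omit hA in
theorem counit_right_inverse :
    mapL ((TensorProduct.rid K A).toLinearMap ∘ₗ ε₀.toLinearMap.lTensor A) G = 1 := by
  have h : IsAlgMap (mapL ((TensorProduct.rid K A).toLinearMap ∘ₗ ε₀.toLinearMap.lTensor A)) :=
    isAlgMap_mapL ((Algebra.TensorProduct.rid K K A).toAlgHom.comp
      (Algebra.TensorProduct.map (AlgHom.id K A) ε₀))
  simpa [hF.counit_right] using (h.map_mul_eq_one hFG hGF).1

omit hA in
/-- The two sides of the cocycle equation have the same inverse. -/
theorem cocycle_inverse : comul12 Δ₀ G * leg12 G = comul23 Δ₀ G * leg23 G := by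
  have c : leg12 F * comul12 Δ₀ F = leg23 F * comul23 Δ₀ F := hF.cocycle
  have i12 := (isAlgMap_comul12 Δ₀).map_mul_eq_one hFG hGF
  have i23 := (isAlgMap_comul23 Δ₀).map_mul_eq_one hFG hGF
  have j12 := (isAlgMap_leg12 (K := K) (A := A)).map_mul_eq_one hFG hGF
  have j23 := (isAlgMap_leg23 (K := K) (A := A)).map_mul_eq_one hFG hGF
  have e1 : (comul12 Δ₀ G * leg12 G) * (leg12 F * comul12 Δ₀ F) = 1 := by
    rw [mul_assoc, ← mul_assoc (leg12 G), j12.2, one_mul, i12.2]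
  have e2 : (leg23 F * comul23 Δ₀ F) * (comul23 Δ₀ G * leg23 G) = 1 := by
    rw [mul_assoc, ← mul_assoc (comul23 Δ₀ F), i23.1, one_mul, j23.1]
  rw [c] at e1
  exact left_inv_eq_right_inv e1 e2

/-- With `F⁻¹ = ∑ g ⊗ g'`, the element `u = m(id ⊗ S₀)(F)` has right inverse `∑ S₀(g) g'`: apply
`a ⊗ b ⊗ c ↦ a S₀(b) c` to `F₂₃⁻¹ F₁₂ = (id ⊗ Δ₀)(F) (Δ₀ ⊗ id)(F⁻¹)`. -/
theorem twistU_mul : twistU S₀ F * antipodeMul S₀ 1 G = 1 := by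
  have c : leg12 F * comul12 Δ₀ F = leg23 F * comul23 Δ₀ F := hF.cocycle
  have h : leg23 G * leg12 F = comul23 Δ₀ F * comul12 Δ₀ G := by
    have h1 := ((isAlgMap_comul12 Δ₀).map_mul_eq_one hFG hGF).1
    have h2 := ((isAlgMap_leg23 (K := K) (A := A)).map_mul_eq_one hFG hGF).2
    calc leg23 G * leg12 F = leg23 G * leg12 F * (comul12 Δ₀ F * comul12 Δ₀ G) := by
          rw [h1, mul_one]
      _ = leg23 G * (leg12 F * comul12 Δ₀ F) * comul12 Δ₀ G := by simp only [mul_assoc]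
      _ = _ := by rw [c, ← mul_assoc, h2, one_mul]
  rw [twistU_eq, ← mulAntipodeMul_leg hA, h, mulAntipodeMul_comul hA, hF.counit_right,
    counit_left_inverse hF hFG hGF, mul_one]

variable (hF1 : F - 1 ∈ filt (A ⊗[K] A) 1)
include hF1

omit hF hFG hGF in
theorem isUnit_twistU : IsUnit (twistU S₀ F) := by
  refine isUnit_of_sub_one_mem_filt K ?_
  have := (isCts_mulAntipode S₀ 1).map_filt hF1
  rwa [map_sub, mulAntipode_one hA, ← twistU_eq] at this

theorem antipodeMul_mul_twistU : antipodeMul S₀ 1 G * twistU S₀ F = 1 := by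
  obtain ⟨w, hw⟩ := isUnit_twistU hA hF1
  have h := twistU_mul hA hF hFG hGF
  rw [← hw] at h ⊢
  rw [← Units.inv_eq_of_mul_eq_one_right h, Units.inv_mul]

theorem inverse_twistU : Ring.inverse (twistU S₀ F) = antipodeMul S₀ 1 G := by
  have := Ring.inverse_unit (⟨twistU S₀ F, antipodeMul S₀ 1 G, twistU_mul hA hF hFG hGF,
    antipodeMul_mul_twistU hA hF hFG hGF hF1⟩ : (FPS A)ˣ)
  simpa using this

theorem twistAntipode_apply (x : FPS A) :
    twistAntipode S₀ F x = twistU S₀ F * (mapL S₀ x * antipodeMul S₀ 1 G) := by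
  rw [twistAntipode, inverse_twistU hA hF hFG hGF hF1]; rfl

theorem isAntiMap_twistAntipode : IsAntiMap (twistAntipode S₀ F) := by
  rw [twistAntipode, inverse_twistU hA hF hFG hGF hF1]
  have h : IsAntiMap (mapL S₀) :=
    ⟨isCts_mapL _, by rw [← const_one, mapL_const, hA.antipode_one],
      (isCts_mapL _).map_mul_rev_of_const fun a b => by
        rw [mapL_const, hA.antipode_mul, const_mul, mapL_const, mapL_const]⟩
  exact (isAlgMap_conj (twistU_mul hA hF hFG hGF)
    (antipodeMul_mul_twistU hA hF hFG hGF hF1)).comp_isAntiMap h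

theorem mulMap_tensMap_id_twistAntipode (y : FPS (A ⊗[K] A)) :
    mulMap (tensMap LinearMap.id (twistAntipode S₀ F) y) =
      mulAntipode S₀ (twistU S₀ F) y * antipodeMul S₀ 1 G := by
  refine (isCts_mulMap.comp (isCts_tensMap _ _)).ext_tmul
    ((isCts_mulRight _).comp (isCts_mulAntipode S₀ _)) (fun a b => ?_) y
  simp only [LinearMap.comp_apply, LinearMap.mulRight_apply, mulAntipode_const, tensMap_const,
    mulMap_tens, twistAntipode_apply hA hF hFG hGF hF1, mapL_const, LinearMap.id_apply, mul_assoc]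

theorem mulMap_tensMap_twistAntipode_id (y : FPS (A ⊗[K] A)) :
    mulMap (tensMap (twistAntipode S₀ F) LinearMap.id y) =
      twistU S₀ F * antipodeMul S₀ (antipodeMul S₀ 1 G) y := by
  refine (isCts_mulMap.comp (isCts_tensMap _ _)).ext_tmul
    ((isCts_mulLeft _).comp (isCts_antipodeMul S₀ _)) (fun a b => ?_) y
  simp only [LinearMap.comp_apply, LinearMap.mulLeft_apply, antipodeMul_const, tensMap_const,
    mulMap_tens, twistAntipode_apply hA hF hFG hGF hF1, mapL_const, LinearMap.id_apply, mul_assoc]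

/-- Drinfeld's twisting theorem: a twist of a cocommutative Hopf algebra gives a topological Hopf
algebra. -/
theorem isTopHopf_twist : IsTopHopf (twistComul Δ₀.toLinearMap F) (mapL ε₀.toLinearMap)
    (twistAntipode S₀ F) := by
  have hΔ := isAlgMap_twistComul Δ₀ hFG hGF
  have hε := isAlgMap_mapL ε₀
  have hS := isAntiMap_twistAntipode hA hF hFG hGF hF1
  have huv := twistU_mul hA hF hFG hGF
  have hu : mulAntipode S₀ 1 F = twistU S₀ F := (twistU_eq F).symm
  refine ⟨hΔ.map_base, hΔ.map_mul, fun c => ?_, hε.map_mul, hS.map_base_mul, fun x => ?_,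
    fun x => ?_, fun x => ?_, fun x => ?_, fun x => ?_⟩
  · rw [hε.map_base]
    change MvPowerSeries.map (RingHom.id K) c = c
    rw [MvPowerSeries.map_id]; rfl
  · have c : leg12 F * comul12 Δ₀ F = leg23 F * comul23 Δ₀ F := hF.cocycle
    have a12 := isAlgMap_comul12 Δ₀
    have a23 := isAlgMap_comul23 Δ₀
    have i12 := a12.map_mul_eq_one hFG hGF
    have i23 := a23.map_mul_eq_one hFG hGF
    have j12 := (isAlgMap_leg12 (K := K) (A := A)).map_mul_eq_one hFG hGF
    have j23 := (isAlgMap_leg23 (K := K) (A := A)).map_mul_eq_one hFG hGF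
    have c' := cocycle_inverse hF hFG hGF
    have co : comul12 Δ₀ (mapL Δ₀.toLinearMap x) = comul23 Δ₀ (mapL Δ₀.toLinearMap x) := by
      refine (a12.toIsCts.comp (isCts_mapL _)).ext (a23.toIsCts.comp (isCts_mapL _))
        (fun a => ?_) x
      have := hA.coassoc a
      simp only [LinearMap.comp_apply, comul12, comul23, mapL_const, regroup]
      exact congrArg const this.symm
    rw [tensMap_twistComul_id Δ₀ hFG hGF, regroup_tensMap_id_twistComul Δ₀ hFG hGF,
      twistComul_apply Δ₀ hFG hGF]
    simp only [a12.map_mul, a23.map_mul, mul_assoc]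
    rw [c', co, ← mul_assoc, ← mul_assoc (leg23 F), c]
  · have h : IsAlgMap (mapL ((TensorProduct.lid K A).toLinearMap ∘ₗ ε₀.toLinearMap.rTensor A)) :=
      isAlgMap_mapL ((Algebra.TensorProduct.lid K A).toAlgHom.comp
        (Algebra.TensorProduct.map ε₀ (AlgHom.id K A)))
    rw [← mapL_id, tensMap_mapL, mapL_comp_apply, twistComul_apply Δ₀ hFG hGF]
    change mapL ((TensorProduct.lid K A).toLinearMap ∘ₗ ε₀.toLinearMap.rTensor A) _ = x
    rw [h.map_mul, h.map_mul, hF.counit_left, counit_left_inverse hF hFG hGF, one_mul, mul_one]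
    exact (h.toIsCts.comp (isCts_mapL _)).ext isCts_id (fun a => by
      simp only [LinearMap.comp_apply, mapL_const]
      exact congrArg const (hA.counit_left a)) x
  · have h : IsAlgMap (mapL ((TensorProduct.rid K A).toLinearMap ∘ₗ ε₀.toLinearMap.lTensor A)) :=
      isAlgMap_mapL ((Algebra.TensorProduct.rid K K A).toAlgHom.comp
        (Algebra.TensorProduct.map (AlgHom.id K A) ε₀))
    rw [← mapL_id, tensMap_mapL, mapL_comp_apply, twistComul_apply Δ₀ hFG hGF]
    change mapL ((TensorProduct.rid K A).toLinearMap ∘ₗ ε₀.toLinearMap.lTensor A) _ = x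
    rw [h.map_mul, h.map_mul, hF.counit_right, counit_right_inverse hF hFG hGF, one_mul, mul_one]
    exact (h.toIsCts.comp (isCts_mapL _)).ext isCts_id (fun a => by
      simp only [LinearMap.comp_apply, mapL_const]
      exact congrArg const (hA.counit_right a)) x
  · rw [mulMap_tensMap_twistAntipode_id hA hF hFG hGF hF1, twistComul_apply Δ₀ hFG hGF,
      antipodeMul_mul hA, ← antipodeMul_mul hA 1, hGF, antipodeMul_one hA, antipodeMul_mul hA,
      antipodeMul_comul hA, antipodeMul_base, ← mul_assoc, ← (base_commute _ _).eq, mul_assoc, huv,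
      mul_one]
  · rw [mulMap_tensMap_id_twistAntipode hA hF hFG hGF hF1, twistComul_apply Δ₀ hFG hGF,
      mulAntipode_mul hA, mulAntipode_mul hA, ← hu, ← mulAntipode_mul hA 1 G, hGF,
      mulAntipode_one hA, mulAntipode_comul hA, mulAntipode_base, hu, mul_assoc, huv, mul_one]

end TwistTheory

end JordanianTwist

end

noncomputable section

namespace JordanianTwist

open MvPowerSeries (coeff monomial)

/-! #### Triangularity -/

section Triangular

variable {K : Type*} [Field K] {A : Type*} [Ring A] [Algebra K A]

variable (K A) in
/-- The cyclic permutation `a ⊗ b ⊗ c ↦ b ⊗ c ⊗ a`. -/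
def cyc : A ⊗[K] A ⊗[K] A ≃ₐ[K] A ⊗[K] A ⊗[K] A :=
  (Algebra.TensorProduct.assoc K K K A A A).trans (Algebra.TensorProduct.comm K A (A ⊗[K] A))

variable (K A) in
/-- The transposition `a ⊗ b ⊗ c ↦ a ⊗ c ⊗ b`. -/
def swap23 : A ⊗[K] A ⊗[K] A ≃ₐ[K] A ⊗[K] A ⊗[K] A :=
  (Algebra.TensorProduct.assoc K K K A A A).trans
    ((Algebra.TensorProduct.congr AlgEquiv.refl (Algebra.TensorProduct.comm K A A)).trans
      (Algebra.TensorProduct.assoc K K K A A A).symm)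

variable (K A) in
/-- The transposition `a ⊗ b ⊗ c ↦ b ⊗ a ⊗ c`. -/
def swap12 : A ⊗[K] A ⊗[K] A ≃ₐ[K] A ⊗[K] A ⊗[K] A :=
  Algebra.TensorProduct.congr (Algebra.TensorProduct.comm K A A) AlgEquiv.refl

@[simp] theorem cyc_tmul (a b c : A) : cyc K A (a ⊗ₜ b ⊗ₜ c) = b ⊗ₜ c ⊗ₜ a := rfl

@[simp] theorem swap23_tmul (a b c : A) : swap23 K A (a ⊗ₜ b ⊗ₜ c) = a ⊗ₜ c ⊗ₜ b := rfl

@[simp] theorem swap12_tmul (a b c : A) : swap12 K A (a ⊗ₜ b ⊗ₜ c) = b ⊗ₜ a ⊗ₜ c := rfl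

@[simp] theorem cyc_symm_tmul (a b c : A) : (cyc K A).symm (a ⊗ₜ b ⊗ₜ c) = c ⊗ₜ a ⊗ₜ b := rfl

variable {Δ₀ : A →ₐ[K] A ⊗[K] A} {ε₀ : A →ₐ[K] K} {S₀ : A →ₗ[K] A}

/-- An algebra automorphism applied to every coefficient. -/
def mapE (e : A ≃ₐ[K] A) : FPS A →ₗ[K] FPS A := mapL e.toAlgHom.toLinearMap

theorem isAlgMap_mapE (e : A ≃ₐ[K] A) : IsAlgMap (mapE e) := isAlgMap_mapL e.toAlgHom

theorem mapE_const (e : A ≃ₐ[K] A) (a : A) : mapE e (const a) = const (e a) := by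
  rw [mapE, mapL_const]; rfl

theorem leg12_const (a b : A) : leg12 (const (a ⊗ₜ[K] b)) = const (a ⊗ₜ[K] b ⊗ₜ[K] (1 : A)) := by
  rw [leg12, mapL_const]; rfl

theorem leg13_const (a b : A) : leg13 (const (a ⊗ₜ[K] b)) = const (a ⊗ₜ[K] (1 : A) ⊗ₜ[K] b) := by
  rw [leg13, mapL_const]; rfl

theorem leg23_const (a b : A) : leg23 (const (a ⊗ₜ[K] b)) = const ((1 : A) ⊗ₜ[K] a ⊗ₜ[K] b) := by
  rw [leg23, mapL_const]; rfl

theorem flip_const (a b : A) : flip (const (a ⊗ₜ[K] b)) = const (b ⊗ₜ[K] a) := by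
  rw [flip, mapL_const]; rfl

/-- Two continuous maps out of `(A ⊗ A)[[h,g]]` into `(A ⊗ A ⊗ A)[[h,g]]`, the first followed by a
permutation of the factors, agree if they agree on constant tensors. -/
theorem mapE_apply_eq {f g : FPS (A ⊗[K] A) →ₗ[K] FPS (A ⊗[K] A ⊗[K] A)}
    (e : A ⊗[K] A ⊗[K] A ≃ₐ[K] A ⊗[K] A ⊗[K] A) (hf : IsCts f) (hg : IsCts g)
    (h : ∀ a b, mapE e (f (const (a ⊗ₜ b))) = g (const (a ⊗ₜ b))) (P : FPS (A ⊗[K] A)) :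
    mapE e (f P) = g P :=
  ((isAlgMap_mapE e).toIsCts.comp hf).ext_tmul hg h P

theorem isCts_leg12 : IsCts (leg12 : FPS (A ⊗[K] A) →ₗ[K] FPS (A ⊗[K] A ⊗[K] A)) :=
  isAlgMap_leg12.toIsCts

theorem isCts_leg13 : IsCts (leg13 : FPS (A ⊗[K] A) →ₗ[K] FPS (A ⊗[K] A ⊗[K] A)) :=
  isAlgMap_leg13.toIsCts

theorem isCts_leg23 : IsCts (leg23 : FPS (A ⊗[K] A) →ₗ[K] FPS (A ⊗[K] A ⊗[K] A)) :=
  isAlgMap_leg23.toIsCts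

theorem isCts_flip : IsCts (flip : FPS (A ⊗[K] A) →ₗ[K] FPS (A ⊗[K] A)) :=
  isAlgMap_flip.toIsCts

theorem cyc_leg12 (P : FPS (A ⊗[K] A)) : mapE (cyc K A) (leg12 P) = leg13 (flip P) :=
  mapE_apply_eq _ isCts_leg12 ((isCts_leg13 (K := K) (A := A)).comp isCts_flip) (fun a b => by
    simp [leg12_const, leg13_const, flip_const, mapE_const]) P

theorem cyc_leg23 (P : FPS (A ⊗[K] A)) : mapE (cyc K A) (leg23 P) = leg12 P :=
  mapE_apply_eq _ isCts_leg23 isCts_leg12 (fun a b => by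
    simp [leg12_const, leg23_const, mapE_const]) P

theorem cyc_symm_leg12 (P : FPS (A ⊗[K] A)) : mapE (cyc K A).symm (leg12 P) = leg23 P :=
  mapE_apply_eq _ isCts_leg12 isCts_leg23 (fun a b => by
    simp [leg12_const, leg23_const, mapE_const]) P

theorem cyc_symm_leg23 (P : FPS (A ⊗[K] A)) :
    mapE (cyc K A).symm (leg23 P) = leg13 (flip P) :=
  mapE_apply_eq _ isCts_leg23 ((isCts_leg13 (K := K) (A := A)).comp isCts_flip) (fun a b => by
    simp [leg13_const, leg23_const, flip_const, mapE_const]) P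

theorem swap23_leg12 (P : FPS (A ⊗[K] A)) : mapE (swap23 K A) (leg12 P) = leg13 P :=
  mapE_apply_eq _ isCts_leg12 isCts_leg13 (fun a b => by
    simp [leg12_const, leg13_const, mapE_const]) P

theorem swap23_leg23 (P : FPS (A ⊗[K] A)) : mapE (swap23 K A) (leg23 P) = leg23 (flip P) :=
  mapE_apply_eq _ isCts_leg23 ((isCts_leg23 (K := K) (A := A)).comp isCts_flip) (fun a b => by
    simp [leg23_const, flip_const, mapE_const]) P

theorem swap12_leg12 (P : FPS (A ⊗[K] A)) : mapE (swap12 K A) (leg12 P) = leg12 (flip P) :=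
  mapE_apply_eq _ isCts_leg12 ((isCts_leg12 (K := K) (A := A)).comp isCts_flip) (fun a b => by
    simp [leg12_const, flip_const, mapE_const]) P

theorem swap12_leg23 (P : FPS (A ⊗[K] A)) : mapE (swap12 K A) (leg23 P) = leg13 P :=
  mapE_apply_eq _ isCts_leg23 isCts_leg13 (fun a b => by
    simp [leg13_const, leg23_const, mapE_const]) P

theorem cyc_comul23 (P : FPS (A ⊗[K] A)) :
    mapE (cyc K A) (comul23 Δ₀ P) = comul12 Δ₀ (flip P) :=
  mapE_apply_eq _ (isAlgMap_comul23 Δ₀).toIsCts ((isAlgMap_comul12 Δ₀).toIsCts.comp isCts_flip)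
    (fun a b => by
      rw [LinearMap.comp_apply, flip_const, comul12_const, comul23_const, mapE_const]
      congr 1
      induction Δ₀ b with
      | zero => simp
      | add s t hs ht => simp only [TensorProduct.tmul_add, TensorProduct.add_tmul, map_add, hs, ht]
      | tmul x y => simp) P

theorem cyc_symm_comul12 (P : FPS (A ⊗[K] A)) :
    mapE (cyc K A).symm (comul12 Δ₀ P) = comul23 Δ₀ (flip P) :=
  mapE_apply_eq _ (isAlgMap_comul12 Δ₀).toIsCts ((isAlgMap_comul23 Δ₀).toIsCts.comp isCts_flip)
    (fun a b => by
      rw [LinearMap.comp_apply, flip_const, comul12_const, comul23_const, mapE_const]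
      rfl) P

variable (hA : IsCocommHopf Δ₀ ε₀ S₀)
include hA

theorem swap23_comul23 (P : FPS (A ⊗[K] A)) :
    mapE (swap23 K A) (comul23 Δ₀ P) = comul23 Δ₀ P :=
  mapE_apply_eq _ (isAlgMap_comul23 Δ₀).toIsCts (isAlgMap_comul23 Δ₀).toIsCts
    (fun a b => by
      rw [comul23_const, mapE_const]
      congr 1
      conv_rhs => rw [← hA.cocomm b]
      induction Δ₀ b with
      | zero => simp
      | add s t hs ht => simp only [TensorProduct.tmul_add, map_add, hs, ht]
      | tmul x y => simp) P

theorem swap12_comul12 (P : FPS (A ⊗[K] A)) :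
    mapE (swap12 K A) (comul12 Δ₀ P) = comul12 Δ₀ P :=
  mapE_apply_eq _ (isAlgMap_comul12 Δ₀).toIsCts (isAlgMap_comul12 Δ₀).toIsCts
    (fun a b => by
      rw [comul12_const, mapE_const]
      congr 1
      conv_rhs => rw [← hA.cocomm a]
      induction Δ₀ a with
      | zero => simp
      | add s t hs ht => simp only [TensorProduct.add_tmul, map_add, hs, ht]
      | tmul x y => simp) P

theorem swap23_comul12 (P : FPS (A ⊗[K] A)) :
    mapE (swap23 K A) (comul12 Δ₀ P) = mapE (cyc K A) (comul12 Δ₀ P) :=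
  mapE_apply_eq _ (isAlgMap_comul12 Δ₀).toIsCts
    ((isAlgMap_mapE (cyc K A)).toIsCts.comp (isAlgMap_comul12 Δ₀).toIsCts)
    (fun a b => by
      rw [LinearMap.comp_apply, comul12_const, mapE_const, mapE_const]
      congr 1
      conv_lhs => rw [← hA.cocomm a]
      induction Δ₀ a with
      | zero => simp
      | add s t hs ht => simp only [TensorProduct.add_tmul, map_add, hs, ht]
      | tmul x y => simp) P

theorem swap12_comul23 (P : FPS (A ⊗[K] A)) :
    mapE (swap12 K A) (comul23 Δ₀ P) = mapE (cyc K A).symm (comul23 Δ₀ P) :=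
  mapE_apply_eq _ (isAlgMap_comul23 Δ₀).toIsCts
    ((isAlgMap_mapE (cyc K A).symm).toIsCts.comp (isAlgMap_comul23 Δ₀).toIsCts)
    (fun a b => by
      rw [LinearMap.comp_apply, comul23_const, mapE_const, mapE_const]
      congr 1
      conv_lhs => rw [← hA.cocomm b]
      induction Δ₀ b with
      | zero => simp
      | add s t hs ht => simp only [TensorProduct.tmul_add, map_add, hs, ht]
      | tmul x y => simp) P

variable {F G : FPS (A ⊗[K] A)} (hF : IsTwist Δ₀.toLinearMap ε₀.toLinearMap F)
  (hFG : F * G = 1) (hGF : G * F = 1)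
include hF hFG hGF

/-- The twist of a cocommutative Hopf algebra is triangular. The hexagon identities follow from
the cocycle equation with its tensor factors permuted: cyclically, and by a transposition that
fixes one side of it by cocommutativity. -/
theorem isTriangular_twist : IsTriangular (twistComul Δ₀.toLinearMap F) (twistR F) := by
  have c : leg12 F * comul12 Δ₀ F = leg23 F * comul23 Δ₀ F := hF.cocycle
  have a12 := isAlgMap_comul12 Δ₀
  have a23 := isAlgMap_comul23 Δ₀
  have i12 := a12.map_mul_eq_one hFG hGF
  have i23 := a23.map_mul_eq_one hFG hGF
  have j12 := (isAlgMap_leg12 (K := K) (A := A)).map_mul_eq_one hFG hGF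
  have j13 := (isAlgMap_leg13 (K := K) (A := A)).map_mul_eq_one hFG hGF
  have j23 := (isAlgMap_leg23 (K := K) (A := A)).map_mul_eq_one hFG hGF
  have jf := (isAlgMap_flip (K := K) (A := A)).map_mul_eq_one hFG hGF
  have l13 := isAlgMap_leg13 (K := K) (A := A)
  have l12 := isAlgMap_leg12 (K := K) (A := A)
  have l23 := isAlgMap_leg23 (K := K) (A := A)
  have hR : twistR F = flip F * G := by rw [twistR, inverse_eq hFG hGF]
  have c' := cocycle_inverse hF hFG hGF
  refine ⟨?_, fun x => ?_, ?_, ?_, ?_⟩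
  · rw [hR]
    exact IsUnit.mul ⟨⟨_, _, jf.1, jf.2⟩, rfl⟩ ⟨⟨_, _, hGF, hFG⟩, rfl⟩
  · have hco : flip (mapL Δ₀.toLinearMap x) = mapL Δ₀.toLinearMap x :=
      (isCts_flip.comp (isCts_mapL _)).ext (isCts_mapL _) (fun a => by
        simp only [LinearMap.comp_apply, mapL_const, flip]
        exact congrArg const (hA.cocomm a)) x
    rw [hR, twistComul_apply Δ₀ hFG hGF, isAlgMap_flip.map_mul, isAlgMap_flip.map_mul, hco]
    calc flip F * G * (F * (mapL Δ₀.toLinearMap x * G))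
        = flip F * (G * F) * (mapL Δ₀.toLinearMap x * G) := by simp only [mul_assoc]
      _ = flip F * mapL Δ₀.toLinearMap x * (flip G * flip F) * G := by
          rw [hGF, jf.2]; simp only [mul_assoc, mul_one]
      _ = _ := by simp only [mul_assoc]
  · -- `W` is `(Δ₀ ⊗ id)(F)` with its factors permuted cyclically
    set W := mapE (cyc K A) (comul12 Δ₀ F) with hW
    have e1 : leg13 (flip F) * W = leg12 F * comul12 Δ₀ (flip F) := by
      have := congrArg (mapE (cyc K A)) c
      rwa [(isAlgMap_mapE _).map_mul, (isAlgMap_mapE _).map_mul, cyc_leg12, cyc_leg23,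
        cyc_comul23] at this
    have e2 : leg13 F * W = leg23 (flip F) * comul23 Δ₀ F := by
      have := congrArg (mapE (swap23 K A)) c
      rwa [(isAlgMap_mapE _).map_mul, (isAlgMap_mapE _).map_mul, swap23_leg12, swap23_leg23,
        swap23_comul23 hA, swap23_comul12 hA] at this
    have e3 : W = leg13 G * (leg23 (flip F) * comul23 Δ₀ F) := by
      rw [← e2, ← mul_assoc, j13.2, one_mul]
    rw [tensMap_twistComul_id Δ₀ hFG hGF, hR, a12.map_mul, l13.map_mul, l23.map_mul, mul_assoc,
      c', ← mul_assoc, ← e1, e3]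
    calc leg13 (flip F) * (leg13 G * (leg23 (flip F) * comul23 Δ₀ F)) *
          (comul23 Δ₀ G * leg23 G)
        = leg13 (flip F) * leg13 G * leg23 (flip F) * (comul23 Δ₀ F * comul23 Δ₀ G) *
          leg23 G := by simp only [mul_assoc]
      _ = _ := by rw [i23.1]; simp only [mul_assoc, one_mul]
  · -- `V` is `(id ⊗ Δ₀)(F)` with its factors permuted cyclically
    set V := mapE (cyc K A).symm (comul23 Δ₀ F) with hV
    have e1 : leg23 F * comul23 Δ₀ (flip F) = leg13 (flip F) * V := by
      have := congrArg (mapE (cyc K A).symm) c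
      rwa [(isAlgMap_mapE _).map_mul, (isAlgMap_mapE _).map_mul, cyc_symm_leg12, cyc_symm_leg23,
        cyc_symm_comul12] at this
    have e2 : leg12 (flip F) * comul12 Δ₀ F = leg13 F * V := by
      have := congrArg (mapE (swap12 K A)) c
      rwa [(isAlgMap_mapE _).map_mul, (isAlgMap_mapE _).map_mul, swap12_leg12, swap12_leg23,
        swap12_comul12 hA, swap12_comul23 hA] at this
    have e3 : V = leg13 G * (leg12 (flip F) * comul12 Δ₀ F) := by
      rw [e2, ← mul_assoc, j13.2, one_mul]
    rw [regroup_tensMap_id_twistComul Δ₀ hFG hGF, hR, a23.map_mul, l13.map_mul, l12.map_mul,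
      mul_assoc, ← c', ← mul_assoc, e1, e3]
    calc leg13 (flip F) * (leg13 G * (leg12 (flip F) * comul12 Δ₀ F)) *
          (comul12 Δ₀ G * leg12 G)
        = leg13 (flip F) * leg13 G * leg12 (flip F) * (comul12 Δ₀ F * comul12 Δ₀ G) *
          leg12 G := by simp only [mul_assoc]
      _ = _ := by rw [i12.1]; simp only [mul_assoc, one_mul]
  · rw [hR, isAlgMap_flip.map_mul, flip_flip, mul_assoc, ← mul_assoc (flip G), jf.2, one_mul, hFG]

end Triangular

end JordanianTwist

end

noncomputable section

namespace JordanianTwist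

/-! ### The Hopf algebra `U(gl(2))` -/

section Enveloping

variable (K : Type*) [Field K]

theorem comul₀_inc (x : Matrix (Fin 2) (Fin 2) K) :
    comul₀ K (inc K x) = inc K x ⊗ₜ 1 + 1 ⊗ₜ inc K x := by
  rw [comul₀, UniversalEnvelopingAlgebra.lift_ι_apply]; rfl

theorem counit₀_inc (x : Matrix (Fin 2) (Fin 2) K) : counit₀ K (inc K x) = 0 := by
  rw [counit₀, UniversalEnvelopingAlgebra.lift_ι_apply]; rfl

theorem antipode₀_inc (x : Matrix (Fin 2) (Fin 2) K) : antipode₀ K (inc K x) = -inc K x := by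
  rw [antipode₀, LinearMap.comp_apply, AlgHom.toLinearMap_apply, antipodeOp₀,
    UniversalEnvelopingAlgebra.lift_ι_apply]
  rfl

theorem antipode₀_one : antipode₀ K 1 = 1 := by
  rw [antipode₀, LinearMap.comp_apply, AlgHom.toLinearMap_apply, map_one]; rfl

theorem antipode₀_mul (x y : U K) : antipode₀ K (x * y) = antipode₀ K y * antipode₀ K x := by
  rw [antipode₀, LinearMap.comp_apply, AlgHom.toLinearMap_apply, map_mul]; rfl

variable {K}

theorem U_algHom_ext {B : Type*} [Ring B] [Algebra K B] {f g : U K →ₐ[K] B}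
    (h : ∀ x, f (inc K x) = g (inc K x)) : f = g := by
  apply UniversalEnvelopingAlgebra.hom_ext
  ext1 x
  exact h x

/-- `U(gl(2))` is generated by `gl(2)`. -/
theorem mem_of_inc_mem (s : Subalgebra K (U K)) (h : ∀ x, inc K x ∈ s) (y : U K) : y ∈ s := by
  let φ : Matrix (Fin 2) (Fin 2) K →ₗ⁅K⁆ s :=
    { toFun := fun x => ⟨inc K x, h x⟩
      map_add' := fun x y => Subtype.ext (by simp)
      map_smul' := fun c x => Subtype.ext (by simp)
      map_lie' := fun {x y} => Subtype.ext (by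
        change inc K ⁅x, y⁆ = _
        rw [LieHom.map_lie, LieRing.of_associative_ring_bracket,
          LieRing.of_associative_ring_bracket]; rfl) }
  have h1 : s.val.comp (UniversalEnvelopingAlgebra.lift K φ) = AlgHom.id K (U K) :=
    U_algHom_ext fun x => by
      rw [AlgHom.comp_apply, UniversalEnvelopingAlgebra.lift_ι_apply]; rfl
  rw [← AlgHom.id_apply (R := K) y, ← h1]
  exact (UniversalEnvelopingAlgebra.lift K φ y).2

theorem U_induction {p : U K → Prop} (halg : ∀ c, p (algebraMap K (U K) c))
    (hinc : ∀ x, p (inc K x)) (hadd : ∀ x y, p x → p y → p (x + y))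
    (hmul : ∀ x y, p x → p y → p (x * y)) (y : U K) : p y :=
  mem_of_inc_mem
    { carrier := {y | p y}
      mul_mem' := fun {x y} hx hy => hmul x y hx hy
      add_mem' := fun {x y} hx hy => hadd x y hx hy
      algebraMap_mem' := halg } hinc y

theorem mul_antipode₀_rTensor_mul (s t : U K ⊗[K] U K) {c : K}
    (ht : LinearMap.mul' K (U K) ((antipode₀ K).rTensor (U K) t) = algebraMap K (U K) c) :
    LinearMap.mul' K (U K) ((antipode₀ K).rTensor (U K) (t * s)) =
      c • LinearMap.mul' K (U K) ((antipode₀ K).rTensor (U K) s) := by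
  have h (x y : U K) (t : U K ⊗[K] U K) :
      LinearMap.mul' K (U K) ((antipode₀ K).rTensor (U K) (t * x ⊗ₜ y)) =
      antipode₀ K x * LinearMap.mul' K (U K) ((antipode₀ K).rTensor (U K) t) * y := by
    induction t with
    | zero => simp
    | add t t' h h' => simp only [add_mul, map_add, mul_add, h, h']
    | tmul z w => simp [antipode₀_mul, mul_assoc]
  induction s with
  | zero => simp
  | add s s' h h' => simp only [mul_add, map_add, smul_add, h, h']
  | tmul x y => rw [h, ht]; simp [Algebra.algebraMap_eq_smul_one]

theorem mul_antipode₀_lTensor_mul (s t : U K ⊗[K] U K) {c : K}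
    (hs : LinearMap.mul' K (U K) ((antipode₀ K).lTensor (U K) s) = algebraMap K (U K) c) :
    LinearMap.mul' K (U K) ((antipode₀ K).lTensor (U K) (t * s)) =
      c • LinearMap.mul' K (U K) ((antipode₀ K).lTensor (U K) t) := by
  have h (x y : U K) (s : U K ⊗[K] U K) :
      LinearMap.mul' K (U K) ((antipode₀ K).lTensor (U K) (x ⊗ₜ y * s)) =
      x * LinearMap.mul' K (U K) ((antipode₀ K).lTensor (U K) s) * antipode₀ K y := by
    induction s with
    | zero => simp
    | add t t' h h' => simp only [add_mul, map_add, mul_add, h, h']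
    | tmul z w => simp [antipode₀_mul, mul_assoc]
  induction t with
  | zero => simp
  | add s s' h h' => simp only [add_mul, map_add, smul_add, h, h']
  | tmul x y => rw [h, hs]; simp [Algebra.algebraMap_eq_smul_one]

variable (K)

/-- `U(gl(2))` with its standard structure is a cocommutative Hopf algebra. -/
theorem isCocommHopf_U : IsCocommHopf (comul₀ K) (counit₀ K) (antipode₀ K) where
  coassoc a := by
    have : ((Algebra.TensorProduct.assoc K K K (U K) (U K) (U K)).symm.toAlgHom.comp
        (Algebra.TensorProduct.map (AlgHom.id K (U K)) (comul₀ K))).comp (comul₀ K) =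
        (Algebra.TensorProduct.map (comul₀ K) (AlgHom.id K (U K))).comp (comul₀ K) :=
      U_algHom_ext fun x => by
        simp [-UniversalEnvelopingAlgebra.ι_apply, comul₀_inc, TensorProduct.tmul_add,
          TensorProduct.add_tmul,
          Algebra.TensorProduct.one_def, add_assoc]
    exact AlgHom.congr_fun this a
  counit_left a := by
    have : ((Algebra.TensorProduct.lid K (U K)).toAlgHom.comp
        (Algebra.TensorProduct.map (counit₀ K) (AlgHom.id K (U K)))).comp (comul₀ K) =
        AlgHom.id K (U K) :=
      U_algHom_ext fun x => by simp [-UniversalEnvelopingAlgebra.ι_apply, comul₀_inc, counit₀_inc]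
    exact AlgHom.congr_fun this a
  counit_right a := by
    have : ((Algebra.TensorProduct.rid K K (U K)).toAlgHom.comp
        (Algebra.TensorProduct.map (AlgHom.id K (U K)) (counit₀ K))).comp (comul₀ K) =
        AlgHom.id K (U K) :=
      U_algHom_ext fun x => by simp [-UniversalEnvelopingAlgebra.ι_apply, comul₀_inc, counit₀_inc]
    exact AlgHom.congr_fun this a
  cocomm a := by
    have : (Algebra.TensorProduct.comm K (U K) (U K)).toAlgHom.comp (comul₀ K) = comul₀ K :=
      U_algHom_ext fun x => by simp [-UniversalEnvelopingAlgebra.ι_apply, comul₀_inc, add_comm]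
    exact AlgHom.congr_fun this a
  antipode_one := antipode₀_one K
  antipode_mul := antipode₀_mul K
  antipode_left a := by
    induction a using U_induction with
    | halg c => simp [Algebra.algebraMap_eq_smul_one,
        Algebra.TensorProduct.one_def, antipode₀_one]
    | hinc x =>
      simp [-UniversalEnvelopingAlgebra.ι_apply, comul₀_inc, counit₀_inc, antipode₀_inc,
        antipode₀_one]
    | hadd x y hx hy => simp only [map_add, hx, hy]
    | hmul x y hx hy =>
      rw [map_mul, mul_antipode₀_rTensor_mul _ _ hx, hy, map_mul, map_mul, Algebra.smul_def]
  antipode_right a := by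
    induction a using U_induction with
    | halg c => simp [Algebra.algebraMap_eq_smul_one,
        Algebra.TensorProduct.one_def, antipode₀_one]
    | hinc x =>
      simp [-UniversalEnvelopingAlgebra.ι_apply, comul₀_inc, counit₀_inc, antipode₀_inc,
        antipode₀_one]
    | hadd x y hx hy => simp only [map_add, hx, hy]
    | hmul x y hx hy =>
      rw [map_mul, mul_antipode₀_lTensor_mul _ _ hy, hx, map_mul, map_mul, Algebra.smul_def,
        Algebra.commutes]

end Enveloping

end JordanianTwist

end

noncomputable section

namespace JordanianTwist

/-! ### The series `σ` and its commutators -/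

section Sigma

variable {A : Type*} [Ring A]

theorem parH_cancel {x y : FPS A} (h : parH * x = parH * y) : x = y := by
  rw [← divH_parH_mul x, h, divH_parH_mul]

theorem mul_parH (x : FPS A) : x * parH = parH * x := (X_commute 0 x).eq.symm

theorem mul_parG (x : FPS A) : x * parG = parG * x := (X_commute 1 x).eq.symm

theorem mul_parH_mul (x y : FPS A) : x * (parH * y) = parH * (x * y) := by
  rw [← mul_assoc, mul_parH, mul_assoc]

theorem mul_parG_mul (x y : FPS A) : x * (parG * y) = parG * (x * y) := by
  rw [← mul_assoc, mul_parG, mul_assoc]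

theorem parH_mem_filt_mul (x : FPS A) : parH * x ∈ filt A 1 := mul_mem_filt_left parH_mem_filt x

theorem parG_mem_filt_mul (x : FPS A) : parG * x ∈ filt A 1 := mul_mem_filt_left parG_mem_filt x

/-- A series without constant term, evaluated at a multiple of `h`, is a multiple of `h`. -/
theorem parH_mul_divH_evalSeries {K : Type*} [Field K] [Algebra K A] {f : PowerSeries K}
    (hf : PowerSeries.constantCoeff f = 0) (y : FPS A) :
    parH * divH (evalSeries f (parH * y)) = evalSeries f (parH * y) := by
  obtain ⟨r, -, hr⟩ := evalSeries_eq_mul hf (parH_mem_filt_mul y)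
  rw [hr, mul_assoc, divH_parH_mul]

variable (K : Type*) [Field K]

theorem const_inc_comm (x y : Matrix (Fin 2) (Fin 2) K) :
    const (inc K x) * const (inc K y) =
      const (inc K y) * const (inc K x) + const (inc K ⁅x, y⁆) := by
  rw [LieHom.map_lie, LieRing.of_associative_ring_bracket, ← const_mul, ← const_mul,
    const_eq_constL (K := K), const_eq_constL (K := K), const_eq_constL (K := K), map_sub]
  abel

theorem const_inc_add (x y : Matrix (Fin 2) (Fin 2) K) :
    const (inc K (x + y)) = const (inc K x) + const (inc K y) := by
  rw [map_add, const_eq_constL (K := K), map_add]; rfl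

theorem const_inc_neg (x : Matrix (Fin 2) (Fin 2) K) :
    const (inc K (-x)) = -const (inc K x) := by
  rw [map_neg, const_eq_constL (K := K), map_neg]; rfl

theorem H_mul_Xp : H K * Xp K = Xp K * H K + 2 * Xp K := by
  rw [H, Xp, const_inc_comm, two_mul, ← const_inc_add]
  congr 4
  rw [LieRing.of_associative_ring_bracket]
  ext i j; fin_cases i <;> fin_cases j <;> simp

theorem H_mul_Xm : H K * Xm K = Xm K * H K - 2 * Xm K := by
  rw [H, Xm, const_inc_comm, two_mul, ← const_inc_add, sub_eq_add_neg, ← const_inc_neg]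
  congr 4
  rw [LieRing.of_associative_ring_bracket]
  ext i j; fin_cases i <;> fin_cases j <;> simp
  ring

theorem Xp_mul_Xm : Xp K * Xm K = Xm K * Xp K + H K := by
  rw [H, Xm, Xp, const_inc_comm]
  congr 4
  rw [LieRing.of_associative_ring_bracket]
  ext i j; fin_cases i <;> fin_cases j <;> simp

theorem Z_commute (x : FPS (U K)) : Commute (Z K) x := by
  have h : ∀ a : U K, inc K !![1, 0; 0, 1] * a = a * inc K !![1, 0; 0, 1] := fun a => by
    refine (Subalgebra.mem_centralizer_iff K).1 (mem_of_inc_mem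
      (Subalgebra.centralizer K {inc K !![1, 0; 0, 1]}) (fun x => ?_) a) _ rfl
    rw [Subalgebra.mem_centralizer_iff]
    rintro _ rfl
    have h1 : ⁅(!![1, 0; 0, 1] : Matrix (Fin 2) (Fin 2) K), x⁆ = 0 := by
      rw [LieRing.of_associative_ring_bracket, ← Matrix.one_fin_two, one_mul, mul_one, sub_self]
    have h2 := (inc K).map_lie !![1, 0; 0, 1] x
    rw [h1, map_zero, LieRing.of_associative_ring_bracket] at h2
    exact (sub_eq_zero.1 h2.symm)
  exact (isCts_mulLeft (K := K) (Z K)).ext (isCts_mulRight (Z K)) (fun a => by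
    simp only [LinearMap.mulLeft_apply, LinearMap.mulRight_apply, Z, ← const_mul, h]) x

/-- The argument `2 h X₊` of the logarithm. -/
theorem two_parH_Xp_mem_filt : 2 * parH * Xp K ∈ filt (U K) 1 :=
  mul_mem_filt_left (mul_mem_filt_right 2 parH_mem_filt) _

theorem σ_eq : σ K = evalSeries (logSeries K) (2 * parH * Xp K) := rfl

theorem σ_mem_filt : σ K ∈ filt (U K) 1 :=
  evalSeries_mem_filt_one (constantCoeff_logSeries K) (two_parH_Xp_mem_filt K)

/-- The quotient `σ / h`. -/
def sdiv : FPS (U K) := divH (σ K)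

theorem parH_mul_sdiv : parH * sdiv K = σ K := by
  have h : 2 * parH * Xp K = parH * (2 * Xp K) := by
    rw [mul_parH, mul_assoc]
  rw [sdiv, σ_eq, h, parH_mul_divH_evalSeries (constantCoeff_logSeries K)]

theorem ε_Z : ε K (Z K) = 0 := by
  rw [ε, Z, mapL_const, AlgHom.toLinearMap_apply, counit₀_inc]; simp [const]

theorem ε_H : ε K (H K) = 0 := by
  rw [ε, H, mapL_const, AlgHom.toLinearMap_apply, counit₀_inc]; simp [const]

theorem ε_Xp : ε K (Xp K) = 0 := by
  rw [ε, Xp, mapL_const, AlgHom.toLinearMap_apply, counit₀_inc]; simp [const]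

theorem ε_Xm : ε K (Xm K) = 0 := by
  rw [ε, Xm, mapL_const, AlgHom.toLinearMap_apply, counit₀_inc]; simp [const]

theorem isAlgMap_ε : IsAlgMap (ε K) := isAlgMap_mapL _

theorem evalSeries_zero_arg {f : PowerSeries K} (hf : PowerSeries.constantCoeff f = 0)
    {A : Type*} [Ring A] [Algebra K A] : evalSeries f (0 : FPS A) = 0 := by
  obtain ⟨r, -, hr⟩ := evalSeries_eq_mul hf (x := (0 : FPS A)) (zero_mem _)
  rw [hr, zero_mul]

theorem ε_σ : ε K (σ K) = 0 := by
  rw [σ_eq, (isAlgMap_ε K).map_evalSeries _ (two_parH_Xp_mem_filt K), (isAlgMap_ε K).map_mul,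
    ε_Xp, mul_zero, evalSeries_zero_arg K (constantCoeff_logSeries K)]

theorem ε_sdiv : ε K (sdiv K) = 0 := by
  apply parH_cancel
  rw [← (isAlgMap_ε K).map_parH, parH_mul_sdiv, ε_σ, mul_zero]

theorem two_parH_Xp_mul_H :
    (2 * parH * Xp K) * H K = H K * (2 * parH * Xp K) + -(2 * (2 * parH * Xp K)) := by
  have e : Xp K * H K = H K * Xp K - 2 * Xp K := by rw [H_mul_Xp]; abel
  simp only [two_mul, mul_add, add_mul, mul_assoc, mul_parH_mul, e, mul_sub]
  abel

variable [CharZero K]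

theorem eσm_eq : eσm K = 1 - 2 * parH * Xp K := fexp_neg_negLogOneSub (two_parH_Xp_mem_filt K)

theorem eσ_mul_eσm : eσ K * eσm K = 1 := fexp_mul_fexp_neg (σ_mem_filt K)

theorem eσm_mul_eσ : eσm K * eσ K = 1 := fexp_neg_mul_fexp (σ_mem_filt K)

theorem eσ_eq : eσ K = evalSeries (PowerSeries.mk 1 : PowerSeries K) (2 * parH * Xp K) := by
  have h := evalSeries_mul (1 - PowerSeries.X : PowerSeries K) (PowerSeries.mk 1)
    (two_parH_Xp_mem_filt K)
  rw [one_sub_X_mul_mk_one, evalSeries_sub, evalSeries_one (two_parH_Xp_mem_filt K),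
    evalSeries_X (two_parH_Xp_mem_filt K), ← eσm_eq] at h
  exact left_inv_eq_right_inv (eσ_mul_eσm K) h.symm

theorem two_parH_Xp_mul_eσ : 2 * parH * Xp K * eσ K = eσ K - 1 := by
  have h := eσm_mul_eσ K
  rw [eσm_eq, sub_mul, one_mul] at h
  rw [← h]; abel

/-- `[σ, H] = -2 (e^σ - 1)`. -/
theorem σ_mul_H : σ K * H K = H K * σ K - 2 * (eσ K - 1) := by
  have h := evalSeries_mul_of_commutators (logSeries K) (two_parH_Xp_mem_filt K)
    (two_parH_Xp_mul_H K) (w := 0) (by rw [add_zero]; noncomm_ring) (by simp)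
  have e : 2 * (2 * parH * Xp K) * eσ K = 2 * (eσ K - 1) := by
    rw [mul_assoc, two_parH_Xp_mul_eσ]
  rw [← σ_eq, derivative_logSeries, ← eσ_eq, neg_mul, e, zero_mul, smul_zero, add_zero] at h
  rw [h, ← sub_eq_add_neg]

/-- `[σ, X₋] = 2 h (H e^σ - (e^σ - 1) e^σ)`. -/
theorem σ_mul_Xm :
    σ K * Xm K = Xm K * σ K + 2 * parH * (H K * eσ K - (eσ K - 1) * eσ K) := by
  have h := evalSeries_mul_of_commutators (logSeries K) (two_parH_Xp_mem_filt K)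
    (y := Xm K) (z := 2 * parH * H K) (w := -(2 * (2 * parH * (2 * parH * Xp K))))
    (by
      simp only [two_mul, mul_add, add_mul, mul_assoc, mul_parH_mul, Xp_mul_Xm]
      abel)
    (by
      have e : Xp K * H K = H K * Xp K - 2 * Xp K := by rw [H_mul_Xp]; abel
      simp only [two_mul, mul_add, add_mul, mul_assoc, mul_parH_mul, e, mul_sub]
      abel)
    (by
      simp only [two_mul, mul_add, add_mul, mul_assoc, mul_parH_mul, mul_neg, neg_mul]
      abel)
  have e : (2 * (2 * parH * (2 * parH * Xp K))) * (eσ K * eσ K) =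
      2 * (2 * parH * ((eσ K - 1) * eσ K)) := by
    rw [← two_parH_Xp_mul_eσ]; simp only [mul_assoc]
  rw [← σ_eq, derivative_derivative_logSeries, evalSeries_pow _ (two_parH_Xp_mem_filt K),
    derivative_logSeries, ← eσ_eq, sq, neg_mul, e, two_mul (2 * parH * _), ← two_smul K,
    smul_neg, smul_smul, one_div, inv_mul_cancel₀ two_ne_zero, one_smul] at h
  rw [h]
  noncomm_ring

end Sigma

end JordanianTwist

end

noncomputable section

namespace JordanianTwist

/-! ### The twist element -/

section Twist

variable (K : Type*) [Field K]

theorem isAlgMap_comul₀ : IsAlgMap (mapL (comul₀ K).toLinearMap) := isAlgMap_mapL _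

theorem comul₀_const_inc (x : Matrix (Fin 2) (Fin 2) K) :
    mapL (comul₀ K).toLinearMap (const (inc K x)) =
      const (inc K x) ⊠[K] 1 + 1 ⊠[K] const (inc K x) := by
  rw [mapL_const, AlgHom.toLinearMap_apply, comul₀_inc, ← const_one, const_tens_const,
    const_tens_const, const_eq_constL (K := K), map_add]
  rfl

theorem comul₀_Z : mapL (comul₀ K).toLinearMap (Z K) = Z K ⊠[K] 1 + 1 ⊠[K] Z K :=
  comul₀_const_inc K _

theorem comul₀_H : mapL (comul₀ K).toLinearMap (H K) = H K ⊠[K] 1 + 1 ⊠[K] H K :=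
  comul₀_const_inc K _

theorem comul₀_Xp : mapL (comul₀ K).toLinearMap (Xp K) = Xp K ⊠[K] 1 + 1 ⊠[K] Xp K :=
  comul₀_const_inc K _

theorem comul₀_Xm : mapL (comul₀ K).toLinearMap (Xm K) = Xm K ⊠[K] 1 + 1 ⊠[K] Xm K :=
  comul₀_const_inc K _

variable [CharZero K]

/-- The Jordanian factor `exp (-(1/2) H ⊗ σ)` of the twist. -/
def jordanFactor : FPS (U K ⊗[K] U K) := fexp K (-((1 / 2 : K) • (H K ⊠[K] σ K)))

/-- The abelian factor `exp ((g / 2h) σ ⊗ Z)` of the twist. -/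
def abelianFactor : FPS (U K ⊗[K] U K) := fexp K ((1 / 2 : K) • (parG * (sdiv K ⊠[K] Z K)))

theorem F_eq : F K = abelianFactor K * jordanFactor K := rfl

omit [CharZero K] in
theorem jordanExponent_mem_filt : -((1 / 2 : K) • (H K ⊠[K] σ K)) ∈ filt (U K ⊗[K] U K) 1 :=
  neg_mem (smul_mem_filt _ (tens_mem_filt_right _ (σ_mem_filt K)))

omit [CharZero K] in
theorem abelianExponent_mem_filt :
    (1 / 2 : K) • (parG * (sdiv K ⊠[K] Z K)) ∈ filt (U K ⊗[K] U K) 1 :=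
  smul_mem_filt _ (parG_mem_filt_mul _)

/-- The inverse of the twist element. -/
def twistInv : FPS (U K ⊗[K] U K) :=
  fexp K ((1 / 2 : K) • (H K ⊠[K] σ K)) *
    fexp K (-((1 / 2 : K) • (parG * (divH (σ K) ⊠[K] Z K))))

theorem jordanFactor_mul_neg :
    jordanFactor K * fexp K ((1 / 2 : K) • (H K ⊠[K] σ K)) = 1 := by
  have := fexp_mul_fexp_neg (K := K) (jordanExponent_mem_filt K)
  rwa [neg_neg] at this

theorem neg_mul_jordanFactor :
    fexp K ((1 / 2 : K) • (H K ⊠[K] σ K)) * jordanFactor K = 1 := by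
  have := fexp_neg_mul_fexp (K := K) (jordanExponent_mem_filt K)
  rwa [neg_neg] at this

theorem F_mul_twistInv : F K * twistInv K = 1 := by
  have h2 := fexp_mul_fexp_neg (K := K) (abelianExponent_mem_filt K)
  rw [F_eq, twistInv, mul_assoc, ← mul_assoc (jordanFactor K), jordanFactor_mul_neg, one_mul]
  exact h2

theorem twistInv_mul_F : twistInv K * F K = 1 := by
  have h2 := fexp_neg_mul_fexp (K := K) (abelianExponent_mem_filt K)
  rw [F_eq, twistInv, mul_assoc, ← mul_assoc _ (abelianFactor K)]
  change _ * (fexp K (-((1 / 2 : K) • (parG * (sdiv K ⊠[K] Z K)))) *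
    fexp K ((1 / 2 : K) • (parG * (sdiv K ⊠[K] Z K))) * _) = 1
  rw [h2, one_mul, neg_mul_jordanFactor]

theorem F_sub_one_mem_filt : F K - 1 ∈ filt (U K ⊗[K] U K) 1 := by
  have h1 := fexp_sub_one_mem_filt (K := K) (jordanExponent_mem_filt K)
  have h2 := fexp_sub_one_mem_filt (K := K) (abelianExponent_mem_filt K)
  have : F K - 1 = (abelianFactor K - 1) * jordanFactor K + (jordanFactor K - 1) := by
    rw [F_eq]; noncomm_ring
  rw [this]
  exact add_mem (mul_mem_filt_left h2 _) h1

/-! #### Conjugation by the Jordanian factor -/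

theorem jordanFactor_mul_Xp_left :
    jordanFactor K * (Xp K ⊠[K] 1) = (Xp K ⊠[K] eσm K) * jordanFactor K := by
  have h1 : -((1 / 2 : K) • (H K ⊠[K] σ K)) * (Xp K ⊠[K] 1) = (Xp K ⊠[K] 1) *
      (1 ⊠[K] (-σ K) + -((1 / 2 : K) • (H K ⊠[K] σ K))) := by
    simp only [mul_add, tens_mul_tens, neg_mul, smul_mul_assoc, mul_neg, mul_smul_comm, H_mul_Xp,
      mul_one, one_mul, tens_neg, add_tens, two_mul]
    module
  have h2 : (1 : FPS (U K)) ⊠[K] (-σ K) ∈ filt (U K ⊗[K] U K) 1 :=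
    tens_mem_filt_right _ (neg_mem (σ_mem_filt K))
  have h3 : fexp K ((1 : FPS (U K)) ⊠[K] (-σ K)) = 1 ⊠[K] eσm K := by
    rw [← right_eq, ← isAlgMap_right.map_fexp (neg_mem (σ_mem_filt K)), right_eq]; rfl
  have h4 := evalSeries_semiconj (PowerSeries.exp K) (jordanExponent_mem_filt K)
    (add_mem h2 (jordanExponent_mem_filt K)) h1
  have h5 : Commute ((1 : FPS (U K)) ⊠[K] (-σ K)) (-((1 / 2 : K) • (H K ⊠[K] σ K))) := by
    refine Commute.neg_right (Commute.smul_right ?_ _)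
    rw [Commute, SemiconjBy, tens_mul_tens, tens_mul_tens, mul_neg, neg_mul, one_mul, mul_one]
  have h6 := fexp_add (K := K) h2 (jordanExponent_mem_filt K) h5
  rw [jordanFactor]
  refine h4.trans ?_
  change (Xp K ⊠[K] 1) * fexp K _ = _
  rw [h6, h3, ← mul_assoc, tens_mul_tens, mul_one, one_mul]

theorem jordanFactor_mul_Xm_left :
    jordanFactor K * (Xm K ⊠[K] 1) = (Xm K ⊠[K] eσ K) * jordanFactor K := by
  have h1 : -((1 / 2 : K) • (H K ⊠[K] σ K)) * (Xm K ⊠[K] 1) = (Xm K ⊠[K] 1) *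
      (1 ⊠[K] σ K + -((1 / 2 : K) • (H K ⊠[K] σ K))) := by
    rw [mul_add, tens_mul_tens, neg_mul, smul_mul_assoc, tens_mul_tens, mul_neg, mul_smul_comm,
      tens_mul_tens, H_mul_Xm, mul_one, one_mul, mul_one, sub_tens, two_mul, add_tens]
    module
  have h2 : (1 : FPS (U K)) ⊠[K] σ K ∈ filt (U K ⊗[K] U K) 1 :=
    tens_mem_filt_right _ (σ_mem_filt K)
  have h3 : fexp K ((1 : FPS (U K)) ⊠[K] σ K) = 1 ⊠[K] eσ K := by
    rw [← right_eq, ← isAlgMap_right.map_fexp (σ_mem_filt K), right_eq]; rfl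
  have h4 := evalSeries_semiconj (PowerSeries.exp K) (jordanExponent_mem_filt K)
    (add_mem h2 (jordanExponent_mem_filt K)) h1
  have h5 : Commute ((1 : FPS (U K)) ⊠[K] σ K) (-((1 / 2 : K) • (H K ⊠[K] σ K))) := by
    refine Commute.neg_right (Commute.smul_right ?_ _)
    rw [Commute, SemiconjBy, tens_mul_tens, tens_mul_tens, one_mul, mul_one]
  have h6 := fexp_add (K := K) h2 (jordanExponent_mem_filt K) h5
  rw [jordanFactor]
  refine h4.trans ?_
  change (Xm K ⊠[K] 1) * fexp K _ = _
  rw [h6, h3, ← mul_assoc, tens_mul_tens, mul_one, one_mul]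

theorem jordanFactor_commute_left {x : FPS (U K)} (hx : Commute (H K) x) :
    Commute (jordanFactor K) (x ⊠[K] 1) := by
  refine fexp_commute (jordanExponent_mem_filt K) (Commute.neg_left (Commute.smul_left ?_ _))
  rw [Commute, SemiconjBy, tens_mul_tens, tens_mul_tens, mul_one, one_mul, hx.eq]

theorem jordanFactor_commute_right {x : FPS (U K)} (hx : Commute (σ K) x) :
    Commute (jordanFactor K) (1 ⊠[K] x) := by
  refine fexp_commute (jordanExponent_mem_filt K) (Commute.neg_left (Commute.smul_left ?_ _))
  rw [Commute, SemiconjBy, tens_mul_tens, tens_mul_tens, mul_one, one_mul, hx.eq]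

omit [CharZero K] in
theorem σ_commute_Xp : Commute (σ K) (Xp K) :=
  evalSeries_commute _ (two_parH_Xp_mem_filt K) (by
    rw [Commute, SemiconjBy]; simp only [two_mul, add_mul, mul_add, mul_assoc, mul_parH_mul])

theorem eσm_commute_σ : Commute (eσm K) (σ K) :=
  fexp_commute (neg_mem (σ_mem_filt K)) (Commute.refl _).neg_left

theorem eσ_commute_σ : Commute (eσ K) (σ K) :=
  fexp_commute (σ_mem_filt K) (Commute.refl _)

theorem jordanFactor_mul_H_right : jordanFactor K * (1 ⊠[K] H K) =
    (1 ⊠[K] H K + H K ⊠[K] (eσ K - 1)) * jordanFactor K := by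
  refine fexp_mul_of_commutator (jordanExponent_mem_filt K) ?_ ?_
  · rw [neg_mul, smul_mul_assoc, tens_mul_tens, mul_neg, mul_smul_comm, tens_mul_tens, σ_mul_H,
      one_mul, mul_one, tens_sub, two_mul, tens_add]
    module
  · rw [neg_mul, smul_mul_assoc, tens_mul_tens, mul_neg, mul_smul_comm, tens_mul_tens, mul_sub,
      sub_mul, (eσ_commute_σ K).eq, one_mul, mul_one]

/-- The Jordanian factor makes `e^{-σ}` group-like. -/
theorem jordanFactor_mul_comul₀_eσm :
    jordanFactor K * mapL (comul₀ K).toLinearMap (eσm K) =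
      (eσm K ⊠[K] eσm K) * jordanFactor K := by
  have e : 1 - eσm K = parH * (2 * Xp K) := by
    rw [eσm_eq, mul_parH, mul_assoc]; abel
  have e' : eσm K = 1 - parH * (2 * Xp K) := by rw [← e]; abel
  have h1 : mapL (comul₀ K).toLinearMap (eσm K) =
      1 - parH * (2 * (Xp K ⊠[K] 1 + 1 ⊠[K] Xp K)) := by
    rw [e', map_sub, (isAlgMap_comul₀ K).map_one, (isAlgMap_comul₀ K).map_parH, two_mul, map_add,
      comul₀_Xp, two_mul]
  have h2 : jordanFactor K * (1 ⊠[K] Xp K) = (1 ⊠[K] Xp K) * jordanFactor K :=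
    jordanFactor_commute_right K (σ_commute_Xp K)
  have h3 : eσm K ⊠[K] eσm K = 1 - parH * (2 * (Xp K ⊠[K] eσm K + 1 ⊠[K] Xp K)) := by
    have h4 : parH * (2 * (Xp K ⊠[K] eσm K + 1 ⊠[K] Xp K)) =
        (1 - eσm K) ⊠[K] eσm K + 1 ⊠[K] (1 - eσm K) := by
      rw [e]
      simp only [parH_tens, tens_parH, two_mul, add_tens, tens_add, mul_add]
    rw [h4, sub_tens, tens_sub, one_tens_one]
    abel
  rw [h1, h3]
  simp only [mul_sub, sub_mul, mul_one, one_mul, mul_parH_mul, mul_assoc, two_mul, mul_add, add_mul,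
    jordanFactor_mul_Xp_left, h2]

omit [CharZero K] in
theorem tens_comm_one (x y : FPS (U K)) : Commute (x ⊠[K] 1) (1 ⊠[K] y) := by
  rw [Commute, SemiconjBy, tens_mul_tens, tens_mul_tens, mul_one, one_mul, one_mul, mul_one]

theorem fexp_neg_σ_add :
    fexp K (-(σ K ⊠[K] 1 + 1 ⊠[K] σ K)) = eσm K ⊠[K] eσm K := by
  have hσ := neg_mem (σ_mem_filt K)
  rw [neg_add, ← neg_tens, ← tens_neg, fexp_add (tens_mem_filt_left hσ _)
    (tens_mem_filt_right _ hσ) (tens_comm_one K _ _), ← left_eq, ← right_eq,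
    ← isAlgMap_left.map_fexp hσ, ← isAlgMap_right.map_fexp hσ, ← tens_eq]
  rfl

/-- The Jordanian factor makes `σ` primitive. -/
theorem jordanFactor_mul_comul₀_σ :
    jordanFactor K * mapL (comul₀ K).toLinearMap (σ K) =
      (σ K ⊠[K] 1 + 1 ⊠[K] σ K) * jordanFactor K := by
  set J := jordanFactor K
  set J' := fexp K ((1 / 2 : K) • (H K ⊠[K] σ K)) with hJ'
  have h1 : J * J' = 1 := jordanFactor_mul_neg K
  have h2 : J' * J = 1 := neg_mul_jordanFactor K
  have hc := (isAlgMap_conj (K := K) h1 h2).comp (isAlgMap_comul₀ K)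
  have hσ := σ_mem_filt K
  have h3 := hc.map_fexp (neg_mem hσ)
  rw [map_neg] at h3
  have h4 : ((LinearMap.mulLeft K J ∘ₗ LinearMap.mulRight K J') ∘ₗ mapL (comul₀ K).toLinearMap)
      (fexp K (-σ K)) = eσm K ⊠[K] eσm K := by
    simp only [LinearMap.comp_apply, LinearMap.mulLeft_apply, LinearMap.mulRight_apply]
    rw [← mul_assoc]
    change J * mapL (comul₀ K).toLinearMap (eσm K) * J' = _
    rw [jordanFactor_mul_comul₀_eσm, mul_assoc, h1, mul_one]
  rw [h4, ← fexp_neg_σ_add] at h3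
  have h5 := fexp_injective (neg_mem (add_mem (tens_mem_filt_left hσ _)
    (tens_mem_filt_right _ hσ))) (neg_mem (hc.map_filt hσ)) h3
  have h6 := neg_injective h5
  simp only [LinearMap.comp_apply, LinearMap.mulLeft_apply, LinearMap.mulRight_apply] at h6
  rw [h6, mul_assoc, mul_assoc, h2, mul_one]

theorem jordanFactor_mul_comul₀_sdiv :
    jordanFactor K * mapL (comul₀ K).toLinearMap (sdiv K) =
      (sdiv K ⊠[K] 1 + 1 ⊠[K] sdiv K) * jordanFactor K := by
  refine parH_cancel ?_
  have h := jordanFactor_mul_comul₀_σ K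
  rw [← parH_mul_sdiv] at h
  rw [(isAlgMap_comul₀ K).map_parH, mul_parH_mul, parH_tens, tens_parH, ← mul_add, mul_assoc] at h
  exact h

end Twist

end JordanianTwist

end

noncomputable section

namespace JordanianTwist

section Tensor

variable {K : Type*} [Field K] {A : Type*} [Ring A] [Algebra K A]

theorem comul12_tens (Δ₀ : A →ₐ[K] A ⊗[K] A) (a b : FPS A) :
    comul12 Δ₀ (a ⊠[K] b) = mapL Δ₀.toLinearMap a ⊠[K] b :=
  (isAlgMap_comul12 Δ₀).toIsCts.map_tens_of_const
    ((tensL K (A ⊗[K] A) A) ∘ₗ mapL Δ₀.toLinearMap) (fun _ => isCts_tensL _)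
    (fun b => (isCts_tensL_flip b).comp (isCts_mapL _))
    (fun a b => by
      rw [comul12_const, LinearMap.comp_apply, tensL_apply, mapL_const, const_tens_const]; rfl) a b

theorem comul23_tens (Δ₀ : A →ₐ[K] A ⊗[K] A) (a b : FPS A) :
    comul23 Δ₀ (a ⊠[K] b) = regroup (a ⊠[K] mapL Δ₀.toLinearMap b) :=
  (isAlgMap_comul23 Δ₀).toIsCts.map_tens_of_const
    ((tensL K A (A ⊗[K] A)).compr₂ regroup |>.compl₂ (mapL Δ₀.toLinearMap))
    (fun a => (isAlgMap_regroup (K := K) (A := A)).toIsCts.comp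
      ((isCts_tensL a).comp (isCts_mapL _)))
    (fun b => (isAlgMap_regroup (K := K) (A := A)).toIsCts.comp
      (isCts_tensL_flip (mapL Δ₀.toLinearMap b)))
    (fun a b => by
      rw [comul23_const, LinearMap.compl₂_apply, LinearMap.compr₂_apply, tensL_apply, mapL_const,
        const_tens_const, regroup, mapL_const]; rfl) a b

theorem mapL_lid_rTensor_tens (ε₀ : A →ₐ[K] K) (a b : FPS A) :
    mapL ((TensorProduct.lid K A).toLinearMap ∘ₗ ε₀.toLinearMap.rTensor A) (a ⊠[K] b) =
      base K A (mapL ε₀.toLinearMap a) * b :=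
  (isCts_mapL _).map_tens_of_const
    ((LinearMap.mul K (FPS A)) ∘ₗ mapL (Algebra.linearMap K A) ∘ₗ mapL ε₀.toLinearMap)
    (fun _ => isCts_mulLeft _)
    (fun b => (isCts_mulRight b).comp ((isCts_mapL _).comp (isCts_mapL _)))
    (fun a b => by
      simp [mapL_const, const_algebraMap, const_smul]) a b

theorem mapL_rid_lTensor_tens (ε₀ : A →ₐ[K] K) (a b : FPS A) :
    mapL ((TensorProduct.rid K A).toLinearMap ∘ₗ ε₀.toLinearMap.lTensor A) (a ⊠[K] b) =
      base K A (mapL ε₀.toLinearMap b) * a :=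
  (isCts_mapL _).map_tens_of_const
    (((LinearMap.mul K (FPS A)) ∘ₗ mapL (Algebra.linearMap K A) ∘ₗ mapL ε₀.toLinearMap).flip)
    (fun a => (isCts_mulRight a).comp ((isCts_mapL _).comp (isCts_mapL _)))
    (fun _ => isCts_mulLeft _)
    (fun a b => by
      simp [mapL_const, const_algebraMap, const_smul]) a b

theorem isAlgMap_mapL_lid_rTensor (ε₀ : A →ₐ[K] K) :
    IsAlgMap (mapL ((TensorProduct.lid K A).toLinearMap ∘ₗ ε₀.toLinearMap.rTensor A)) :=
  isAlgMap_mapL ((Algebra.TensorProduct.lid K A).toAlgHom.comp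
    (Algebra.TensorProduct.map ε₀ (AlgHom.id K A)))

theorem isAlgMap_mapL_rid_lTensor (ε₀ : A →ₐ[K] K) :
    IsAlgMap (mapL ((TensorProduct.rid K A).toLinearMap ∘ₗ ε₀.toLinearMap.lTensor A)) :=
  isAlgMap_mapL ((Algebra.TensorProduct.rid K K A).toAlgHom.comp
    (Algebra.TensorProduct.map (AlgHom.id K A) ε₀))

theorem _root_.Commute.tens {B : Type*} [Ring B] [Algebra K B] {a c : FPS A} {b d : FPS B}
    (h : Commute a c) (h' : Commute b d) : Commute (a ⊠[K] b) (c ⊠[K] d) := by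
  rw [Commute, SemiconjBy, tens_mul_tens, tens_mul_tens, h.eq, h'.eq]

theorem neg_smul_mul_eq (c : K) {x x' y : FPS A} (h : y * x = x' * y) :
    -(c • x') * y = y * -(c • x) := by
  rw [neg_mul, mul_neg, smul_mul_assoc, mul_smul_comm, h]

end Tensor

section Twist

variable (K : Type*) [Field K] [CharZero K]

/-! #### The twist element is a normalised cocycle -/

local notation "D" => mapL (AlgHom.toLinearMap (comul₀ K))

theorem leg12_jordanFactor :
    leg12 (jordanFactor K) = fexp K (-((1 / 2 : K) • (H K ⊠[K] σ K ⊠[K] 1))) := by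
  rw [jordanFactor, (isAlgMap_leg12 (K := K) (A := U K)).map_fexp (jordanExponent_mem_filt K),
    map_neg, map_smul, leg12_tens]

theorem leg13_jordanFactor :
    leg13 (jordanFactor K) = fexp K (-((1 / 2 : K) • (H K ⊠[K] 1 ⊠[K] σ K))) := by
  rw [jordanFactor, (isAlgMap_leg13 (K := K) (A := U K)).map_fexp (jordanExponent_mem_filt K),
    map_neg, map_smul, leg13_tens]

theorem leg23_jordanFactor :
    leg23 (jordanFactor K) = fexp K (-((1 / 2 : K) • (1 ⊠[K] H K ⊠[K] σ K))) := by
  rw [jordanFactor, (isAlgMap_leg23 (K := K) (A := U K)).map_fexp (jordanExponent_mem_filt K),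
    map_neg, map_smul, leg23_tens]

omit [CharZero K] in
theorem jordan12_mem_filt :
    -((1 / 2 : K) • (H K ⊠[K] σ K ⊠[K] (1 : FPS (U K)))) ∈ filt (U K ⊗[K] U K ⊗[K] U K) 1 :=
  neg_mem (smul_mem_filt _ (tens_mem_filt_left (tens_mem_filt_right _ (σ_mem_filt K)) _))

omit [CharZero K] in
theorem jordan13_mem_filt :
    -((1 / 2 : K) • (H K ⊠[K] (1 : FPS (U K)) ⊠[K] σ K)) ∈ filt (U K ⊗[K] U K ⊗[K] U K) 1 :=
  neg_mem (smul_mem_filt _ (tens_mem_filt_right _ (σ_mem_filt K)))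

omit [CharZero K] in
theorem jordan23_mem_filt :
    -((1 / 2 : K) • ((1 : FPS (U K)) ⊠[K] H K ⊠[K] σ K)) ∈ filt (U K ⊗[K] U K ⊗[K] U K) 1 :=
  neg_mem (smul_mem_filt _ (tens_mem_filt_right _ (σ_mem_filt K)))

/-- As `H` is primitive, the Jordanian factor is a character in its first leg. -/
theorem comul12_jordanFactor :
    comul12 (comul₀ K) (jordanFactor K) = leg13 (jordanFactor K) * leg23 (jordanFactor K) := by
  rw [leg13_jordanFactor, leg23_jordanFactor, ← fexp_add (jordan13_mem_filt K)
    (jordan23_mem_filt K), jordanFactor,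
    (isAlgMap_comul12 (comul₀ K)).map_fexp (jordanExponent_mem_filt K), map_neg, map_smul,
    comul12_tens, comul₀_H, add_tens]
  · congr 1; module
  · exact (((tens_comm_one K _ _).tens
      (Commute.refl _)).smul_left _ |>.smul_right _).neg_left.neg_right

/-- As conjugation by the Jordanian factor makes `σ` primitive, the Jordanian factor satisfies the
cocycle equation. -/
theorem leg23_jordanFactor_mul_comul23 :
    leg23 (jordanFactor K) * comul23 (comul₀ K) (jordanFactor K) =
      leg12 (jordanFactor K) * leg13 (jordanFactor K) * leg23 (jordanFactor K) := by
  rw [leg12_jordanFactor, leg13_jordanFactor, ← fexp_add (jordan12_mem_filt K)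
    (jordan13_mem_filt K)]
  swap
  · exact ((((Commute.refl (H K)).tens (Commute.one_right (σ K))).tens
      (Commute.one_left (σ K))).smul_left _ |>.smul_right _).neg_left.neg_right
  rw [jordanFactor,
    (isAlgMap_comul23 (comul₀ K)).map_fexp (jordanExponent_mem_filt K), ← jordanFactor]
  refine (evalSeries_semiconj (PowerSeries.exp K)
    (add_mem (jordan12_mem_filt K) (jordan13_mem_filt K))
    ((isAlgMap_comul23 (comul₀ K)).map_filt (jordanExponent_mem_filt K)) ?_).symm
  have h : leg23 (jordanFactor K) * regroup (H K ⊠[K] D (σ K)) =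
      (H K ⊠[K] σ K ⊠[K] 1 + H K ⊠[K] 1 ⊠[K] σ K) * leg23 (jordanFactor K) := by
    rw [← regroup_one_tens, ← regroup_tens, ← regroup_tens, ← map_add,
      ← (isAlgMap_regroup (K := K) (A := U K)).map_mul,
      ← (isAlgMap_regroup (K := K) (A := U K)).map_mul, ← tens_add, tens_mul_tens, tens_mul_tens,
      one_mul, mul_one, jordanFactor_mul_comul₀_σ]
  rw [map_neg, map_smul, comul23_tens, ← neg_add, ← smul_add]
  exact neg_smul_mul_eq _ h

theorem leg12_abelianFactor : leg12 (abelianFactor K) =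
    fexp K ((1 / 2 : K) • (parG * (sdiv K ⊠[K] Z K ⊠[K] 1))) := by
  rw [abelianFactor, (isAlgMap_leg12 (K := K) (A := U K)).map_fexp (abelianExponent_mem_filt K),
    map_smul, (isAlgMap_leg12 (K := K) (A := U K)).toIsCts.map_parG, leg12_tens]

theorem leg13_abelianFactor : leg13 (abelianFactor K) =
    fexp K ((1 / 2 : K) • (parG * (sdiv K ⊠[K] 1 ⊠[K] Z K))) := by
  rw [abelianFactor, (isAlgMap_leg13 (K := K) (A := U K)).map_fexp (abelianExponent_mem_filt K),
    map_smul, (isAlgMap_leg13 (K := K) (A := U K)).toIsCts.map_parG, leg13_tens]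

theorem leg23_abelianFactor : leg23 (abelianFactor K) =
    fexp K ((1 / 2 : K) • (parG * (1 ⊠[K] sdiv K ⊠[K] Z K))) := by
  rw [abelianFactor, (isAlgMap_leg23 (K := K) (A := U K)).map_fexp (abelianExponent_mem_filt K),
    map_smul, (isAlgMap_leg23 (K := K) (A := U K)).toIsCts.map_parG, leg23_tens]

variable {K} in
omit [CharZero K] in
theorem half_parG_mul_mem_filt {A : Type*} [Ring A] [Algebra K A] (x : FPS A) :
    (1 / 2 : K) • (parG * x) ∈ filt A 1 := smul_mem_filt _ (parG_mem_filt_mul _)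

variable {K} in
omit [CharZero K] in
theorem half_parG_mul_commute {A : Type*} [Ring A] [Algebra K A] {x y : FPS A} (h : Commute x y) :
    Commute ((1 / 2 : K) • (parG * x)) y :=
  Commute.smul_left (Commute.mul_left (X_commute 1 y) h) _

variable {K} in
omit [CharZero K] in
theorem half_parG_mul_commute_half {A : Type*} [Ring A] [Algebra K A] {x y : FPS A}
    (h : Commute x y) : Commute ((1 / 2 : K) • (parG * x)) ((1 / 2 : K) • (parG * y)) :=
  half_parG_mul_commute (half_parG_mul_commute h.symm).symm

variable {K} in
theorem fexp_half_parG_add {A : Type*} [Ring A] [Algebra K A] {x y : FPS A}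
    (h : Commute x y) : fexp K ((1 / 2 : K) • (parG * (x + y))) =
      fexp K ((1 / 2 : K) • (parG * x)) * fexp K ((1 / 2 : K) • (parG * y)) := by
  rw [mul_add, smul_add, fexp_add (half_parG_mul_mem_filt _) (half_parG_mul_mem_filt _)
    (half_parG_mul_commute_half h)]

/-- As `Z` is primitive, the abelian factor is a character in its second leg. -/
theorem comul23_abelianFactor : comul23 (comul₀ K) (abelianFactor K) =
    leg12 (abelianFactor K) * leg13 (abelianFactor K) := by
  rw [leg12_abelianFactor, leg13_abelianFactor, ← fexp_half_parG_add, abelianFactor,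
    (isAlgMap_comul23 (comul₀ K)).map_fexp (abelianExponent_mem_filt K), map_smul,
    (isAlgMap_comul23 (comul₀ K)).toIsCts.map_parG, comul23_tens, comul₀_Z, tens_add, map_add,
    regroup_tens, regroup_tens]
  exact ((Commute.refl _).tens (Commute.one_right _)).tens (Commute.one_left _)

/-- Up to conjugation by the Jordanian factor, which makes `σ / h` primitive, the abelian factor is
a character in its first leg. -/
theorem leg12_jordanFactor_mul_comul12 :
    leg12 (jordanFactor K) * comul12 (comul₀ K) (abelianFactor K) =
      leg13 (abelianFactor K) * leg23 (abelianFactor K) * leg12 (jordanFactor K) := by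
  rw [leg13_abelianFactor, leg23_abelianFactor, ← fexp_half_parG_add]
  swap
  · exact (tens_comm_one K _ _).tens (Commute.refl _)
  rw [abelianFactor, (isAlgMap_comul12 (comul₀ K)).map_fexp (abelianExponent_mem_filt K)]
  refine (evalSeries_semiconj (PowerSeries.exp K) (half_parG_mul_mem_filt _)
    ((isAlgMap_comul12 (comul₀ K)).map_filt (abelianExponent_mem_filt K)) ?_).symm
  have h : leg12 (jordanFactor K) * (D (sdiv K) ⊠[K] Z K) =
      (sdiv K ⊠[K] 1 ⊠[K] Z K + 1 ⊠[K] sdiv K ⊠[K] Z K) * leg12 (jordanFactor K) := by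
    have e : leg12 (jordanFactor K) = jordanFactor K ⊠[K] (1 : FPS (U K)) := left_eq (B := U K) _
    rw [e, ← add_tens, tens_mul_tens, tens_mul_tens, one_mul, mul_one, jordanFactor_mul_comul₀_sdiv]
  rw [map_smul, (isAlgMap_comul12 (comul₀ K)).toIsCts.map_parG, comul12_tens, mul_smul_comm,
    mul_parG_mul, h, smul_mul_assoc, mul_assoc]

/-- The cocycle equation for the product of the two factors. The legs of the abelian factor that
have to be moved past the Jordanian factor commute with it, as `Z` is central. -/
theorem F_cocycle : leg12 (F K) * comul12 (comul₀ K) (F K) =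
    leg23 (F K) * comul23 (comul₀ K) (F K) := by
  rw [F_eq, (isAlgMap_comul12 (comul₀ K)).map_mul, (isAlgMap_comul23 (comul₀ K)).map_mul,
    (isAlgMap_leg12 (K := K) (A := U K)).map_mul, (isAlgMap_leg23 (K := K) (A := U K)).map_mul]
  have h1 : Commute (leg23 (jordanFactor K))
      (leg12 (abelianFactor K) * leg13 (abelianFactor K)) := by
    rw [leg23_jordanFactor, leg12_abelianFactor, leg13_abelianFactor]
    refine Commute.mul_right ?_ ?_
    all_goals
      refine fexp_commute (jordan23_mem_filt K) (Commute.symm ?_)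
      refine fexp_commute (half_parG_mul_mem_filt _) (half_parG_mul_commute ?_)
      refine (Commute.smul_right ?_ _).neg_right
    · exact ((Commute.one_right _).tens (Z_commute K _)).tens (Commute.one_left _)
    · exact ((Commute.one_right _).tens (Commute.one_left _)).tens (Z_commute K _)
  have h2 : Commute (leg23 (abelianFactor K))
      (leg12 (abelianFactor K) * leg13 (abelianFactor K)) := by
    rw [leg23_abelianFactor, leg12_abelianFactor, leg13_abelianFactor]
    refine Commute.mul_right ?_ ?_
    all_goals
      refine fexp_commute (half_parG_mul_mem_filt _) (Commute.symm ?_)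
      refine fexp_commute (half_parG_mul_mem_filt _) (half_parG_mul_commute_half ?_)
    · exact ((Commute.one_right _).tens (Z_commute K _)).tens (Commute.one_left _)
    · exact ((Commute.one_right _).tens (Commute.one_left _)).tens (Z_commute K _)
  calc _ = leg12 (abelianFactor K) *
        (leg12 (jordanFactor K) * comul12 (comul₀ K) (abelianFactor K)) *
        comul12 (comul₀ K) (jordanFactor K) := by simp only [mul_assoc]
    _ = (leg12 (abelianFactor K) * leg13 (abelianFactor K)) * leg23 (abelianFactor K) *
        (leg12 (jordanFactor K) * leg13 (jordanFactor K) * leg23 (jordanFactor K)) := by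
      rw [leg12_jordanFactor_mul_comul12, comul12_jordanFactor]; simp only [mul_assoc]
    _ = leg23 (abelianFactor K) * ((leg12 (abelianFactor K) * leg13 (abelianFactor K)) *
        leg23 (jordanFactor K)) * comul23 (comul₀ K) (jordanFactor K) := by
      rw [← leg23_jordanFactor_mul_comul23, ← h2.eq]; simp only [mul_assoc]
    _ = _ := by rw [← h1.eq, comul23_abelianFactor]; simp only [mul_assoc]

theorem isTwist_F : IsTwist (comul₀ K).toLinearMap (counit₀ K).toLinearMap (F K) where
  isUnit := ⟨⟨F K, twistInv K, F_mul_twistInv K, twistInv_mul_F K⟩, rfl⟩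
  counit_left := by
    have hE := isAlgMap_mapL_lid_rTensor (counit₀ K)
    rw [F_eq, hE.map_mul, abelianFactor, jordanFactor, hE.map_fexp (abelianExponent_mem_filt K),
      hE.map_fexp (jordanExponent_mem_filt K), map_neg, map_smul, map_smul, hE.toIsCts.map_parG,
      mapL_lid_rTensor_tens, mapL_lid_rTensor_tens]
    change fexp K ((1 / 2 : K) • (parG * (base K (U K) (ε K (sdiv K)) * Z K))) *
      fexp K (-((1 / 2 : K) • (base K (U K) (ε K (H K)) * σ K))) = 1
    simp [ε_sdiv, ε_H, fexp_zero]
  counit_right := by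
    have hE := isAlgMap_mapL_rid_lTensor (counit₀ K)
    rw [F_eq, hE.map_mul, abelianFactor, jordanFactor, hE.map_fexp (abelianExponent_mem_filt K),
      hE.map_fexp (jordanExponent_mem_filt K), map_neg, map_smul, map_smul, hE.toIsCts.map_parG,
      mapL_rid_lTensor_tens, mapL_rid_lTensor_tens]
    change fexp K ((1 / 2 : K) • (parG * (base K (U K) (ε K (Z K)) * sdiv K))) *
      fexp K (-((1 / 2 : K) • (base K (U K) (ε K (σ K)) * H K))) = 1
    simp [ε_Z, ε_σ, fexp_zero]
  cocycle := F_cocycle K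

theorem isTopHopf_U : IsTopHopf (Δ K) (ε K) (S K) :=
  isTopHopf_twist (isCocommHopf_U K) (isTwist_F K) (F_mul_twistInv K) (twistInv_mul_F K)
    (F_sub_one_mem_filt K)

theorem isTriangular_U : IsTriangular (Δ K) (twistR (F K)) :=
  isTriangular_twist (isCocommHopf_U K) (isTwist_F K) (F_mul_twistInv K) (twistInv_mul_F K)

theorem twistR_F : twistR (F K) =
    fexp K ((1 / 2 : K) • (parG * (Z K ⊠[K] divH (σ K)))) *
    fexp K (-((1 / 2 : K) • (σ K ⊠[K] H K))) *
    fexp K ((1 / 2 : K) • (H K ⊠[K] σ K)) *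
    fexp K (-((1 / 2 : K) • (parG * (divH (σ K) ⊠[K] Z K)))) := by
  have hf := isAlgMap_flip (K := K) (A := U K)
  rw [twistR, inverse_eq (F_mul_twistInv K) (twistInv_mul_F K), F_eq, hf.map_mul, abelianFactor,
    jordanFactor, hf.map_fexp (abelianExponent_mem_filt K),
    hf.map_fexp (jordanExponent_mem_filt K), map_neg, map_smul, map_smul, hf.toIsCts.map_parG,
    flip_tens, flip_tens, twistInv, ← mul_assoc]
  rfl

end Twist

end JordanianTwist

end

noncomputable section

namespace JordanianTwist

section GeneratorFormulas

variable (K : Type*) [Field K] [CharZero K]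

/-! ### Coproduct and antipode of the Lie generators -/

local notation "D" => mapL (AlgHom.toLinearMap (comul₀ K))

theorem isAlgMap_Δ : IsAlgMap (Δ K) :=
  isAlgMap_twistComul (comul₀ K) (F_mul_twistInv K) (twistInv_mul_F K)

/-- The twisted coproduct of `x` is obtained from `Δ₀(x)` by conjugation by the Jordanian factor,
followed by conjugation by the abelian factor. -/
theorem Δ_eq {x : FPS (U K)} {y z : FPS (U K ⊗[K] U K)}
    (h1 : jordanFactor K * D x = y * jordanFactor K)
    (h2 : abelianFactor K * y = z * abelianFactor K) : Δ K x = z := by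
  rw [Δ, twistComul_apply (comul₀ K) (F_mul_twistInv K) (twistInv_mul_F K), F_eq, ← mul_assoc,
    mul_assoc (abelianFactor K), h1, ← mul_assoc, h2, mul_assoc z, mul_assoc, ← F_eq,
    F_mul_twistInv, mul_one]

theorem abelianFactor_commute {x y : FPS (U K)} (h : Commute (sdiv K) x) :
    Commute (abelianFactor K) (x ⊠[K] y) :=
  fexp_commute (abelianExponent_mem_filt K) (half_parG_mul_commute (h.tens (Z_commute K y)))

/-- `(e^σ - 1) / h`. -/
def tdiv : FPS (U K) := divH (eσ K - 1)

/-- `(e^{-σ} - 1) / h`. -/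
def tdivm : FPS (U K) := divH (eσm K - 1)

theorem parH_mul_divH_fexp_sub_one {A : Type*} [Ring A] [Algebra K A] (x : FPS A) :
    parH * divH (fexp K (parH * x) - 1) = fexp K (parH * x) - 1 := by
  have hx : parH * x ∈ filt A 1 := mul_mem_filt_left parH_mem_filt x
  have h : fexp K (parH * x) - 1 = evalSeries (PowerSeries.exp K - 1) (parH * x) := by
    rw [evalSeries_sub, evalSeries_one hx]; rfl
  rw [h, parH_mul_divH_evalSeries (by simp)]

theorem parH_mul_tdiv : parH * tdiv K = eσ K - 1 := by
  have := parH_mul_divH_fexp_sub_one K (sdiv K)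
  rwa [parH_mul_sdiv] at this

theorem parH_mul_tdivm : parH * tdivm K = eσm K - 1 := by
  have := parH_mul_divH_fexp_sub_one K (-sdiv K)
  rwa [mul_neg, parH_mul_sdiv] at this

theorem sdiv_mul_H : sdiv K * H K = H K * sdiv K - 2 * tdiv K := by
  refine parH_cancel ?_
  rw [mul_sub, ← mul_parH_mul (H K), ← mul_parH_mul 2, ← mul_assoc parH (sdiv K), parH_mul_sdiv,
    parH_mul_tdiv, σ_mul_H]

theorem sdiv_mul_Xm : sdiv K * Xm K = Xm K * sdiv K + 2 * (H K * eσ K - (eσ K - 1) * eσ K) := by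
  refine parH_cancel ?_
  rw [mul_add, ← mul_parH_mul (Xm K), ← mul_assoc parH (sdiv K), parH_mul_sdiv, σ_mul_Xm, two_mul,
    two_mul, add_mul, mul_add]

omit [CharZero K] in
theorem commute_sdiv_of_commute_σ {x : FPS (U K)} (h : Commute (σ K) x) : Commute (sdiv K) x := by
  refine parH_cancel ?_
  rw [← mul_assoc, ← mul_parH_mul, parH_mul_sdiv, h.eq]

theorem commute_tdiv_of_commute_eσ {x : FPS (U K)} (h : Commute (eσ K) x) : Commute (tdiv K) x := by
  refine parH_cancel ?_
  rw [← mul_assoc, ← mul_parH_mul, parH_mul_tdiv, sub_mul, mul_sub, h.eq, one_mul, mul_one]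

omit [CharZero K] in
theorem sdiv_commute_σ : Commute (sdiv K) (σ K) := commute_sdiv_of_commute_σ K (Commute.refl _)

theorem sdiv_commute_eσ : Commute (sdiv K) (eσ K) :=
  commute_sdiv_of_commute_σ K (eσ_commute_σ K).symm

theorem sdiv_commute_eσm : Commute (sdiv K) (eσm K) :=
  commute_sdiv_of_commute_σ K (eσm_commute_σ K).symm

theorem tdiv_commute_eσ : Commute (tdiv K) (eσ K) :=
  commute_tdiv_of_commute_eσ K (Commute.refl _)

theorem tdiv_commute_sdiv : Commute (tdiv K) (sdiv K) :=
  commute_tdiv_of_commute_eσ K (sdiv_commute_eσ K).symm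

theorem abelianFactor_mul_H_left (b : FPS (U K)) : abelianFactor K * (H K ⊠[K] b) =
    (H K ⊠[K] b - parG * (tdiv K ⊠[K] (Z K * b))) * abelianFactor K := by
  rw [sub_eq_add_neg]
  refine fexp_mul_of_commutator (abelianExponent_mem_filt K) ?_ ?_
  · simp only [smul_mul_assoc, mul_smul_comm, mul_assoc, mul_parG_mul, tens_mul_tens, sdiv_mul_H,
      sub_tens, two_mul, add_tens, mul_sub, mul_add, ← (Z_commute K b).eq]
    module
  · simp only [smul_mul_assoc, mul_smul_comm, mul_assoc, mul_parG_mul, tens_mul_tens, mul_neg,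
      neg_mul, (tdiv_commute_sdiv K).eq, ← (Z_commute K b).eq, smul_neg]

/-- With `s = σ`, `t = e^σ - 1` or `s = σ / h`, `t = (e^σ - 1) / h`, and `e = e^σ`, this is the
commutator of `s` with the element `H e^σ - (e^σ - 1) e^σ = [σ, X₋] / (2h)`. -/
theorem mul_Xm_bracket {R : Type*} [Ring R] {s H e t : R} (hH : s * H = H * s - 2 * t)
    (he : Commute s e) :
    s * (H * e - (e - 1) * e) = (H * e - (e - 1) * e) * s - 2 * (t * e) := by
  have h1 := ((he.sub_right (Commute.one_right s)).mul_right he).eq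
  rw [mul_sub, h1, ← mul_assoc, hH, sub_mul, sub_mul, mul_assoc H s, he.eq]
  noncomm_ring

theorem abelianFactor_mul_Xm_left (b : FPS (U K)) : abelianFactor K * (Xm K ⊠[K] b) =
    (Xm K ⊠[K] b + parG * ((H K * eσ K - (eσ K - 1) * eσ K) ⊠[K] (Z K * b))
      + (1 / 2 : K) • -(parG * (parG * ((tdiv K * eσ K) ⊠[K] (Z K * (Z K * b)))))) *
      abelianFactor K := by
  refine fexp_mul_of_commutators (abelianExponent_mem_filt K) ?_ ?_ ?_
  · simp only [smul_mul_assoc, mul_smul_comm, mul_assoc, mul_parG_mul, tens_mul_tens, sdiv_mul_Xm,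
      two_mul, add_tens, mul_add, ← (Z_commute K b).eq]
    module
  · have h := mul_Xm_bracket (sdiv_mul_H K) (sdiv_commute_eσ K)
    generalize H K * eσ K - (eσ K - 1) * eσ K = M at h ⊢
    simp only [smul_mul_assoc, mul_smul_comm, mul_assoc, mul_parG_mul, tens_mul_tens, h,
      two_mul, sub_tens, add_tens, mul_add, mul_sub, ← (Z_commute K b).eq]
    module
  · have h := ((tdiv_commute_sdiv K).mul_left (sdiv_commute_eσ K).symm).eq
    generalize tdiv K * eσ K = M at h ⊢
    simp only [smul_mul_assoc, mul_smul_comm, mul_assoc, mul_parG_mul, tens_mul_tens, mul_neg,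
      neg_mul, h, ← (Z_commute K b).eq, smul_neg]

theorem H_mul_eσ : H K * eσ K = eσ K * H K + 2 * (eσ K * eσ K) - 2 * eσ K := by
  have h := evalSeries_mul_of_commutators (PowerSeries.exp K) (w := 0) (σ_mem_filt K)
    (y := H K) (z := -(2 * (eσ K - 1))) (by rw [σ_mul_H]; abel)
    (by
      have := (eσ_commute_σ K).eq
      rw [add_zero, mul_neg, neg_mul, two_mul, mul_add, add_mul, mul_sub, sub_mul, this, one_mul,
        mul_one]) (by simp)
  rw [PowerSeries.derivative_exp] at h
  change eσ K * H K = H K * eσ K + _ * eσ K + _ at h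
  rw [h]
  simp only [zero_mul, smul_zero, add_zero]
  noncomm_ring

/-- The Jordanian factor conjugates `1 ⊗ X₋`. -/
theorem jordanFactor_mul_Xm_right : jordanFactor K * (1 ⊠[K] Xm K) =
    (1 ⊠[K] Xm K - parH * (H K ⊠[K] (H K * eσ K - (eσ K - 1) * eσ K)) +
      (1 / 2 : K) • -(parH * ((H K * H K) ⊠[K] ((eσ K - 1) * eσ K)))) * jordanFactor K := by
  have hc := (eσ_commute_σ K).eq
  rw [sub_eq_add_neg]
  refine fexp_mul_of_commutators (jordanExponent_mem_filt K) ?_ ?_ ?_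
  · have h : σ K * Xm K = Xm K * σ K +
        (2 : K) • (parH * (H K * eσ K - (eσ K - 1) * eσ K)) := by
      rw [σ_mul_Xm, mul_assoc, two_mul, two_smul]
    simp only [neg_mul, mul_neg, smul_mul_assoc, mul_smul_comm, tens_mul_tens, h, one_mul, mul_one,
      tens_add, tens_smul, tens_parH]
    module
  · have h := mul_Xm_bracket (σ_mul_H K) (eσ_commute_σ K).symm
    generalize H K * eσ K - (eσ K - 1) * eσ K = M at h ⊢
    simp only [neg_mul, mul_neg, smul_mul_assoc, mul_smul_comm, tens_mul_tens, h, mul_parH_mul,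
      mul_assoc, tens_sub, two_mul, tens_add, mul_sub, mul_add]
    module
  · have h := (((eσ_commute_σ K).sub_left (Commute.one_left _)).mul_left (eσ_commute_σ K)).eq
    generalize (eσ K - 1) * eσ K = M at h ⊢
    simp only [neg_mul, mul_neg, smul_mul_assoc, mul_smul_comm, tens_mul_tens, h, mul_parH_mul,
      mul_assoc, smul_neg]

end GeneratorFormulas

end JordanianTwist

end

noncomputable section

namespace JordanianTwist

section GeneratorCoproducts

variable (K : Type*) [Field K] [CharZero K]

local notation "D" => mapL (AlgHom.toLinearMap (comul₀ K))

theorem Δ_Z : Δ K (Z K) = Z K ⊠[K] 1 + 1 ⊠[K] Z K := by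
  refine Δ_eq K (y := Z K ⊠[K] 1 + 1 ⊠[K] Z K) ?_ ?_
  · rw [comul₀_Z, mul_add, add_mul, (jordanFactor_commute_left K (Z_commute K _).symm).eq,
      (jordanFactor_commute_right K (Z_commute K _).symm).eq]
  · rw [mul_add, add_mul, (abelianFactor_commute K (Z_commute K _).symm).eq,
      (abelianFactor_commute K (Commute.one_right _)).eq]

theorem Δ_σ : Δ K (σ K) = σ K ⊠[K] 1 + 1 ⊠[K] σ K := by
  refine Δ_eq K (jordanFactor_mul_comul₀_σ K) ?_
  rw [mul_add, add_mul, (abelianFactor_commute K (sdiv_commute_σ K)).eq,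
    (abelianFactor_commute K (Commute.one_right _)).eq]

theorem Δ_eσm : Δ K (eσm K) = eσm K ⊠[K] eσm K := by
  refine Δ_eq K (jordanFactor_mul_comul₀_eσm K) ?_
  rw [(abelianFactor_commute K (sdiv_commute_eσm K)).eq]

theorem divH_one_sub_eσ : divH (1 - eσ K) = -tdiv K := by
  rw [← divH_parH_mul (-tdiv K), mul_neg, parH_mul_tdiv, neg_sub]

theorem jordanFactor_mul_comul₀_H : jordanFactor K * D (H K) =
    (H K ⊠[K] eσ K + 1 ⊠[K] H K) * jordanFactor K := by
  rw [comul₀_H, mul_add, jordanFactor_mul_H_right,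
    (jordanFactor_commute_left K (Commute.refl _)).eq, ← add_mul, tens_sub]
  congr 1
  abel

theorem Δ_H : Δ K (H K) = H K ⊠[K] eσ K + 1 ⊠[K] H K - parG * (tdiv K ⊠[K] (Z K * eσ K)) := by
  refine Δ_eq K (jordanFactor_mul_comul₀_H K) ?_
  rw [mul_add, abelianFactor_mul_H_left, (abelianFactor_commute K (Commute.one_right _)).eq,
    ← add_mul]
  congr 1
  abel

theorem eσm_eq_one_sub_parH_mul : eσm K = 1 - parH * ((2 : K) • Xp K) := by
  rw [eσm_eq, two_smul, mul_add, two_mul, add_mul]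

theorem Δ_Xp : Δ K (Xp K) = Xp K ⊠[K] 1 + eσm K ⊠[K] Xp K := by
  have e : parH * ((2 : K) • Xp K) = 1 - eσm K := by rw [eσm_eq_one_sub_parH_mul]; abel
  have h : (2 : K) • Δ K (Xp K) = (2 : K) • (Xp K ⊠[K] 1 + eσm K ⊠[K] Xp K) := by
    refine parH_cancel ?_
    rw [← map_smul, ← (isAlgMap_Δ K).map_parH, smul_add, mul_add, ← smul_tens, ← tens_smul,
      ← parH_tens, ← tens_parH, e, map_sub, (isAlgMap_Δ K).map_one, Δ_eσm, sub_tens, tens_sub,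
      one_tens_one]
    abel
  exact smul_right_injective _ (two_ne_zero (α := K)) h

theorem jordanFactor_mul_comul₀_Xm : jordanFactor K * D (Xm K) =
    (Xm K ⊠[K] eσ K + (1 ⊠[K] Xm K - parH * (H K ⊠[K] (H K * eσ K - (eσ K - 1) * eσ K)) +
      (1 / 2 : K) • -(parH * ((H K * H K) ⊠[K] ((eσ K - 1) * eσ K))))) * jordanFactor K := by
  rw [comul₀_Xm, mul_add, jordanFactor_mul_Xm_left, jordanFactor_mul_Xm_right, ← add_mul]

theorem abelianFactor_mul_HH_left (b : FPS (U K)) : abelianFactor K * ((H K * H K) ⊠[K] b) =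
    ((H K * H K) ⊠[K] b - parG * ((H K * tdiv K) ⊠[K] (Z K * b))
      - parG * ((tdiv K * H K) ⊠[K] (Z K * b))
      + parG * (parG * ((tdiv K * tdiv K) ⊠[K] (Z K * (Z K * b))))) * abelianFactor K := by
  have h : (H K * H K) ⊠[K] b = (H K ⊠[K] b) * (H K ⊠[K] 1) := by
    rw [tens_mul_tens, mul_one]
  rw [h, ← mul_assoc, abelianFactor_mul_H_left, mul_assoc, abelianFactor_mul_H_left, ← mul_assoc]
  congr 1
  simp only [mul_sub, sub_mul, mul_assoc, mul_parG_mul, tens_mul_tens, mul_one,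
    ← (Z_commute K b).eq]
  abel

theorem Δ_Xm : Δ K (Xm K) = Xm K ⊠[K] eσ K + 1 ⊠[K] Xm K
    - parH * (H K ⊠[K] (eσ K * H K))
    - (1 / 2 : K) • (parH * ((H K * (H K + 2)) ⊠[K] (eσ K * (eσ K - 1))))
    + parG * ((eσ K - 1) ⊠[K] (Z K * eσ K * H K))
    + parG * ((H K - eσ K + 1) ⊠[K] (Z K * eσ K))
    + parG * (((eσ K - 1) * (H K + eσ K + 1)) ⊠[K] (Z K * eσ K ^ 2))
    - (1 / 2 : K) • (parG ^ 2 * (tdiv K ⊠[K] (Z K ^ 2 * eσ K)))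
    - (1 / 2 : K) • (parG ^ 2 * (((eσ K - 1) * tdiv K) ⊠[K] (Z K ^ 2 * eσ K ^ 2))) := by
  refine Δ_eq K (jordanFactor_mul_comul₀_Xm K) ?_
  have ht : parH * tdiv K = eσ K - 1 := parH_mul_tdiv K
  have hHe := H_mul_eσ K
  have hte := (tdiv_commute_eσ K).eq
  have hcomm : Commute (abelianFactor K) ((1 : FPS (U K)) ⊠[K] Xm K) :=
    abelianFactor_commute K (Commute.one_right _)
  -- every occurrence of `t = (e^σ - 1) / h` outside the `g²`-terms is multiplied by `h`
  have h1 : ∀ b, abelianFactor K * (parH * (H K ⊠[K] b)) =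
      (parH * (H K ⊠[K] b) - parG * ((eσ K - 1) ⊠[K] (Z K * b))) * abelianFactor K := fun b => by
    rw [mul_parH_mul, abelianFactor_mul_H_left, ← mul_assoc, mul_sub, mul_parG_mul parH,
      ← parH_tens (tdiv K), ht]
  have h2 : ∀ b, abelianFactor K * (parH * ((H K * H K) ⊠[K] b)) =
      (parH * ((H K * H K) ⊠[K] b) - parG * ((H K * (eσ K - 1)) ⊠[K] (Z K * b))
      - parG * (((eσ K - 1) * H K) ⊠[K] (Z K * b))
      + parG * (parG * (((eσ K - 1) * tdiv K) ⊠[K] (Z K * (Z K * b))))) * abelianFactor K :=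
    fun b => by
      rw [mul_parH_mul, abelianFactor_mul_HH_left, ← mul_assoc, mul_add, mul_sub, mul_sub,
        mul_parG_mul parH, mul_parG_mul parH, mul_parG_mul parH, mul_parG_mul parH,
        ← parH_tens (H K * tdiv K), ← parH_tens (tdiv K * H K), ← parH_tens (tdiv K * tdiv K),
        ← mul_parH_mul (H K), ← mul_assoc parH, ← mul_assoc parH, ht]
  have h3 : ∀ {a b c d y f : FPS (U K ⊗[K] U K)}, a + (b - c + (1 / 2 : K) • -d) = y →
      a * f + (b * f - c * f + (1 / 2 : K) • -(d * f)) = y * f := fun h => by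
    rw [← h, add_mul, add_mul, sub_mul, smul_mul_assoc, neg_mul]
  rw [mul_add, mul_add, mul_sub, mul_smul_comm, mul_neg, abelianFactor_mul_Xm_left, hcomm.eq, h1,
    h2]
  refine h3 ?_
  simp only [pow_two, mul_add, mul_sub, sub_mul, mul_one, one_mul, mul_assoc, hHe, two_mul,
    mul_two, hte, add_tens, tens_add, sub_tens, tens_sub, smul_add, smul_sub, smul_neg]
  module

theorem divH_sq_eσ_sub_one : divH ((eσ K - 1) ^ 2) = (eσ K - 1) * tdiv K := by
  rw [← divH_parH_mul ((eσ K - 1) * tdiv K), ← mul_parH_mul, parH_mul_tdiv, pow_two]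

end GeneratorCoproducts

end JordanianTwist

end

noncomputable section

namespace JordanianTwist

section GeneratorAntipodes

variable (K : Type*) [Field K] [CharZero K]

theorem isAntiMap_S : IsAntiMap (S K) :=
  isAntiMap_twistAntipode (isCocommHopf_U K) (isTwist_F K) (F_mul_twistInv K) (twistInv_mul_F K)
    (F_sub_one_mem_filt K)

/-- The map `a ⊗ b ↦ S(a) b`. -/
def antipodeConv : FPS (U K ⊗[K] U K) →ₗ[K] FPS (U K) := mulMap ∘ₗ tensMap (S K) LinearMap.id

theorem isCts_antipodeConv : IsCts (antipodeConv K) := isCts_mulMap.comp (isCts_tensMap _ _)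

theorem antipodeConv_tens (a b : FPS (U K)) : antipodeConv K (a ⊠[K] b) = S K a * b := by
  rw [antipodeConv, LinearMap.comp_apply, tensMap_tens (isAntiMap_S K).toIsCts isCts_id,
    mulMap_tens]
  rfl

/-- The antipode axiom, from which the antipode of an element is read off its coproduct. -/
theorem antipodeConv_Δ {x : FPS (U K)} (hx : ε K x = 0) : antipodeConv K (Δ K x) = 0 := by
  have := (isTopHopf_U K).antipode_left x
  rwa [hx, map_zero] at this

theorem S_Z : S K (Z K) = -Z K := by
  have h := antipodeConv_Δ K (ε_Z K)
  rw [Δ_Z, map_add, antipodeConv_tens, antipodeConv_tens, (isAntiMap_S K).map_one, mul_one,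
    one_mul] at h
  exact eq_neg_of_add_eq_zero_left h

theorem S_σ : S K (σ K) = -σ K := by
  have h := antipodeConv_Δ K (ε_σ K)
  rw [Δ_σ, map_add, antipodeConv_tens, antipodeConv_tens, (isAntiMap_S K).map_one, mul_one,
    one_mul] at h
  exact eq_neg_of_add_eq_zero_left h

theorem S_eσ : S K (eσ K) = eσm K := by
  rw [eσ, (isAntiMap_S K).map_fexp (σ_mem_filt K), S_σ]; rfl

theorem S_eσm : S K (eσm K) = eσ K := by
  rw [eσm, (isAntiMap_S K).map_fexp (neg_mem (σ_mem_filt K)), map_neg, S_σ, neg_neg]; rfl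

theorem S_tdiv : S K (tdiv K) = tdivm K := by
  refine parH_cancel ?_
  rw [← (isAntiMap_S K).map_parH, parH_mul_tdiv, parH_mul_tdivm, map_sub, S_eσ,
    (isAntiMap_S K).map_one]

theorem eσ_commute_Xp : Commute (eσ K) (Xp K) := fexp_commute (σ_mem_filt K) (σ_commute_Xp K)

theorem S_Xp : S K (Xp K) = -(Xp K * eσ K) := by
  have h := antipodeConv_Δ K (ε_Xp K)
  rw [Δ_Xp, map_add, antipodeConv_tens, antipodeConv_tens, S_eσm, mul_one,
    (eσ_commute_Xp K).eq] at h
  exact eq_neg_of_add_eq_zero_left h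

theorem eq_mul_eσm {x y : FPS (U K)} (h : x * eσ K = y) : x = y * eσm K := by
  rw [← h, mul_assoc, eσ_mul_eσm, mul_one]

theorem S_H : S K (H K) = -(H K * eσm K) + parG * Z K * tdivm K := by
  have h := antipodeConv_Δ K (ε_H K)
  rw [Δ_H, map_sub, map_add, (isCts_antipodeConv K).map_parG, antipodeConv_tens, antipodeConv_tens,
    antipodeConv_tens, (isAntiMap_S K).map_one, one_mul, S_tdiv, sub_eq_zero] at h
  have h1 := eq_mul_eσm K (eq_sub_of_add_eq h)
  rw [h1, sub_mul, mul_assoc parG, mul_assoc (tdivm K), mul_assoc (Z K), eσ_mul_eσm, mul_one,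
    ← (Z_commute K (tdivm K)).eq, mul_assoc]
  abel

theorem tdivm_commute_eσm : Commute (tdivm K) (eσm K) := by
  refine parH_cancel ?_
  rw [← mul_assoc, ← mul_parH_mul, parH_mul_tdivm, sub_mul, mul_sub, one_mul, mul_one]

theorem H_mul_eσm : H K * eσm K = eσm K * H K + 2 * eσm K - 2 := by
  have h := congrArg (fun x => eσm K * x * eσm K) (H_mul_eσ K)
  simp only [mul_add, mul_sub, add_mul, sub_mul, two_mul] at h
  have e1 : eσm K * (H K * eσ K) * eσm K = eσm K * H K := by
    rw [mul_assoc, mul_assoc, eσ_mul_eσm, mul_one]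
  have e2 : eσm K * (eσ K * H K) * eσm K = H K * eσm K := by
    rw [← mul_assoc, eσm_mul_eσ, one_mul]
  have e3 : eσm K * (eσ K * eσ K) * eσm K = 1 := by
    rw [← mul_assoc, eσm_mul_eσ, one_mul, eσ_mul_eσm]
  have e4 : eσm K * eσ K * eσm K = eσm K := by rw [eσm_mul_eσ, one_mul]
  rw [e1, e2, e3, e4] at h
  rw [h, ← one_add_one_eq_two (R := FPS (U K)), add_mul, one_mul]
  abel

theorem H_mul_tdivm : H K * tdivm K = tdivm K * H K + 2 * tdivm K := by
  refine parH_cancel ?_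
  rw [mul_add, ← mul_parH_mul (H K), ← mul_parH_mul 2, ← mul_assoc parH (tdivm K), parH_mul_tdivm,
    mul_sub, H_mul_eσm, sub_mul, mul_sub, two_mul, two_mul, mul_one, one_mul,
    ← one_add_one_eq_two (R := FPS (U K))]
  abel

end GeneratorAntipodes

/-- The identity behind the formula for `S(X₋)`: the antipode axiom on the coproduct of `X₋`, with
`s = S(H)`, `e = e^σ`, `f = e^{-σ}` and `t = (e^{-σ} - 1) / h`. -/
theorem antipode_Xm_identity {K R : Type*} [Field K] [CharZero K] [Ring R] [Algebra K R]
    {h g Z H X e f t s : R} (hg : ∀ x, x * g = g * x)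
    (hZ : ∀ x, x * Z = Z * x) (hfe : f * e = 1) (ht : h * t = f - 1)
    (htf : f * t = t * f) (hHe : H * e = e * H + 2 * (e * e) - 2 * e)
    (hHf : H * f = f * H + 2 * f - 2) (hHt : H * t = t * H + 2 * t)
    (hs : s = -(H * f) + g * Z * t) :
    X + (1 / 2 : K) • (h * H ^ 2 * (f + 1)) - h * H * (f - 1) - g * H * Z * f + g * Z * (f - 1)
      + (1 / 2 : K) • (g ^ 2 * t * Z ^ 2) =
    X - h * (s * (e * H)) - (1 / 2 : K) • (h * (((s + 2) * s) * (e * (e - 1))))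
      + g * ((f - 1) * (Z * e * H)) + g * ((s - f + 1) * (Z * e))
      + g * (((s + f + 1) * (f - 1)) * (Z * e ^ 2)) - (1 / 2 : K) • (g ^ 2 * (t * (Z ^ 2 * e)))
      - (1 / 2 : K) • (g ^ 2 * ((t * (f - 1)) * (Z ^ 2 * e ^ 2))) := by
  have assoc : ∀ {a b : R}, a * b = b * a → ∀ x, a * (b * x) = b * (a * x) := fun hab x => by
    rw [← mul_assoc, hab, mul_assoc]
  have h11 : (2 : R) = 1 + 1 := one_add_one_eq_two.symm
  rw [h11] at hHf
  simp only [two_mul] at hHe hHf hHt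
  have hHe' : ∀ x, H * (e * x) = e * (H * x) + (e * (e * x) + e * (e * x)) - (e * x + e * x) :=
    fun x => by rw [← mul_assoc, hHe]; noncomm_ring
  have hHf' : ∀ x, H * (f * x) = f * (H * x) + (f * x + f * x) - (x + x) := fun x => by
    rw [← mul_assoc, hHf]; noncomm_ring
  have hfe' : ∀ x, f * (e * x) = x := fun x => by rw [← mul_assoc, hfe, one_mul]
  have ht' : ∀ x, h * (t * x) = f * x - x := fun x => by rw [← mul_assoc, ht]; noncomm_ring
  rw [hs]
  -- normal ordering: central factors `g, Z, h` first, then `t`, then `e` or `f`, then `H`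
  simp only [pow_two, mul_add, add_mul, mul_sub, sub_mul, mul_neg, neg_mul, two_mul, mul_one,
    one_mul, mul_assoc, assoc (hg Z), assoc (hg h), assoc (hg H), assoc (hg f), assoc (hg t), hZ H,
    hZ t, assoc (hZ h), assoc (hZ H), assoc (hZ f), assoc (hZ t), htf, assoc htf, hfe, hfe', ht,
    ht', hHe, hHf, hHt, hHe', hHf']
  module

section GeneratorAntipodes

variable (K : Type*) [Field K] [CharZero K]

theorem S_Xm : S K (Xm K) = -((Xm K + (1 / 2 : K) • (parH * H K ^ 2 * (eσm K + 1))
    - parH * H K * (eσm K - 1) - parG * H K * Z K * eσm K + parG * Z K * (eσm K - 1)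
    + (1 / 2 : K) • (parG ^ 2 * tdivm K * Z K ^ 2)) * eσm K) := by
  have h := antipodeConv_Δ K (ε_Xm K)
  have hS := isAntiMap_S K
  have hM := isCts_antipodeConv K
  have hM2 : ∀ x, antipodeConv K (parG ^ 2 * x) = parG ^ 2 * antipodeConv K x := fun x => by
    rw [pow_two, mul_assoc, hM.map_parG, hM.map_parG, ← mul_assoc, ← pow_two]
  have hS2 : S K 2 = 2 := by
    rw [← one_add_one_eq_two (R := FPS (U K)), map_add, hS.map_one]
  rw [Δ_Xm] at h
  simp only [map_add, map_sub, map_smul, hM.map_parG, hM.map_parH, hM2, antipodeConv_tens,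
    hS.map_mul, hS.map_one, hS2, S_eσ, S_tdiv] at h
  have key := antipode_Xm_identity (K := K) (X := Xm K) mul_parG (fun x => (Z_commute K x).symm)
    (eσm_mul_eσ K) (parH_mul_tdivm K) (tdivm_commute_eσm K).symm.eq
    (H_mul_eσ K) (H_mul_eσm K) (H_mul_tdivm K) (S_H K)
  rw [key, ← neg_mul]
  refine eq_mul_eσm K ?_
  rw [eq_neg_iff_add_eq_zero, ← h, one_mul]
  abel

theorem generatorFormulas : GeneratorFormulas K where
  H_Xp := by rw [H_mul_Xp]; abel
  H_Xm := by rw [H_mul_Xm]; noncomm_ring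
  Xp_Xm := by rw [Xp_mul_Xm]; abel
  Z_central x := (Z_commute K x).eq
  comul_Z := Δ_Z K
  comul_H := by
    rw [Δ_H, divH_one_sub_eσ, neg_tens, mul_neg, ← sub_eq_add_neg]
  comul_Xp := Δ_Xp K
  comul_Xm := by
    rw [divH_sq_eσ_sub_one]
    exact Δ_Xm K
  counit_Z := ε_Z K
  counit_H := ε_H K
  counit_Xp := ε_Xp K
  counit_Xm := ε_Xm K
  antipode_Z := S_Z K
  antipode_H := S_H K
  antipode_Xp := S_Xp K
  antipode_Xm := S_Xm K

end GeneratorAntipodes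

end JordanianTwist

end

noncomputable section

namespace JordanianTwist

/-! ### The Jordanian generators -/

section HalfExponentials

variable (K : Type*) [Field K] [CharZero K]

omit [CharZero K] in
theorem half_σ_mem_filt : (1 / 2 : K) • σ K ∈ filt (U K) 1 := smul_mem_filt _ (σ_mem_filt K)

omit [CharZero K] in
theorem parH_mul_jX : parH * jX K = (1 / 2 : K) • σ K := by
  rw [jX, mul_smul_comm]
  exact congrArg _ (parH_mul_sdiv K)

theorem fexp_parH_mul_jX : fexp K (parH * jX K) = eσh K := by rw [parH_mul_jX]; rfl

theorem fexp_neg_parH_mul_jX : fexp K (-(parH * jX K)) = eσmh K := by rw [parH_mul_jX]; rfl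

theorem eσh_mul_eσmh : eσh K * eσmh K = 1 := fexp_mul_fexp_neg (half_σ_mem_filt K)

theorem eσmh_mul_eσh : eσmh K * eσh K = 1 := fexp_neg_mul_fexp (half_σ_mem_filt K)

theorem eσh_mul_eσh : eσh K * eσh K = eσ K := by
  rw [eσh, ← fexp_add (half_σ_mem_filt K) (half_σ_mem_filt K) (Commute.refl _), eσ]
  congr 1
  module

theorem eσmh_mul_eσmh : eσmh K * eσmh K = eσm K := by
  have h := neg_mem (half_σ_mem_filt K)
  rw [eσmh, ← fexp_add h h (Commute.refl _), eσm]
  congr 1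
  module

theorem eσh_commute {x : FPS (U K)} (h : Commute (σ K) x) : Commute (eσh K) x :=
  fexp_commute (half_σ_mem_filt K) (h.smul_left _)

theorem eσmh_commute {x : FPS (U K)} (h : Commute (σ K) x) : Commute (eσmh K) x :=
  fexp_commute (neg_mem (half_σ_mem_filt K)) (h.smul_left _).neg_left

theorem half_σ_mul_H : ((1 / 2 : K) • σ K) * H K = H K * ((1 / 2 : K) • σ K) + -(eσ K - 1) := by
  rw [smul_mul_assoc, σ_mul_H, mul_smul_comm, two_mul]
  module

theorem H_mul_eσh : H K * eσh K = eσh K * H K + (eσh K * eσh K * eσh K - eσh K) := by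
  have h := fexp_mul_of_commutator (K := K) (half_σ_mem_filt K) (half_σ_mul_H K)
    ((((eσ_commute_σ K).sub_left (Commute.one_left _)).neg_left.smul_right _).symm.eq)
  change eσh K * H K = _ * eσh K at h
  rw [h, eσh_mul_eσh]
  noncomm_ring

theorem H_mul_eσmh : H K * eσmh K = eσmh K * H K + (eσmh K - eσh K) := by
  have h := congrArg (fun x => eσmh K * x * eσmh K) (H_mul_eσh K)
  simp only [mul_add, mul_sub, add_mul, sub_mul] at h
  have h1 := eσh_mul_eσmh K
  have h2 := eσmh_mul_eσh K
  rw [mul_assoc (eσmh K) (H K * eσh K), mul_assoc (H K), h1, mul_one,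
    ← mul_assoc (eσmh K) (eσh K) (H K), h2, one_mul, mul_assoc (eσh K) (eσh K),
    ← mul_assoc (eσmh K) (eσh K), h2, one_mul, mul_assoc (eσh K), h1,
    mul_one, one_mul] at h
  rw [h]
  abel

theorem half_σ_mul_Xm : ((1 / 2 : K) • σ K) * Xm K =
    Xm K * ((1 / 2 : K) • σ K) + parH * (H K * eσ K - (eσ K - 1) * eσ K) := by
  rw [smul_mul_assoc, σ_mul_Xm, mul_smul_comm, mul_assoc 2, two_mul]
  module

theorem Xm_mul_eσmh : Xm K * eσmh K = eσmh K * Xm K + parH * (eσh K * H K)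
    + (1 / 2 : K) • (parH * (eσh K * eσh K * eσh K - eσh K)) := by
  have hz := half_σ_mul_Xm K
  have hc := eσ_commute_σ K
  have hM := mul_Xm_bracket (σ_mul_H K) hc.symm
  have hW := (((hc.sub_left (Commute.one_left _)).mul_left hc)).eq
  have h := fexp_mul_of_commutators (K := K) (x := -((1 / 2 : K) • σ K)) (y := Xm K)
    (z := -(parH * (H K * eσ K - (eσ K - 1) * eσ K))) (w := -(parH * ((eσ K - 1) * eσ K)))
    (neg_mem (half_σ_mem_filt K)) (by rw [neg_mul, hz, mul_neg]; abel)
    (by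
      generalize H K * eσ K - (eσ K - 1) * eσ K = M at hM ⊢
      simp only [neg_mul, mul_neg, smul_mul_assoc, mul_smul_comm, mul_parH_mul, hM,
        mul_sub, two_mul, mul_add, mul_assoc]
      module)
    (by
      generalize (eσ K - 1) * eσ K = M at hW ⊢
      simp only [neg_mul_neg, smul_mul_assoc, mul_smul_comm, mul_parH_mul, hW, mul_assoc])
  change eσmh K * Xm K = _ * eσmh K at h
  have he : eσ K * eσmh K = eσh K := by
    rw [← eσh_mul_eσh, mul_assoc, eσh_mul_eσmh, mul_one]
  rw [h, ← eσh_mul_eσh]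
  rw [← eσh_mul_eσh] at he
  have he' := he
  rw [mul_assoc] at he'
  simp only [add_mul, sub_mul, mul_add, mul_sub, neg_mul, smul_mul_assoc, mul_assoc, he', one_mul,
    H_mul_eσh, smul_neg, smul_sub]
  module

theorem fsinh_parH_mul_jX : fsinh K (parH * jX K) = (1 / 2 : K) • (eσh K - eσmh K) := by
  rw [fsinh, fexp_parH_mul_jX, fexp_neg_parH_mul_jX]

theorem fcosh_parH_mul_jX : fcosh K (parH * jX K) = (1 / 2 : K) • (eσh K + eσmh K) := by
  rw [fcosh, fexp_parH_mul_jX, fexp_neg_parH_mul_jX]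

theorem parH_mul_divH_fsinh {A : Type*} [Ring A] [Algebra K A] (x : FPS A) :
    parH * divH (fsinh K (parH * x)) = fsinh K (parH * x) := by
  have h1 := parH_mul_divH_fexp_sub_one K x
  have h2 := parH_mul_divH_fexp_sub_one K (-x)
  rw [mul_neg] at h2
  have h : fsinh K (parH * x) = parH * ((1 / 2 : K) • (divH (fexp K (parH * x) - 1)
      - divH (fexp K (-(parH * x)) - 1))) := by
    rw [mul_smul_comm, mul_sub, h1, h2, fsinh, sub_sub_sub_cancel_right]
  rw [h, divH_parH_mul]

theorem parH_mul_divH_fsinh_jX :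
    parH * divH (fsinh K (parH * jX K)) = (1 / 2 : K) • (eσh K - eσmh K) := by
  rw [parH_mul_divH_fsinh, fsinh_parH_mul_jX]

theorem eσmh_mul_tdiv : eσmh K * tdiv K = (2 : K) • divH (fsinh K (parH * jX K)) := by
  refine parH_cancel ?_
  rw [← mul_parH_mul, parH_mul_tdiv, mul_smul_comm, parH_mul_divH_fsinh_jX, mul_sub, mul_one,
    ← eσh_mul_eσh, ← mul_assoc, eσmh_mul_eσh, one_mul]
  module

theorem tdivm_mul_eσh : tdivm K * eσh K = -((2 : K) • divH (fsinh K (parH * jX K))) := by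
  refine parH_cancel ?_
  rw [← mul_assoc, parH_mul_tdivm, mul_neg, mul_smul_comm, parH_mul_divH_fsinh_jX, sub_mul, one_mul,
    ← eσmh_mul_eσmh, mul_assoc, eσmh_mul_eσh, mul_one]
  module

theorem divisibility : Divisibility K where
  sigma := parH_mul_sdiv K
  exp_sub_one := parH_mul_tdiv K
  exp_neg_sub_one := parH_mul_tdivm K
  sinh := parH_mul_divH_fsinh K _
  sinh_free := parH_mul_divH_fsinh K _

theorem Δ_half_σ : Δ K ((1 / 2 : K) • σ K) =
    ((1 / 2 : K) • σ K) ⊠[K] 1 + 1 ⊠[K] ((1 / 2 : K) • σ K) := by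
  rw [map_smul, Δ_σ, smul_add, smul_tens, tens_smul]

theorem fexp_tens_one_add_one_tens {x : FPS (U K)} (hx : x ∈ filt (U K) 1) :
    fexp K (x ⊠[K] 1 + 1 ⊠[K] x) = fexp K x ⊠[K] fexp K x := by
  rw [fexp_add (tens_mem_filt_left hx _) (tens_mem_filt_right _ hx) (tens_comm_one K _ _),
    ← left_eq, ← right_eq, ← isAlgMap_left.map_fexp hx, ← isAlgMap_right.map_fexp hx, ← tens_eq]

theorem Δ_eσh : Δ K (eσh K) = eσh K ⊠[K] eσh K := by
  rw [eσh, (isAlgMap_Δ K).map_fexp (half_σ_mem_filt K), Δ_half_σ,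
    fexp_tens_one_add_one_tens K (half_σ_mem_filt K)]

theorem Δ_eσmh : Δ K (eσmh K) = eσmh K ⊠[K] eσmh K := by
  have h := neg_mem (half_σ_mem_filt K)
  rw [eσmh, (isAlgMap_Δ K).map_fexp h, map_neg, Δ_half_σ, ← fexp_tens_one_add_one_tens K h,
    neg_tens, tens_neg, neg_add]

theorem S_eσh : S K (eσh K) = eσmh K := by
  rw [eσh, (isAntiMap_S K).map_fexp (half_σ_mem_filt K), map_smul, S_σ, smul_neg]; rfl

theorem S_eσmh : S K (eσmh K) = eσh K := by
  rw [eσmh, (isAntiMap_S K).map_fexp (neg_mem (half_σ_mem_filt K)), map_neg, map_smul, S_σ,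
    smul_neg, neg_neg]; rfl

end HalfExponentials

end JordanianTwist

end

noncomputable section

namespace JordanianTwist

/-! ### Relations, coproduct and antipode of the Jordanian generators -/

/-- The commutation relations between `p = e^{σ/2}`, `q = e^{-σ/2}`, `H`, `X₋` and the central
`h`, from which the identities between words in these elements follow by normal ordering: `h`
first, then powers of `p` or `q`, then powers of `H`, then `X₋`. -/
structure HalfRelations {K R : Type*} [Field K] [Ring R] [Algebra K R] (h p q H X : R) :
    Prop where
  central : ∀ x, x * h = h * x
  pq : p * q = 1
  qp : q * p = 1
  Hp : H * p = p * H + (p * p * p - p)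
  Hq : H * q = q * H + (q - p)
  XH : X * H = H * X + (X + X)
  Xq : X * q = q * X + h * (p * H) + (1 / 2 : K) • (h * (p * p * p - p))

namespace HalfRelations

variable {K R : Type*} [Field K] [Ring R] [Algebra K R] {h p q H X : R}
  (r : HalfRelations (K := K) h p q H X)
include r

theorem h_left (a x : R) : a * (h * x) = h * (a * x) := by
  rw [← mul_assoc, r.central, mul_assoc]

theorem pq_mul (x : R) : p * (q * x) = x := by rw [← mul_assoc, r.pq, one_mul]

theorem qp_mul (x : R) : q * (p * x) = x := by rw [← mul_assoc, r.qp, one_mul]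

theorem Hp_mul (x : R) : H * (p * x) = p * (H * x) + (p * (p * (p * x)) - p * x) := by
  rw [← mul_assoc, r.Hp]; noncomm_ring

theorem Hq_mul (x : R) : H * (q * x) = q * (H * x) + (q * x - p * x) := by
  rw [← mul_assoc, r.Hq]; noncomm_ring

theorem Xq_mul (x : R) : X * (q * x) = q * (X * x) + h * (p * (H * x)) +
    (1 / 2 : K) • (h * (p * (p * (p * x)) - p * x)) := by
  rw [← mul_assoc, r.Xq]
  simp only [add_mul, sub_mul, smul_mul_assoc, mul_assoc]

variable [CharZero K]

theorem Xp : X * p = p * X - h * (p * (p * (p * H)) + p * (p * (p * (p * p))) - p * (p * p)) -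
    (1 / 2 : K) • (h * (p * (p * (p * (p * p))) - p * (p * p))) := by
  have := congrArg (fun x => p * x * p) r.Xq
  simp only [mul_add, add_mul, mul_sub, sub_mul, smul_mul_assoc, mul_smul_comm, mul_assoc,
    r.pq_mul, r.qp, mul_one, r.h_left, r.Hp] at this
  rw [this]
  simp only [mul_sub, mul_add]
  module

/-- `[H', Y] = -Y cosh hX - cosh hX Y`. -/
theorem bracket_H_Y :
    (q * H) * (q * (X + (1 / 2 : K) • (h * H ^ 2)) - (1 / 8 : K) • (h * p * (q * q - 1))) -
    (q * (X + (1 / 2 : K) • (h * H ^ 2)) - (1 / 8 : K) • (h * p * (q * q - 1))) * (q * H) =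
    -((q * (X + (1 / 2 : K) • (h * H ^ 2)) - (1 / 8 : K) • (h * p * (q * q - 1))) *
      ((1 / 2 : K) • (p + q))) -
    ((1 / 2 : K) • (p + q)) *
      (q * (X + (1 / 2 : K) • (h * H ^ 2)) - (1 / 8 : K) • (h * p * (q * q - 1))) := by
  simp only [pow_two, mul_add, add_mul, mul_sub, sub_mul, mul_one,
    mul_assoc, smul_mul_assoc, mul_smul_comm, smul_add, smul_sub, smul_smul, r.h_left,
    r.pq, r.qp, r.Hp, r.Hq, r.XH, r.Xq, r.pq_mul, r.qp_mul, r.Hp_mul, r.Hq_mul,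
    r.Xq_mul, r.Xp]
  module

/-- `[X, Y] = H'`, with `x = σ / (2h)` and `t = (e^σ - 1) / h`. -/
theorem bracket_X_Y {x t : R} (hq : x * q = q * x) (hp : x * p = p * x) (hH : x * H = H * x - t)
    (hX : x * X = X * x + (H * (p * p) - (p * p - 1) * (p * p))) (ht : h * t = p * p - 1)
    (hqt : q * t = t * q) (hHt : H * t = t * H + 2 * (t * (p * p))) :
    x * (q * (X + (1 / 2 : K) • (h * H ^ 2)) - (1 / 8 : K) • (h * p * (q * q - 1))) -
      (q * (X + (1 / 2 : K) • (h * H ^ 2)) - (1 / 8 : K) • (h * p * (q * q - 1))) * x = q * H := by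
  have hq' : ∀ y, x * (q * y) = q * (x * y) := fun y => by rw [← mul_assoc, hq, mul_assoc]
  have hp' : ∀ y, x * (p * y) = p * (x * y) := fun y => by rw [← mul_assoc, hp, mul_assoc]
  have hqt' : ∀ y, q * (t * y) = t * (q * y) := fun y => by rw [← mul_assoc, hqt, mul_assoc]
  have hH' : ∀ y, x * (H * y) = H * (x * y) - t * y := fun y => by
    rw [← mul_assoc, hH, sub_mul, mul_assoc]
  have ht' : ∀ y, h * (t * y) = p * (p * y) - y := fun y => by rw [← mul_assoc, ht]; noncomm_ring
  simp only [pow_two, mul_add, add_mul, mul_sub, sub_mul, mul_one, one_mul, two_mul, mul_assoc,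
    smul_mul_assoc, mul_smul_comm, smul_add, smul_sub, r.h_left, r.Hp, r.pq_mul,
    r.qp_mul, r.Hp_mul, hq, hq', hp, hqt', hH, hH', hX, ht', hHt]
  module

/-- The identity behind the formula for `S(Y)`, with `s = S(H)` and `t = (e^{-σ} - 1) / h`. -/
theorem antipode_Y {g Z t s : R} (hg : ∀ x, x * g = g * x) (hZ : ∀ x, x * Z = Z * x)
    (ht : h * t = q * q - 1) (hqt : q * t = t * q)
    (hHt : H * t = t * H + 2 * t) (hs : s = -(H * (q * q)) + g * Z * t) :
    (-((X + (1 / 2 : K) • (h * H ^ 2 * (q * q + 1))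
    - h * H * (q * q - 1) - g * H * Z * (q * q) + g * Z * (q * q - 1)
    + (1 / 2 : K) • (g ^ 2 * t * Z ^ 2)) * (q * q)) + (1 / 2 : K) • (h * s ^ 2)) * p
      - (1 / 8 : K) • (h * ((p * p - 1) * q)) =
    -(p * (q * (X + (1 / 2 : K) • (h * H ^ 2)) - (1 / 8 : K) • (h * p * (q * q - 1))) * q)
    + g ^ 2 * (-((1 / 2 : K) • (t * p))) * Z ^ 2
    + g * p * (q * H) * Z * q := by
  have assoc : ∀ {a b : R}, a * b = b * a → ∀ x, a * (b * x) = b * (a * x) := fun hab x => by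
    rw [← mul_assoc, hab, mul_assoc]
  have hHt' : ∀ x, H * (t * x) = t * (H * x) + (t * x + t * x) := fun x => by
    rw [← mul_assoc, hHt]; noncomm_ring
  have ht' : ∀ x, h * (t * x) = q * (q * x) - x := fun x => by rw [← mul_assoc, ht]; noncomm_ring
  have h1 : h * s ^ 2 = -(h * (H * (q * q) * s)) + g * (Z * ((q * q - 1) * s)) := by
    have e : h * s = -(h * (H * (q * q))) + g * (Z * (q * q - 1)) := by
      rw [hs, mul_add, mul_neg, ← ht, r.h_left Z, r.h_left g, mul_assoc g]
    rw [pow_two, ← mul_assoc, e]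
    simp only [add_mul, neg_mul, mul_assoc]
  rw [h1, hs]
  simp only [pow_two, mul_add, add_mul, mul_sub, sub_mul, mul_neg, neg_mul, mul_one, one_mul,
    two_mul, mul_assoc, smul_mul_assoc, mul_smul_comm, smul_add, smul_sub, r.h_left,
    r.pq, r.qp, r.Hp, r.Hq, r.Xq, r.pq_mul, r.qp_mul, r.Hp_mul, r.Hq_mul,
    r.Xq_mul, r.Xp, ht, ht', hqt, assoc hqt, hHt,
    assoc (hg Z), assoc (hg h), assoc (hg H), assoc (hg q),
    hZ H, hZ p, hZ t, assoc (hZ h), assoc (hZ H), assoc (hZ q), assoc (hZ p), assoc (hZ t)]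
  module

end HalfRelations

end JordanianTwist

end

noncomputable section

namespace JordanianTwist

section JordanianFormulas

variable (K : Type*) [Field K] [CharZero K]

omit [CharZero K] in
theorem Xm_mul_H : Xm K * H K = H K * Xm K + (Xm K + Xm K) := by
  rw [H_mul_Xm, two_mul]; abel

theorem halfRelations :
    HalfRelations (K := K) parH (eσh K) (eσmh K) (H K) (Xm K) where
  central := mul_parH
  pq := eσh_mul_eσmh K
  qp := eσmh_mul_eσh K
  Hp := H_mul_eσh K
  Hq := H_mul_eσmh K
  XH := Xm_mul_H K
  Xq := Xm_mul_eσmh K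

theorem jY_eq : jY K = eσmh K * (Xm K + (1 / 2 : K) • (parH * H K ^ 2)) -
    (1 / 8 : K) • (parH * eσh K * (eσmh K * eσmh K - 1)) := by
  rw [jY, eσmh_mul_eσmh]

omit [CharZero K] in
theorem commute_jX {x : FPS (U K)} (h : Commute (σ K) x) : Commute (jX K) x :=
  (commute_sdiv_of_commute_σ K h).smul_left _

theorem eσh_commute_σ : Commute (eσh K) (σ K) := eσh_commute K (Commute.refl _)

theorem eσmh_commute_σ : Commute (eσmh K) (σ K) := eσmh_commute K (Commute.refl _)

theorem jX_mul_H : jX K * H K = H K * jX K - tdiv K := by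
  change ((1 / 2 : K) • sdiv K) * H K = H K * ((1 / 2 : K) • sdiv K) - tdiv K
  rw [smul_mul_assoc, sdiv_mul_H, mul_smul_comm, two_mul]
  module

theorem jX_mul_Xm : jX K * Xm K = Xm K * jX K + (H K * eσ K - (eσ K - 1) * eσ K) := by
  change ((1 / 2 : K) • sdiv K) * Xm K = Xm K * ((1 / 2 : K) • sdiv K) + _
  rw [smul_mul_assoc, sdiv_mul_Xm, mul_smul_comm, two_mul]
  module

theorem H_mul_tdiv : H K * tdiv K = tdiv K * H K + 2 * (tdiv K * eσ K) := by
  refine parH_cancel ?_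
  rw [mul_add, ← mul_parH_mul (H K), ← mul_parH_mul 2, ← mul_assoc parH (tdiv K),
    ← mul_assoc parH (tdiv K), parH_mul_tdiv, mul_sub, H_mul_eσ]
  noncomm_ring

theorem jordanian_X_Y : jX K * jY K - jY K * jX K = jH K := by
  have ht : parH * tdiv K = eσh K * eσh K - 1 := by rw [parH_mul_tdiv, eσh_mul_eσh]
  rw [jY_eq, jH]
  exact (halfRelations K).bracket_X_Y (commute_jX K (eσmh_commute_σ K).symm).eq
    (commute_jX K (eσh_commute_σ K).symm).eq (jX_mul_H K) (by rw [jX_mul_Xm, eσh_mul_eσh]) ht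
    (commute_tdiv_of_commute_eσ K (eσmh_commute K (eσ_commute_σ K).symm).symm).symm.eq
    (by rw [eσh_mul_eσh, H_mul_tdiv])

theorem jordanian_H_X :
    jH K * jX K - jX K * jH K = 2 * divH (fsinh K (parH * jX K)) := by
  have hq := (commute_jX K (eσmh_commute_σ K).symm).eq
  rw [jH, ← mul_assoc, hq, mul_assoc, mul_assoc, ← mul_sub, jX_mul_H, sub_sub_cancel,
    eσmh_mul_tdiv, two_smul, two_mul]

theorem jordanian_H_Y : jH K * jY K - jY K * jH K
    = -(jY K * fcosh K (parH * jX K)) - fcosh K (parH * jX K) * jY K := by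
  rw [fcosh_parH_mul_jX, jY_eq, jH]
  exact (halfRelations K).bracket_H_Y

theorem Δ_jX : Δ K (jX K) = jX K ⊠[K] 1 + 1 ⊠[K] jX K := by
  refine parH_cancel ?_
  rw [← (isAlgMap_Δ K).map_parH, parH_mul_jX, Δ_half_σ, mul_add, ← parH_tens, ← tens_parH,
    parH_mul_jX]

theorem eσmh_mul_eσ : eσmh K * eσ K = eσh K := by
  rw [← eσh_mul_eσh, ← mul_assoc, eσmh_mul_eσh, one_mul]

theorem Δ_jH : Δ K (jH K) = jH K ⊠[K] eσh K + eσmh K ⊠[K] jH K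
    - 2 * parG * (divH (fsinh K (parH * jX K)) ⊠[K] (jA K * eσh K)) := by
  rw [jH, (isAlgMap_Δ K).map_mul, Δ_eσmh, Δ_H, mul_sub, mul_add, mul_parG_mul, tens_mul_tens,
    tens_mul_tens, tens_mul_tens, mul_one, eσmh_mul_eσ, ← mul_assoc (eσmh K) (Z K),
    ← (Z_commute K (eσmh K)).eq, mul_assoc (Z K), eσmh_mul_eσ, eσmh_mul_tdiv, smul_tens, two_smul,
    mul_assoc, two_mul, mul_add]
  rfl

theorem parH_mul_Δ_H_sq : parH * Δ K (H K) ^ 2 =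
    parH * (H K ⊠[K] eσ K + 1 ⊠[K] H K) ^ 2 -
    parG * ((H K ⊠[K] eσ K + 1 ⊠[K] H K) * ((eσ K - 1) ⊠[K] (Z K * eσ K))) -
    parG * (((eσ K - 1) ⊠[K] (Z K * eσ K)) * (H K ⊠[K] eσ K + 1 ⊠[K] H K)) +
    parG ^ 2 * (((eσ K - 1) * tdiv K) ⊠[K] ((Z K * eσ K) * (Z K * eσ K))) := by
  rw [Δ_H, ← tens_mul_tens, ← parH_mul_tdiv, parH_tens]
  generalize H K ⊠[K] eσ K + 1 ⊠[K] H K = a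
  generalize tdiv K ⊠[K] (Z K * eσ K) = b
  simp only [pow_two, mul_sub, sub_mul, mul_assoc, mul_parG_mul a, mul_parG_mul b,
    mul_parG_mul parH, mul_parH_mul a]
  abel

/-- Up to the factor `e^{-σ/2}` and a term in `e^{±σ/2}`, this is the coproduct of `Y`. -/
theorem Δ_Xm_add : Δ K (Xm K + (1 / 2 : K) • (parH * H K ^ 2)) =
    (Xm K + (1 / 2 : K) • (parH * H K ^ 2)) ⊠[K] eσ K +
      1 ⊠[K] (Xm K + (1 / 2 : K) • (parH * H K ^ 2)) + parG * (H K ⊠[K] (Z K * eσ K)) -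
      (1 / 2 : K) • (parG ^ 2 * (tdiv K ⊠[K] (Z K ^ 2 * eσ K))) := by
  have hΔ := isAlgMap_Δ K
  have hsq : Δ K (H K ^ 2) = Δ K (H K) ^ 2 := hΔ.map_pow _ _
  have hHe := H_mul_eσ K
  have hZ : ∀ x, x * Z K = Z K * x := fun x => (Z_commute K x).symm.eq
  have hZ' : ∀ x y, x * (Z K * y) = Z K * (x * y) := fun x y => by
    rw [← mul_assoc, hZ, mul_assoc]
  rw [map_add, map_smul, hΔ.map_parH, hsq, parH_mul_Δ_H_sq, Δ_Xm]
  simp only [pow_two, mul_add, mul_sub, add_mul, sub_mul, mul_one, one_mul, mul_assoc, hHe, two_mul,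
    mul_two, add_tens, tens_add, sub_tens, tens_sub, smul_add, smul_sub, smul_tens, tens_smul,
    parH_tens, tens_parH, tens_mul_tens, hZ' (eσ K), hZ' (H K)]
  module

theorem Δ_jY : Δ K (jY K) = jY K ⊠[K] eσh K + eσmh K ⊠[K] jY K
    - parG ^ 2 * (divH (fsinh K (parH * jX K)) ⊠[K] (jA K ^ 2 * eσh K))
    + parG * (jH K ⊠[K] (jA K * eσh K)) := by
  have hΔ := isAlgMap_Δ K
  have hτ : divH (fsinh K (parH * jX K)) = (1 / 2 : K) • (eσmh K * tdiv K) := by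
    rw [eσmh_mul_tdiv]; module
  have hqZ : ∀ x, eσmh K * (Z K * x) = Z K * (eσmh K * x) := fun x => by
    rw [← mul_assoc, ← (Z_commute K _).eq, mul_assoc]
  have hG : ∀ a b : FPS (U K), ∀ y, (a ⊠[K] b) * (parG * y) = parG * ((a ⊠[K] b) * y) :=
    fun a b => mul_parG_mul _
  have e : parH * eσh K * (eσmh K * eσmh K - 1) = parH * (eσmh K - eσh K) := by
    rw [mul_assoc, mul_sub, ← mul_assoc (eσh K), eσh_mul_eσmh, one_mul, mul_one]
  rw [hτ, jY_eq, jH, jA, e, map_sub, map_smul, hΔ.map_mul, hΔ.map_parH, Δ_Xm_add, map_sub, Δ_eσmh,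
    Δ_eσh]
  generalize Xm K + (1 / 2 : K) • (parH * H K ^ 2) = y
  simp only [pow_two, mul_add, mul_sub, mul_one, mul_assoc, mul_smul_comm, sub_tens, smul_tens,
    tens_sub, tens_smul, parH_tens, tens_parH, tens_mul_tens, hG, hqZ, eσmh_mul_eσ, smul_sub]
  module

theorem S_jX : S K (jX K) = -jX K := by
  refine parH_cancel ?_
  rw [← (isAntiMap_S K).map_parH, parH_mul_jX, map_smul, S_σ, mul_neg, parH_mul_jX, smul_neg]

theorem S_jH : S K (jH K) = -(eσh K * jH K * eσmh K)
    - 2 * parG * divH (fsinh K (parH * jX K)) * jA K := by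
  have hp : eσm K * eσh K = eσmh K := by
    rw [← eσmh_mul_eσmh, mul_assoc, eσmh_mul_eσh, mul_one]
  rw [jH, (isAntiMap_S K).map_mul, S_eσmh, S_H, add_mul, neg_mul, mul_assoc (H K), hp, mul_assoc,
    tdivm_mul_eσh, ← mul_assoc (eσh K), eσh_mul_eσmh, one_mul, two_smul, mul_neg, ← sub_eq_add_neg,
    mul_assoc parG, (Z_commute K _).eq, two_mul, add_mul, add_mul, mul_add, add_mul, mul_assoc parG]
  rfl

theorem S_jY : S K (jY K) = -(eσh K * jY K * eσmh K)
    + parG ^ 2 * divH (fsinh K (parH * jX K)) * jA K ^ 2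
    + parG * eσh K * jH K * jA K * eσmh K := by
  have hS := isAntiMap_S K
  have hτ : divH (fsinh K (parH * jX K)) = -((1 / 2 : K) • (tdivm K * eσh K)) := by
    rw [tdivm_mul_eσh]; module
  have ht : parH * tdivm K = eσmh K * eσmh K - 1 := by rw [parH_mul_tdivm, eσmh_mul_eσmh]
  have hq : Commute (tdivm K) (eσmh K) := by
    refine parH_cancel ?_
    rw [← mul_assoc, ← mul_parH_mul, ht]; noncomm_ring
  have hsq : S K (H K ^ 2) = S K (H K) ^ 2 := hS.map_pow _ _
  have key := (halfRelations K).antipode_Y (s := S K (H K)) mul_parG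
    (fun x => (Z_commute K x).symm.eq) ht hq.symm.eq (H_mul_tdivm K)
    (by rw [S_H, eσmh_mul_eσmh])
  rw [hτ, jH, jA, jY_eq, ← key, map_sub, map_smul, hS.map_mul, map_add, map_smul, hS.map_parH, hsq,
    S_Xm, S_eσmh, mul_assoc parH (eσh K), hS.map_parH, hS.map_mul, map_sub, hS.map_mul, hS.map_one,
    S_eσmh, S_eσh, eσmh_mul_eσmh]

end JordanianFormulas

end JordanianTwist

end

noncomputable section

namespace JordanianTwist

section JordanianFormulas

variable (K : Type*) [Field K] [CharZero K]

omit [CharZero K] in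
theorem ε_jX : ε K (jX K) = 0 := by
  rw [jX, map_smul]
  exact (congrArg _ (ε_sdiv K)).trans (smul_zero _)

theorem ε_eσmh : ε K (eσmh K) = 1 := by
  rw [eσmh, (isAlgMap_ε K).map_fexp (neg_mem (half_σ_mem_filt K)), map_neg, map_smul, ε_σ,
    smul_zero, neg_zero, fexp_zero]

theorem ε_jH : ε K (jH K) = 0 := by rw [jH, (isAlgMap_ε K).map_mul, ε_H, mul_zero]

theorem ε_jY : ε K (jY K) = 0 := by
  have hε := isAlgMap_ε K
  rw [jY_eq, map_sub, hε.map_mul, map_add, map_smul, map_smul, hε.map_parH, hε.map_mul, map_sub,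
    hε.map_mul, hε.map_pow, ε_H, ε_Xm, hε.map_one]
  simp [hε.map_mul, ε_eσmh]

theorem jordanianFormulas : JordanianFormulas K where
  X_Y := jordanian_X_Y K
  H_X := jordanian_H_X K
  H_Y := jordanian_H_Y K
  A_central x := (Z_commute K x).eq
  comul_A := Δ_Z K
  comul_H := by rw [fexp_neg_parH_mul_jX, Δ_jH, fexp_parH_mul_jX]
  comul_X := Δ_jX K
  comul_Y := by rw [fexp_neg_parH_mul_jX, Δ_jY, fexp_parH_mul_jX]
  counit_A := ε_Z K
  counit_H := ε_jH K
  counit_X := ε_jX K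
  counit_Y := ε_jY K
  antipode_A := S_Z K
  antipode_X := S_jX K
  antipode_H := by rw [fexp_neg_parH_mul_jX, S_jH, fexp_parH_mul_jX]
  antipode_Y := by rw [fexp_neg_parH_mul_jX, S_jY, fexp_parH_mul_jX]

end JordanianFormulas

end JordanianTwist

end

noncomputable section

namespace JordanianTwist

open MvPowerSeries (coeff monomial)

/-! ### Successive approximation for continuous maps -/

section Approximation

variable {K : Type*} [Field K] {A B : Type*} [Ring A] [Algebra K A] [Ring B] [Algebra K B]

/-- The terms of lowest degree of `f x` are the images, under the map `f₀` induced by `f` modulo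
`(h, g)`, of the terms of lowest degree of `x`. -/
theorem IsCts.coeff_of_mem_filt {f : FPS A →ₗ[K] FPS B} (hf : IsCts f) {f₀ : A →ₗ[K] B}
    (h0 : ∀ a, coeff 0 (f (const a)) = f₀ a) {x : FPS A} {d : Fin 2 →₀ ℕ}
    (hx : x ∈ filt A d.degree) : coeff d (f x) = f₀ (coeff d x) := by
  classical
  rw [hf.eq_extend, coeff_extend, Finset.sum_eq_single (d, 0)]
  · exact h0 _
  · intro p hp hne
    rw [Finset.HasAntidiagonal.mem_antidiagonal] at hp
    have hlt : p.1.degree < d.degree := by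
      rcases Nat.lt_or_ge p.1.degree d.degree with h | h
      · exact h
      · exfalso
        have h1 : p.1.degree + p.2.degree = d.degree := by rw [← hp, map_add]
        have h2 : p.2 = 0 := (Finsupp.degree_eq_zero_iff _).1 (by omega)
        exact hne (Prod.ext (by simpa [h2] using hp) h2)
    rw [hx _ hlt, map_zero, map_zero]
  · intro h
    exact absurd (Finset.HasAntidiagonal.mem_antidiagonal.2 (add_zero d)) h

/-- A continuous map that is surjective modulo `(h, g)` is surjective. -/
theorem IsCts.surjective {f : FPS A →ₗ[K] FPS B} (hf : IsCts f) {f₀ : A →ₗ[K] B}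
    (h0 : ∀ a, coeff 0 (f (const a)) = f₀ a) (hs : Function.Surjective f₀) :
    Function.Surjective f := by
  classical
  obtain ⟨s, hs⟩ := f₀.exists_rightInverse_of_surjective (LinearMap.range_eq_top.2 hs)
  have hfs : IsCts (f ∘ₗ mapL s) := hf.comp (isCts_mapL s)
  -- `T = id - f ∘ s` raises the filtration degree, so that `f ∘ s = id - T` is inverted by the
  -- Neumann series of `T`
  have hT : ∀ {n : ℕ} {x : FPS B}, x ∈ filt B n → x - f (mapL s x) ∈ filt B (n + 1) := by
    intro n x hx d hd
    have hx' : x ∈ filt B d.degree := filt_anti (by omega) hx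
    have h1 := hfs.coeff_of_mem_filt (f₀ := LinearMap.id) (fun b => by
      rw [LinearMap.comp_apply, mapL_const, h0]
      exact LinearMap.congr_fun hs b) hx'
    rw [map_sub, sub_eq_zero]
    exact h1.symm
  intro b
  let T : FPS B → FPS B := fun x => x - f (mapL s x)
  have hTn : ∀ n, T^[n] b ∈ filt B n := fun n => by
    induction n with
    | zero => exact mem_filt_zero _
    | succ n ih => rw [Function.iterate_succ_apply']; exact hT ih
  let y : FPS B := fun d => coeff d (∑ k ∈ Finset.range (d.degree + 1), T^[k] b)
  have hy : ∀ N, y - ∑ k ∈ Finset.range N, T^[k] b ∈ filt B N := fun N d hd => by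
    have e : coeff d y = coeff d (∑ k ∈ Finset.range (d.degree + 1), T^[k] b) := rfl
    rw [map_sub, e, sub_eq_zero, map_sum, map_sum]
    refine Finset.sum_subset (Finset.range_subset_range.2 hd) fun k _ hk => ?_
    exact hTn k d (by simpa using hk)
  have hsum : ∀ N, f (mapL s (∑ k ∈ Finset.range N, T^[k] b)) = b - T^[N] b := fun N => by
    induction N with
    | zero => simp
    | succ N ih =>
      rw [Finset.sum_range_succ, map_add, map_add, ih, Function.iterate_succ_apply']
      change _ = b - (T^[N] b - f (mapL s (T^[N] b)))
      abel
  refine ⟨mapL s y, eq_of_forall_sub_mem_filt fun N => ?_⟩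
  have h1 := sub_mem (hfs.map_filt (hy N)) (hTn N)
  rw [LinearMap.comp_apply, map_sub, map_sub, hsum] at h1
  convert h1 using 1
  abel

/-- Let `I` be an ideal annihilated by `f`. If every element of the kernel of `f` modulo `(h, g)`
lifts to an element of `I`, then the kernel of `f` is contained in the closure of `I`. -/
theorem IsCts.exists_sub_mem_filt {f : FPS A →ₗ[K] FPS B} (hf : IsCts f) {f₀ : A →ₗ[K] B}
    (h0 : ∀ a, coeff 0 (f (const a)) = f₀ a) {I : TwoSidedIdeal (FPS A)}
    (hI : ∀ y ∈ I, f y = 0) (hlift : ∀ a, f₀ a = 0 → ∃ y ∈ I, y - const a ∈ filt A 1)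
    {x : FPS A} (hx : f x = 0) (n : ℕ) : ∃ y ∈ I, x - y ∈ filt A n := by
  classical
  induction n with
  | zero => exact ⟨0, I.zero_mem, mem_filt_zero _⟩
  | succ n ih =>
    obtain ⟨y, hy, hxy⟩ := ih
    set w := x - y with hw
    have hfw : f w = 0 := by rw [hw, map_sub, hx, hI y hy, sub_zero]
    have key : ∀ d : Fin 2 →₀ ℕ, ∃ z ∈ I, monomial d (coeff d w) - z ∈ filt A (n + 1) := by
      intro d
      have hmono : ∀ {m : ℕ}, m ≤ d.degree → (monomial d (1 : A) : FPS A) ∈ filt A m := by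
        intro m hm e he
        rw [MvPowerSeries.coeff_monomial, if_neg]
        rintro rfl
        omega
      rcases lt_trichotomy d.degree n with h | h | h
      · exact ⟨0, I.zero_mem, by rw [hxy d h, map_zero, sub_zero]; exact zero_mem _⟩
      · obtain ⟨z, hz, hz'⟩ := hlift (coeff d w) (by
          rw [← hf.coeff_of_mem_filt h0 (by rwa [h]), hfw, map_zero])
        refine ⟨monomial d 1 * z, I.mul_mem_left _ _ hz, ?_⟩
        rw [monomial_eq_mul_const, ← mul_sub, ← neg_sub z, mul_neg]
        exact neg_mem (mul_mem_filt (hmono h.ge) hz')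
      · refine ⟨0, I.zero_mem, ?_⟩
        rw [sub_zero, monomial_eq_mul_const]
        exact mul_mem_filt_left (hmono h) _
    choose z hz hz' using key
    obtain ⟨s, hs⟩ := exists_sub_sum_monomial_mem_filt w (n + 1)
    refine ⟨y + ∑ d ∈ s, z d, I.add_mem hy (sum_mem fun d _ => hz d), ?_⟩
    have h1 := add_mem hs (sum_mem fun d (_ : d ∈ s) => hz' d)
    rw [Finset.sum_sub_distrib] at h1
    convert h1 using 1
    rw [hw]
    abel

end Approximation

/-! ### Continuous maps out of the free algebra -/

section FreeMaps

variable {K : Type*} [Field K] {B : Type*} [Ring B] [Algebra K B]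

/-- Continuous algebra homomorphisms on `K⟨A, H', X, Y⟩[[h, g]]` are determined by the
generators. -/
theorem IsAlgMap.ext_gen {f g : FPS (Free K) →ₗ[K] FPS B} (hf : IsAlgMap f) (hg : IsAlgMap g)
    (h : ∀ i, f (gen K i) = g (gen K i)) (x : FPS (Free K)) : f x = g x := by
  refine hf.toIsCts.ext hg.toIsCts (fun a => ?_) x
  induction a using FreeAlgebra.induction with
  | grade0 c => rw [const_algebraMap, map_smul, map_smul, hf.map_one, hg.map_one]
  | grade1 i => exact h i
  | mul a b ha hb => rw [const_mul, hf.map_mul, hg.map_mul, ha, hb]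
  | add a b ha hb =>
    rw [const_eq_constL (K := K), map_add, map_add, map_add]
    exact congrArg₂ _ ha hb

theorem IsAntiMap.ext_gen {f g : FPS (Free K) →ₗ[K] FPS B} (hf : IsAntiMap f) (hg : IsAntiMap g)
    (h : ∀ i, f (gen K i) = g (gen K i)) (x : FPS (Free K)) : f x = g x := by
  refine hf.toIsCts.ext hg.toIsCts (fun a => ?_) x
  induction a using FreeAlgebra.induction with
  | grade0 c => rw [const_algebraMap, map_smul, map_smul, hf.map_one, hg.map_one]
  | grade1 i => exact h i
  | mul a b ha hb => rw [const_mul, hf.map_mul, hg.map_mul, ha, hb]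
  | add a b ha hb =>
    rw [const_eq_constL (K := K), map_add, map_add, map_add]
    exact congrArg₂ _ ha hb

theorem extend_lift_gen (v : Fin 4 → FPS B) (i : Fin 4) :
    extend (FreeAlgebra.lift K v).toLinearMap (gen K i) = v i := by
  rw [gen, extend_const, AlgHom.toLinearMap_apply, FreeAlgebra.lift_ι_apply]

theorem isAntiMap_extend (φ : Free K →ₐ[K] (FPS B)ᵐᵒᵖ) :
    IsAntiMap (extend ((MulOpposite.opLinearEquiv K).symm.toLinearMap ∘ₗ φ.toLinearMap)) where
  toIsCts := isCts_extend _
  map_one := by rw [← const_one, extend_const]; simp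
  map_mul := (isCts_extend _).map_mul_rev_of_const fun a b => by simp [extend_const]

variable [CharZero K]

theorem fsinh_sub_mem_filt {x : FPS B} (hx : x ∈ filt B 1) : fsinh K x - x ∈ filt B 2 := by
  have h1 := evalSeries_sub_mem_filt (PowerSeries.exp K) hx 2
  have h2 := evalSeries_sub_mem_filt (PowerSeries.exp K) (neg_mem hx) 2
  have h3 := smul_mem_filt (1 / 2 : K) (sub_mem h1 h2)
  simp only [Finset.sum_range_succ, Finset.sum_range_zero, PowerSeries.coeff_exp] at h3
  convert h3 using 1
  simp only [fsinh, fexp, pow_zero, pow_one, Nat.factorial]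
  simp
  module

theorem divH_mem_filt {n : ℕ} {x : FPS B} (hx : x ∈ filt B (n + 1)) : divH x ∈ filt B n := by
  intro d hd
  refine hx (d + Finsupp.single 0 1) ?_
  rw [map_add, Finsupp.degree_single]
  omega

theorem divH_sub (x y : FPS B) : divH (x - y) = divH x - divH y := rfl

theorem divH_fsinh_sub_mem_filt (x : FPS B) :
    divH (fsinh K (parH * x)) - x ∈ filt B 1 := by
  have h := divH_mem_filt (fsinh_sub_mem_filt (K := K) (x := parH * x)
    (mul_mem_filt_left parH_mem_filt x))
  rwa [divH_sub, divH_parH_mul] at h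

theorem fcosh_sub_one_mem_filt {x : FPS B} (hx : x ∈ filt B 1) : fcosh K x - 1 ∈ filt B 1 := by
  have h := smul_mem_filt (1 / 2 : K) (add_mem (fexp_sub_one_mem_filt (K := K) hx)
    (fexp_sub_one_mem_filt (K := K) (neg_mem hx)))
  convert h using 1
  rw [fcosh]
  module

variable {C : Type*} [Ring C] [Algebra K C]

theorem IsAlgMap.map_fsinh {f : FPS B →ₗ[K] FPS C} (hf : IsAlgMap f) {x : FPS B}
    (hx : x ∈ filt B 1) : f (fsinh K x) = fsinh K (f x) := by
  rw [fsinh, map_smul, map_sub, hf.map_fexp hx, hf.map_fexp (neg_mem hx), map_neg, fsinh]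

theorem IsAlgMap.map_fcosh {f : FPS B →ₗ[K] FPS C} (hf : IsAlgMap f) {x : FPS B}
    (hx : x ∈ filt B 1) : f (fcosh K x) = fcosh K (f x) := by
  rw [fcosh, map_smul, map_add, hf.map_fexp hx, hf.map_fexp (neg_mem hx), map_neg, fcosh]

theorem IsAlgMap.map_divH_fsinh {f : FPS B →ₗ[K] FPS C} (hf : IsAlgMap f) (x : FPS B) :
    f (divH (fsinh K (parH * x))) = divH (fsinh K (parH * f x)) := by
  rw [hf.toIsCts.map_divH (parH_mul_divH_fsinh K x),
    hf.map_fsinh (mul_mem_filt_left parH_mem_filt x), hf.toIsCts.map_parH]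

end FreeMaps

end JordanianTwist

end

noncomputable section

namespace JordanianTwist

open MvPowerSeries (coeff)

/-! ### The presentation modulo the deformation parameters -/

section ClassicalLimit

variable (K : Type*) [Field K]

theorem coeff_zero_eq_of_sub_const_mem_filt {A : Type*} [Ring A] {x : FPS A} {a : A}
    (h : x - const a ∈ filt A 1) : coeff 0 x = a := by
  classical
  have h0 := h 0 (by simp)
  rwa [map_sub, coeff_const, if_pos rfl, sub_eq_zero] at h0

theorem const_sub {A : Type*} [Ring A] (a b : A) : const (a - b) = const a - const b := by
  simp [const]

theorem const_add {A : Type*} [Ring A] (a b : A) : const (a + b) = const a + const b := by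
  simp [const]

theorem coeff_zero_jA : coeff 0 (jA K) = inc K !![1, 0; 0, 1] :=
  coeff_zero_eq_of_sub_const_mem_filt (by rw [jA, Z, sub_self]; exact zero_mem _)

/-- The classical limit of `present`: the homomorphism `K⟨A, H', X, Y⟩ → U(gl(2))` with
`A ↦ Z`, `H' ↦ H`, `X ↦ X₊`, `Y ↦ X₋`. -/
def classicalPresent : Free K →ₐ[K] U K :=
  FreeAlgebra.lift K ![inc K !![1, 0; 0, 1], inc K !![1, 0; 0, -1], inc K !![0, 1; 0, 0],
    inc K !![0, 0; 1, 0]]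

variable [CharZero K]

theorem matrix_eq_sum (x : Matrix (Fin 2) (Fin 2) K) :
    x = ((x 0 0 + x 1 1) / 2) • !![1, 0; 0, 1] + ((x 0 0 - x 1 1) / 2) • !![1, 0; 0, -1] +
      x 0 1 • !![0, 1; 0, 0] + x 1 0 • !![0, 0; 1, 0] := by
  ext i j
  fin_cases i <;> fin_cases j <;> simp <;> ring

theorem classicalPresent_surjective : Function.Surjective (classicalPresent K) := by
  have hg : ∀ i, (![inc K !![1, 0; 0, 1], inc K !![1, 0; 0, -1], inc K !![0, 1; 0, 0],
      inc K !![0, 0; 1, 0]] : Fin 4 → U K) i ∈ (classicalPresent K).range := fun i =>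
    ⟨FreeAlgebra.ι K i, FreeAlgebra.lift_ι_apply _ i⟩
  intro y
  refine mem_of_inc_mem (classicalPresent K).range (fun x => ?_) y
  rw [matrix_eq_sum K x]
  simp only [map_add, map_smul]
  exact add_mem (add_mem (add_mem (Subalgebra.smul_mem _ (hg 0) _)
    (Subalgebra.smul_mem _ (hg 1) _)) (Subalgebra.smul_mem _ (hg 2) _))
    (Subalgebra.smul_mem _ (hg 3) _)

theorem eσmh_sub_one_mem_filt : eσmh K - 1 ∈ filt (U K) 1 :=
  fexp_sub_one_mem_filt (neg_mem (half_σ_mem_filt K))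

theorem coeff_zero_jH : coeff 0 (jH K) = inc K !![1, 0; 0, -1] :=
  coeff_zero_eq_of_sub_const_mem_filt (by
    have h := mul_mem_filt_left (eσmh_sub_one_mem_filt K) (H K)
    rwa [sub_mul, one_mul] at h)

theorem coeff_zero_jX : coeff 0 (jX K) = inc K !![0, 1; 0, 0] :=
  coeff_zero_eq_of_sub_const_mem_filt (by
    have h := evalSeries_sub_mem_filt (logSeries K) (two_parH_Xp_mem_filt K) 2
    rw [← σ_eq, Finset.sum_range_succ, Finset.sum_range_one] at h
    have e : 2 * parH * Xp K = parH * (2 * Xp K) := by rw [mul_parH, mul_assoc]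
    simp only [logSeries, PowerSeries.coeff_mk, if_true, zero_smul, zero_add, one_ne_zero,
      if_false, Nat.cast_one, inv_one, one_smul, pow_one, e] at h
    have h1 := smul_mem_filt (1 / 2 : K) (divH_mem_filt h)
    rw [divH_sub, divH_parH_mul] at h1
    convert h1 using 1
    rw [two_mul, jX]
    change _ - Xp K = _
    module)

theorem coeff_zero_jY : coeff 0 (jY K) = inc K !![0, 0; 1, 0] :=
  coeff_zero_eq_of_sub_const_mem_filt (by
    have h1 := mul_mem_filt_left (eσmh_sub_one_mem_filt K) (Xm K)
    have h2 := smul_mem_filt (1 / 2 : K) (mul_mem_filt_right (eσmh K) (parH_mem_filt_mul (H K ^ 2)))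
    have h3 := smul_mem_filt (1 / 8 : K)
      (mul_mem_filt_left (parH_mem_filt_mul (eσh K)) (eσm K - 1))
    have h := sub_mem (add_mem h1 h2) h3
    convert h using 1
    rw [jY, mul_add, mul_smul_comm, sub_mul, one_mul]
    change _ - Xm K = _
    abel)

/-- Modulo `(h, g)`, the map `present` is its classical limit. -/
theorem coeff_zero_present_const (a : Free K) :
    coeff 0 (present K (const a)) = classicalPresent K a := by
  rw [present, extend_const, AlgHom.toLinearMap_apply]
  induction a using FreeAlgebra.induction with
  | grade0 c =>
    rw [AlgHom.commutes, AlgHom.commutes, MvPowerSeries.algebraMap_apply]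
    exact MvPowerSeries.coeff_zero_C _
  | grade1 i =>
    rw [FreeAlgebra.lift_ι_apply, classicalPresent, FreeAlgebra.lift_ι_apply]
    fin_cases i
    exacts [coeff_zero_jA K, coeff_zero_jH K, coeff_zero_jX K, coeff_zero_jY K]
  | mul a b ha hb =>
    rw [map_mul (FreeAlgebra.lift K _), map_mul (classicalPresent K), ← ha, ← hb]
    exact map_mul MvPowerSeries.constantCoeff _ _
  | add a b ha hb => rw [map_add, map_add, map_add, ha, hb]

/-- The ideal of constant terms of elements of `relIdeal`. -/
def constIdeal : Ideal (Free K) where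
  carrier := {a | ∃ y ∈ relIdeal K, y - const a ∈ filt (Free K) 1}
  zero_mem' := ⟨0, (relIdeal K).zero_mem, by
    rw [const_eq_constL (K := K), map_zero, sub_zero]; exact zero_mem _⟩
  add_mem' := by
    rintro a b ⟨y, hy, hya⟩ ⟨z, hz, hzb⟩
    refine ⟨y + z, (relIdeal K).add_mem hy hz, ?_⟩
    rw [const_eq_constL (K := K), map_add, add_sub_add_comm]
    exact add_mem hya hzb
  smul_mem' := by
    rintro c a ⟨y, hy, hya⟩
    refine ⟨const c * y, (relIdeal K).mul_mem_left _ _ hy, ?_⟩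
    rw [smul_eq_mul, const_mul, ← mul_sub]
    exact mul_mem_filt_right _ hya

instance : (constIdeal K).IsTwoSided where
  mul_mem_of_left := by
    rintro a b ⟨y, hy, hya⟩
    refine ⟨y * const b, (relIdeal K).mul_mem_right _ _ hy, ?_⟩
    rw [const_mul, ← sub_mul]
    exact mul_mem_filt_left hya _

theorem mem_constIdeal_of_relator {r : FPS (Free K)} {a : Free K}
    (hr : r ∈ relators K (gen K 0) (gen K 1) (gen K 2) (gen K 3))
    (h : r - const a ∈ filt (Free K) 1) : a ∈ constIdeal K :=
  ⟨r, TwoSidedIdeal.subset_span hr, h⟩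

/-- The image of a generator in the quotient of the free algebra by `constIdeal`. -/
def quotGen (i : Fin 4) : Free K ⧸ constIdeal K :=
  Ideal.Quotient.mk (constIdeal K) (FreeAlgebra.ι K i)

theorem quotGen_XY : quotGen K 2 * quotGen K 3 = quotGen K 3 * quotGen K 2 + quotGen K 1 := by
  rw [← sub_eq_zero, ← sub_sub]
  simp only [quotGen, ← map_mul, ← map_sub]
  rw [Ideal.Quotient.eq_zero_iff_mem]
  refine mem_constIdeal_of_relator K (Or.inl rfl) ?_
  simp only [const_sub, const_mul]
  convert zero_mem (filt (Free K) 1) using 1; exact sub_self _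

theorem quotGen_HX :
    quotGen K 1 * quotGen K 2 = quotGen K 2 * quotGen K 1 + (quotGen K 2 + quotGen K 2) := by
  rw [← sub_eq_zero, ← sub_sub]
  simp only [quotGen, ← map_mul, ← map_sub, ← map_add]
  rw [Ideal.Quotient.eq_zero_iff_mem]
  refine mem_constIdeal_of_relator K (Or.inr (Or.inl rfl)) ?_
  have h := neg_mem (mul_mem_filt_right 2 (divH_fsinh_sub_mem_filt (K := K) (gen K 2)))
  convert h using 1
  simp only [const_sub, const_add, const_mul, gen]
  noncomm_ring

theorem quotGen_HY :
    quotGen K 1 * quotGen K 3 = quotGen K 3 * quotGen K 1 - (quotGen K 3 + quotGen K 3) := by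
  rw [← sub_eq_zero, ← sub_add]
  simp only [quotGen, ← map_mul, ← map_sub, ← map_add]
  rw [Ideal.Quotient.eq_zero_iff_mem]
  refine mem_constIdeal_of_relator K (Or.inr (Or.inr (Or.inl rfl))) ?_
  have h := fcosh_sub_one_mem_filt (K := K) (parH_mem_filt_mul (gen K 2))
  convert add_mem (mul_mem_filt_right (gen K 3) h) (mul_mem_filt_left h (gen K 3)) using 1
  simp only [const_sub, const_add, const_mul, gen]
  noncomm_ring

theorem quotGen_A (i : Fin 4) : quotGen K 0 * quotGen K i = quotGen K i * quotGen K 0 := by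
  rw [← sub_eq_zero]
  simp only [quotGen, ← map_mul, ← map_sub]
  rw [Ideal.Quotient.eq_zero_iff_mem]
  fin_cases i
  · simp
  · refine mem_constIdeal_of_relator K (Or.inr (Or.inr (Or.inr (Or.inr (Or.inr rfl))))) ?_
    simp only [const_sub, const_mul]
    convert zero_mem (filt (Free K) 1) using 1; exact sub_self _
  · refine mem_constIdeal_of_relator K (Or.inr (Or.inr (Or.inr (Or.inl rfl)))) ?_
    simp only [const_sub, const_mul]
    convert zero_mem (filt (Free K) 1) using 1; exact sub_self _
  · refine mem_constIdeal_of_relator K (Or.inr (Or.inr (Or.inr (Or.inr (Or.inl rfl))))) ?_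
    simp only [const_sub, const_mul]
    convert zero_mem (filt (Free K) 1) using 1; exact sub_self _

/-- The classical limits of the Jordanian relations are the relations of `gl(2)`, so `gl(2)` maps
to the quotient of the free algebra by `constIdeal`. -/
def quotLieHom : Matrix (Fin 2) (Fin 2) K →ₗ⁅K⁆ Free K ⧸ constIdeal K where
  toFun x := ((x 0 0 + x 1 1) / 2) • quotGen K 0 + ((x 0 0 - x 1 1) / 2) • quotGen K 1 +
    x 0 1 • quotGen K 2 + x 1 0 • quotGen K 3
  map_add' x y := by
    simp only [Matrix.add_apply]
    module
  map_smul' c x := by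
    simp only [Matrix.smul_apply, smul_eq_mul, RingHom.id_apply]
    module
  map_lie' {x y} := by
    simp only [LieRing.of_associative_ring_bracket, Matrix.sub_apply, Matrix.mul_apply,
      Fin.sum_univ_two, mul_add, add_mul, smul_mul_assoc, mul_smul_comm, quotGen_A, quotGen_XY,
      quotGen_HX, quotGen_HY]
    module

theorem mem_constIdeal_of_classicalPresent_eq_zero {a : Free K} (ha : classicalPresent K a = 0) :
    a ∈ constIdeal K := by
  have h : (UniversalEnvelopingAlgebra.lift K (quotLieHom K)).comp (classicalPresent K) =
      Ideal.Quotient.mkₐ K (constIdeal K) := by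
    refine FreeAlgebra.hom_ext (funext fun i => ?_)
    rw [Function.comp_apply, Function.comp_apply, AlgHom.comp_apply, classicalPresent,
      FreeAlgebra.lift_ι_apply]
    change _ = quotGen K i
    fin_cases i <;>
    · simp only [Fin.zero_eta, Fin.mk_one, Fin.reduceFinMk, Matrix.cons_val]
      erw [UniversalEnvelopingAlgebra.lift_ι_apply]
      simp [quotLieHom]
  rw [← Ideal.Quotient.eq_zero_iff_mem, ← Ideal.Quotient.mkₐ_eq_mk K, ← h, AlgHom.comp_apply, ha,
    map_zero]

end ClassicalLimit

end JordanianTwist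

end

noncomputable section

namespace JordanianTwist

open MvPowerSeries (coeff)

/-! ### The Jordanian presentation -/

section Presentation

variable (K : Type*) [Field K] [CharZero K]

theorem isAlgMap_present : IsAlgMap (present K) := isAlgMap_extend _

theorem present_gen (i : Fin 4) : present K (gen K i) = ![jA K, jH K, jX K, jY K] i :=
  extend_lift_gen _ i

theorem present_gen_zero : present K (gen K 0) = jA K := present_gen K 0

theorem present_gen_one : present K (gen K 1) = jH K := present_gen K 1

theorem present_gen_two : present K (gen K 2) = jX K := present_gen K 2

theorem present_gen_three : present K (gen K 3) = jY K := present_gen K 3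

theorem present_fexp : present K (fexp K (parH * gen K 2)) = fexp K (parH * jX K) := by
  rw [(isAlgMap_present K).map_fexp (parH_mem_filt_mul _), (isAlgMap_present K).map_parH,
    present_gen_two]

theorem present_fexp_neg : present K (fexp K (-(parH * gen K 2))) = fexp K (-(parH * jX K)) := by
  rw [(isAlgMap_present K).map_fexp (neg_mem (parH_mem_filt_mul _)), map_neg,
    (isAlgMap_present K).map_parH, present_gen_two]

theorem present_fcosh : present K (fcosh K (parH * gen K 2)) = fcosh K (parH * jX K) := by
  rw [(isAlgMap_present K).map_fcosh (parH_mem_filt_mul _), (isAlgMap_present K).map_parH,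
    present_gen_two]

theorem present_divH_fsinh :
    present K (divH (fsinh K (parH * gen K 2))) = divH (fsinh K (parH * jX K)) := by
  rw [(isAlgMap_present K).map_divH_fsinh, present_gen_two]

theorem present_relator {r : FPS (Free K)}
    (hr : r ∈ relators K (gen K 0) (gen K 1) (gen K 2) (gen K 3)) : present K r = 0 := by
  have hm := (isAlgMap_present K).map_mul
  have hj := jordanianFormulas K
  rcases hr with rfl | rfl | rfl | rfl | rfl | rfl
  · simp only [map_sub, hm, present_gen_one, present_gen_two, present_gen_three]
    rw [hj.X_Y, sub_self]
  · simp only [two_mul, map_sub, map_add, hm, present_gen_one, present_gen_two,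
      present_divH_fsinh]
    rw [hj.H_X, two_mul, sub_self]
  · simp only [map_sub, map_add, hm, present_gen_one, present_gen_three, present_fcosh]
    rw [hj.H_Y]
    abel
  all_goals
    simp only [map_sub, hm, present_gen_zero, present_gen_one, present_gen_two,
      present_gen_three]
    rw [hj.A_central, sub_self]

theorem present_eq_zero_of_mem_relIdeal {y : FPS (Free K)} (hy : y ∈ relIdeal K) :
    present K y = 0 := by
  have hπ := isAlgMap_present K
  let φ : FPS (Free K) →+* FPS (U K) :=
    { toFun := present K
      map_one' := hπ.map_one
      map_mul' := hπ.map_mul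
      map_zero' := map_zero _
      map_add' := map_add _ }
  have h : relIdeal K ≤ TwoSidedIdeal.ker φ :=
    TwoSidedIdeal.span_le.2 fun r hr => (TwoSidedIdeal.mem_ker φ).2 (present_relator K hr)
  exact (TwoSidedIdeal.mem_ker φ).1 (h hy)

theorem mem_relClosure_iff {x : FPS (Free K)} :
    x ∈ relClosure K ↔ ∀ n, ∃ y ∈ relIdeal K, x - y ∈ filt (Free K) n := by
  simp only [relClosure, Set.mem_ofPred_eq, mem_filt, map_sub, sub_eq_zero]

theorem present_eq_zero_iff (x : FPS (Free K)) : present K x = 0 ↔ x ∈ relClosure K := by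
  have hπ := (isAlgMap_present K).toIsCts
  rw [mem_relClosure_iff]
  constructor
  · exact fun hx n => hπ.exists_sub_mem_filt (f₀ := (classicalPresent K).toLinearMap)
      (coeff_zero_present_const K) (fun y hy => present_eq_zero_of_mem_relIdeal K hy)
      (fun a ha => mem_constIdeal_of_classicalPresent_eq_zero K ha) hx n
  · refine fun h => eq_of_forall_sub_mem_filt fun n => ?_
    obtain ⟨y, hy, hxy⟩ := h n
    have h1 := hπ.map_filt hxy
    rwa [map_sub, present_eq_zero_of_mem_relIdeal K hy] at h1

theorem Δ_present (x : FPS (Free K)) :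
    Δ K (present K x) = tensMap (present K) (present K) (freeΔ K x) := by
  have hπ := isAlgMap_present K
  have ht := isAlgMap_tensMap hπ hπ
  have hj := jordanianFormulas K
  refine ((isAlgMap_Δ K).comp hπ).ext_gen (ht.comp (isAlgMap_extend _)) (fun i => ?_) x
  rw [LinearMap.comp_apply, LinearMap.comp_apply, extend_lift_gen, present_gen]
  have e2 : ∀ y : FPS (Free K ⊗[K] Free K), 2 * parG * y = parG * y + parG * y := fun y => by
    rw [mul_assoc, two_mul]
  have e2' : ∀ y : FPS (U K ⊗[K] U K), 2 * parG * y = parG * y + parG * y := fun y => by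
    rw [mul_assoc, two_mul]
  fin_cases i
  · refine hj.comul_A.trans ?_
    simp only [jorComul, Fin.zero_eta, Matrix.cons_val, map_add,
      tensMap_tens hπ.toIsCts hπ.toIsCts, hπ.map_one, present_gen_zero]
  · refine hj.comul_H.trans ?_
    simp only [jorComul, Fin.mk_one, Matrix.cons_val, map_add, map_sub, e2, e2',
      ht.toIsCts.map_parG, tensMap_tens hπ.toIsCts hπ.toIsCts, hπ.map_mul, present_gen_zero,
      present_gen_one, present_fexp, present_fexp_neg, present_divH_fsinh]
  · refine hj.comul_X.trans ?_
    simp only [jorComul, Fin.reduceFinMk, Matrix.cons_val, map_add,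
      tensMap_tens hπ.toIsCts hπ.toIsCts, hπ.map_one, present_gen_two]
  · refine hj.comul_Y.trans ?_
    simp only [jorComul, Fin.reduceFinMk, Matrix.cons_val, map_add, map_sub, pow_two parG,
      mul_assoc parG parG, ht.toIsCts.map_parG, tensMap_tens hπ.toIsCts hπ.toIsCts, hπ.map_mul,
      hπ.map_pow, present_gen_zero, present_gen_one, present_gen_three, present_fexp,
      present_fexp_neg, present_divH_fsinh]

theorem ε_present (x : FPS (Free K)) : ε K (present K x) = freeε K x := by
  have hj := jordanianFormulas K
  refine ((isAlgMap_ε K).comp (isAlgMap_present K)).ext_gen (isAlgMap_mapL _) (fun i => ?_) x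
  rw [LinearMap.comp_apply, present_gen, gen, mapL_const, AlgHom.toLinearMap_apply,
    FreeAlgebra.lift_ι_apply, const_eq_constL (K := K), map_zero]
  fin_cases i
  exacts [hj.counit_A, hj.counit_H, hj.counit_X, hj.counit_Y]

theorem S_present (x : FPS (Free K)) : S K (present K x) = present K (freeS K x) := by
  have hπ := isAlgMap_present K
  have hj := jordanianFormulas K
  refine ((isAntiMap_S K).comp_isAlgMap hπ).ext_gen
    (hπ.comp_isAntiMap (isAntiMap_extend _)) (fun i => ?_) x
  rw [LinearMap.comp_apply, LinearMap.comp_apply, present_gen, gen.eq_1 K i, extend_const,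
    LinearMap.comp_apply, AlgHom.toLinearMap_apply, FreeAlgebra.lift_ι_apply]
  change _ = present K (jorAntipode K (gen K 0) (gen K 1) (gen K 2) (gen K 3) i)
  have e2 : ∀ y : FPS (Free K), 2 * (parG * y) = parG * y + parG * y := fun y => two_mul _
  have e2' : ∀ y : FPS (U K), 2 * (parG * y) = parG * y + parG * y := fun y => two_mul _
  fin_cases i
  · refine hj.antipode_A.trans ?_
    simp only [jorAntipode, Fin.zero_eta, Matrix.cons_val, map_neg, present_gen_zero]
  · refine hj.antipode_H.trans ?_
    simp only [jorAntipode, Fin.mk_one, Matrix.cons_val, map_neg, map_sub, map_add, mul_assoc, e2,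
      e2', hπ.toIsCts.map_parG, hπ.map_mul, present_gen_zero,
      present_gen_one, present_fexp, present_fexp_neg, present_divH_fsinh]
  · refine hj.antipode_X.trans ?_
    simp only [jorAntipode, Fin.reduceFinMk, Matrix.cons_val, map_neg, present_gen_two]
  · refine hj.antipode_Y.trans ?_
    simp only [jorAntipode, Fin.reduceFinMk, Matrix.cons_val, map_neg, map_add, pow_two parG,
      mul_assoc, hπ.toIsCts.map_parG, hπ.map_mul, hπ.map_pow, present_gen_zero,
      present_gen_one, present_gen_three, present_fexp, present_fexp_neg, present_divH_fsinh]

theorem jordanianPresentation : JordanianPresentation K where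
  map_gen := present_gen K
  map_base := (isAlgMap_present K).map_base
  map_mul := (isAlgMap_present K).map_mul
  surjective := (isAlgMap_present K).toIsCts.surjective
    (f₀ := (classicalPresent K).toLinearMap) (coeff_zero_present_const K)
    (classicalPresent_surjective K)
  kernel := present_eq_zero_iff K
  comul := Δ_present K
  counit := ε_present K
  antipode := S_present K

end Presentation

end JordanianTwist

end

open JordanianTwist

theorem mainTheorem1 (K : Type*) [Field K] [CharZero K] :
    -- every quotient by `h` is the quotient of a series divisible by `h`
    Divisibility K ∧
    -- `F` is a twist element, and the twisted algebra is a triangular Hopf algebra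
    IsTwist (comul₀ K).toLinearMap (counit₀ K).toLinearMap (F K) ∧
    IsUnit (twistU (antipode₀ K) (F K)) ∧
    IsTopHopf (Δ K) (ε K) (S K) ∧
    IsTriangular (Δ K) (twistR (F K)) ∧
    -- the universal R-matrix
    twistR (F K) =
      fexp K ((1 / 2 : K) • (parG * (Z K ⊠[K] divH (σ K)))) *
      fexp K (-((1 / 2 : K) • (σ K ⊠[K] H K))) *
      fexp K ((1 / 2 : K) • (H K ⊠[K] σ K)) *
      fexp K (-((1 / 2 : K) • (parG * (divH (σ K) ⊠[K] Z K)))) ∧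
    -- relations, coproduct, counit and antipode of `Z, H, X₊, X₋`
    GeneratorFormulas K ∧
    -- relations, coproduct, counit and antipode of `A, H', X, Y`
    JordanianFormulas K ∧
    -- the Jordanian Hopf algebra presented by generators and relations is the twisted algebra
    JordanianPresentation K := by
  exact ⟨divisibility K, isTwist_F K,
    isUnit_twistU (isCocommHopf_U K) (F_sub_one_mem_filt K), isTopHopf_U K, isTriangular_U K,
    twistR_F K, generatorFormulas K, jordanianFormulas K, jordanianPresentation K⟩
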